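/- Let $r(n)$ be the number of $(a,b)\in\mathbb Z^2$ with $a^2+b^2=n$. Call $n\ge 1$ $y$-smooth if all its prime factors are at most $y$ (so $1$ is $y$-smooth), and for real $y\ge 2$ and $\sigma>0$ put $$H(\sigma,G;y)=\sum_{\substack{n\ge 1\\ n\ y\text{-smooth}}}\frac{r(n)/4}{n^{\sigma}},\qquad \phi(\sigma,G;y)=\log H(\sigma,G;y),\qquad \phi_1=\frac{\partial\phi}{\partial\sigma}.$$ For $u>1$ let $\xi(u)$ be the unique non-zero real solution of $e^{\xi}=1+u\xi$, and let $\xi(1)=0$. **Proposition 3.2.** For all real $x\ge y\ge 2$ the equation $\log x+\phi_1(\alpha,G;y)=0$ has a unique solution $\alpha=\alpha_G(x,y)>0$ (the saddle point). Moreover, for all sufficiently large real $y$, with absolute implied constants, the following hold uniformly for real $u$ in the ranges indicated: $$\alpha_G(y^u,y)\ \ge\ \frac{2}{\log y}\qquad\Big(1\le u\le \frac{y}{8\log y}\Big),$$ $$\alpha_G(y^u,y)=1+O\Big(\frac1{\log y}\Big)\qquad(1\le u\le 14),$$ $$\alpha_G(y^u,y)\ \le\ 1-\frac{4}{\log y}\qquad(u\ge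 14),$$ $$\alpha_G(y^u,y)=1-\frac{\xi(u)}{\log y}+O\Big(\frac1{(\log y)^2}+\frac uy\Big)\qquad\Big(1\le u\le \frac{y}{8\log y}\Big),$$ $$\alpha_G(y^u,y)=1-\frac{\log(u\log u)}{\log y}+O\Big(\frac{\log\log u}{\log u\,\log y}+\frac1{(\log y)^2}+\frac uy\Big)\qquad\Big(3\le u\le \frac{y}{8\log y}\Big).$$ -/

import Mathlib

namespace GaussSmooth

/-- `r(n)`: the number of representations of `n` as a sum of two squares of integers, where
different signs and different orders of the summands are counted as different. -/
noncomputable def r (n : ℕ) : ℕ := Set.ncard {z : ℤ × ℤ | z.1 ^ 2 + z.2 ^ 2 = (n : ℤ)}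

/-- The `y`-smooth positive integers: all prime factors are at most `y`
(in particular `1` is `y`-smooth). -/
def smooth (y : ℝ) : Set ℕ := {n | 1 ≤ n ∧ ∀ p : ℕ, p.Prime → p ∣ n → (p : ℝ) ≤ y}

/-- `H(σ, G; y) = ∑_{P(n) ≤ y} (r(n)/4) n^{-σ}`, for real `σ`.
The series converges for every `σ > 0`; only such `σ` are used. -/
noncomputable def H (σ y : ℝ) : ℝ := ∑' n : smooth y, ((r n : ℝ) / 4) / ((n : ℕ) : ℝ) ^ σ

/-- `φ(σ, G; y) = log H(σ, G; y)`. -/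
noncomputable def phi (σ y : ℝ) : ℝ := Real.log (H σ y)

/-- `φ₁(σ, G; y)`: the first partial derivative of `φ(σ, G; y)` with respect to `σ`. -/
noncomputable def phi1 (σ y : ℝ) : ℝ := deriv (fun s : ℝ => phi s y) σ

/-- `α` is a positive solution of the saddle point equation `log x + φ₁(α, G; y) = 0`.
For `x > 1` this forces `φ₁(α, G; y) ≠ 0`, hence differentiability at `α`. -/
def IsSaddlePoint (x y α : ℝ) : Prop := 0 < α ∧ Real.log x + phi1 α y = 0

/-- The saddle point `α_G(x, y)`: the positive solution of the saddle point equation. -/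
noncomputable def alphaG (x y : ℝ) : ℝ := Classical.epsilon fun α : ℝ => IsSaddlePoint x y α

/-- For `u > 1` the equation `e^ξ = 1 + u ξ` has exactly one non-zero real solution. -/
theorem existsUnique_xi {u : ℝ} (hu : 1 < u) :
    ∃! ξ : ℝ, ξ ≠ 0 ∧ Real.exp ξ = 1 + u * ξ := by
  have hpos : ∀ a : ℝ, a ≠ 0 → Real.exp a = 1 + u * a → 0 < a := by
    intro a ha h
    by_contra hn
    have hlt : a < 0 := lt_of_le_of_ne (not_lt.mp hn) ha
    have h1 := Real.add_one_le_exp a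
    nlinarith
  have key : ∀ a b : ℝ, 0 < a → a < b → Real.exp a = 1 + u * a →
      Real.exp b = 1 + u * b → False := by
    intro a b ha hab h1 h2
    have hb : 0 < b := ha.trans hab
    have h := strictConvexOn_exp.2 (Set.mem_univ (0 : ℝ)) (Set.mem_univ b) hb.ne
      (sub_pos.2 ((div_lt_one hb).2 hab)) (div_pos ha hb) (by ring)
    simp only [smul_eq_mul, mul_zero, zero_add, Real.exp_zero, mul_one] at h
    rw [div_mul_cancel₀ _ hb.ne', h1, h2] at h
    have h3 : 1 - a / b + a / b * (1 + u * b) = 1 + u * a := by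
      field_simp
      ring
    linarith
  have hlog : 0 < Real.log u := Real.log_pos hu
  have hu0 : 0 < u := by linarith
  have hle : Real.log u ≤ 2 * u := by
    have := Real.log_le_sub_one_of_pos hu0
    linarith
  have hneg : Real.exp (Real.log u) - 1 - u * Real.log u ≤ 0 := by
    rw [Real.exp_log hu0]
    have h := Real.one_sub_inv_le_log_of_pos hu0
    have h2 : u * (1 - u⁻¹) = u - 1 := by field_simp
    nlinarith [mul_le_mul_of_nonneg_left h hu0.le]
  have hge : 0 ≤ Real.exp (2 * u) - 1 - u * (2 * u) := by
    have := Real.quadratic_le_exp_of_nonneg (x := 2 * u) (by linarith)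
    nlinarith
  have hcont : ContinuousOn (fun t : ℝ => Real.exp t - 1 - u * t)
      (Set.Icc (Real.log u) (2 * u)) := by fun_prop
  obtain ⟨ξ, hξ, h0⟩ := intermediate_value_Icc hle hcont ⟨hneg, hge⟩
  have hξ0 : 0 < ξ := hlog.trans_le hξ.1
  refine ⟨ξ, ⟨hξ0.ne', ?_⟩, ?_⟩
  · have h0' : Real.exp ξ - 1 - u * ξ = 0 := h0
    linarith
  · rintro b ⟨hb0, hb⟩
    have h0' : Real.exp ξ = 1 + u * ξ := by
      have h00 : Real.exp ξ - 1 - u * ξ = 0 := h0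
      linarith
    have hbpos := hpos b hb0 hb
    rcases lt_trichotomy b ξ with h | h | h
    · exact (key b ξ hbpos h hb h0').elim
    · exact h
    · exact (key ξ b hξ0 h h0' hb).elim

open Classical in
/-- `ξ(u)`: for `u > 1` the non-zero solution of `e^ξ = 1 + u ξ`; also `ξ(1) = 0`.
(The value `0` for `u < 1` is never used.) -/
noncomputable def xi (u : ℝ) : ℝ := if h : 1 < u then (existsUnique_xi h).choose else 0

end GaussSmooth

/-! The function r/4 counts the ideals of norm n in the Gaussian integers. Hence it is
multiplicative, and H is a finite Euler product over p ≤ y, valid for every σ > 0 (`H_eq_prod`). The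
logarithmic derivative turns the saddle point equation into `saddleSum y α = log x`, where
`saddleSum y` is a finite sum of positive strictly decreasing functions that tends to infinity at 0+
and to 0 at infinity. This gives existence and uniqueness. All bounds for α come from evaluating
this sum and using its monotonicity.

Write σ = 1 - w / log y and E(w) = (e^w - 1) / w, which is `expMean w`. The primes p ≡ 1 (mod 4), of
weight 2 log p, give the main term, the integral of t^(-σ) over [1, y], which equals E(w) log y. The
prime 2, the inert primes and the higher powers add only O(E(w) (1 + y^(-σ) log y)) when σ ≥ 2 / log
y and w ≥ -1 (`exists_saddleSum_bounds`). For x = y^u the equation therefore reads E(w) ≈ u, while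
E(ξ(u)) = u exactly. Since E grows at a rate proportional to its size (`expMean_add_ge`), w is close
to ξ(u) (`abs_sub_xi_le`). The one-sided bounds on α come from testing the sum at σ = 2 / log y and
at σ = 1 - 4 / log y.

The arithmetic input is the prime number theorem for the class 1 modulo 4 with relative error O((log
x)^(-4/3)) (`exists_abs_splitPsi_sub_le`). An exponent above 1 makes the error integrable against dx
/ x, so it costs only O(E(w)). Near Re s = 1 the character series modulo 4 and their derivatives up
to the third are O(|t|^(1/50)), by Euler-Maclaurin summation and Cauchy's estimate. The 3-4-1
inequality bounds the series from below, so the logarithmic derivatives and their first two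
derivatives are O(|t|^(2/5)). The Mellin transform of log² x (ψ(x) - x) is then square-integrable on
vertical lines, uniformly as they approach Re s = 1, where ψ is `splitPsi`. Plancherel's formula
converts this into an L² bound in log x, and the monotonicity of ψ converts the L² bound into a
pointwise one. -/

namespace GaussSmooth

open GaussianInt

/-! ### Sums of two squares through factorisation in the Gaussian integers. -/

/-- The Gaussian integers of norm `n`. -/
def normSet (n : ℕ) : Set GaussianInt := {z | Zsqrtd.norm z = (n : ℤ)}

theorem r_eq_ncard_normSet (n : ℕ) : r n = (normSet n).ncard := by
  unfold r normSet
  rw [← Set.ncard_image_of_injective (f := fun z : GaussianInt => (z.re, z.im))]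
  · congr 1
    ext ⟨a, b⟩
    simp only [Set.mem_ofPred_eq, Set.mem_image, Prod.mk.injEq]
    constructor
    · intro h
      exact ⟨⟨a, b⟩, by rw [Zsqrtd.norm_def]; simp; linarith, rfl, rfl⟩
    · rintro ⟨z, hz, rfl, rfl⟩
      rw [Zsqrtd.norm_def] at hz
      linarith
  · intro z w h
    simp only [Prod.mk.injEq] at h
    exact Zsqrtd.ext h.1 h.2

theorem finite_normSet (n : ℕ) : (normSet n).Finite := by
  have hfin : ((Set.Icc (-(n : ℤ)) n) ×ˢ (Set.Icc (-(n : ℤ)) n)).Finite :=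
    (Set.finite_Icc _ _).prod (Set.finite_Icc _ _)
  refine Set.Finite.of_injOn (f := fun z : GaussianInt => (z.re, z.im)) ?_ ?_ hfin
  · intro z hz
    have hz' : z.re * z.re + z.im * z.im = n := by
      have := hz
      simp only [normSet, Set.mem_ofPred_eq, Zsqrtd.norm_def] at this
      linarith
    simp only [Set.mem_prod, Set.mem_Icc]
    refine ⟨⟨?_, ?_⟩, ?_, ?_⟩ <;> nlinarith [sq_nonneg z.re, sq_nonneg z.im,
      Int.le_self_sq z.re, Int.le_self_sq z.im, Int.le_self_sq (-z.re), Int.le_self_sq (-z.im)]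
  · intro z _ w _ h
    simp only [Prod.mk.injEq] at h
    exact Zsqrtd.ext h.1 h.2

theorem ncard_mul_image (w : GaussianInt) (hw : w ≠ 0) (s : Set GaussianInt) :
    ((w * ·) '' s).ncard = s.ncard :=
  Set.ncard_image_of_injective _ (mul_right_injective₀ hw)

theorem r_one : r 1 = 4 := by
  have h : {z : ℤ × ℤ | z.1 ^ 2 + z.2 ^ 2 = ((1 : ℕ) : ℤ)} =
      ((({(1, 0), (-1, 0), (0, 1), (0, -1)} : Finset (ℤ × ℤ))) : Set (ℤ × ℤ)) := by
    ext ⟨a, b⟩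
    simp only [Set.mem_ofPred_eq, Finset.coe_insert, Finset.coe_singleton, Set.mem_insert_iff,
      Set.mem_singleton_iff, Prod.mk.injEq, Nat.cast_one]
    constructor
    · intro h
      have ha : -1 ≤ a ∧ a ≤ 1 := by constructor <;> nlinarith [sq_nonneg b]
      have hb : -1 ≤ b ∧ b ≤ 1 := by constructor <;> nlinarith [sq_nonneg a]
      obtain ⟨ha1, ha2⟩ := ha
      obtain ⟨hb1, hb2⟩ := hb
      interval_cases a <;> interval_cases b <;> simp_all
    · rintro (⟨rfl, rfl⟩ | ⟨rfl, rfl⟩ | ⟨rfl, rfl⟩ | ⟨rfl, rfl⟩) <;> norm_num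
  rw [r, h, Set.ncard_coe_finset]
  rfl

/-- If `w` has norm `p` and every element of norm `p * n` is divisible by `w`, then multiplication
by `w` matches the elements of norm `n` with those of norm `p * n`. -/
theorem r_mul_of_forall_dvd {w : GaussianInt} {p n : ℕ} (hp : p ≠ 0)
    (hw : Zsqrtd.norm w = (p : ℤ)) (h : ∀ z ∈ normSet (p * n), w ∣ z) : r (p * n) = r n := by
  have hw0 : w ≠ 0 := by
    rintro rfl
    simp [Zsqrtd.norm_def] at hw
    exact hp (by exact_mod_cast hw.symm)
  rw [r_eq_ncard_normSet, r_eq_ncard_normSet, ← ncard_mul_image w hw0 (normSet n)]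
  congr 1
  ext z
  constructor
  · intro hz
    obtain ⟨v, rfl⟩ := h z hz
    refine ⟨v, ?_, rfl⟩
    have hz' : Zsqrtd.norm (w * v) = ((p * n : ℕ) : ℤ) := hz
    rw [Zsqrtd.norm_mul, hw, Nat.cast_mul] at hz'
    exact mul_left_cancel₀ (by exact_mod_cast hp) hz'
  · rintro ⟨v, hv, rfl⟩
    show Zsqrtd.norm (w * v) = ((p * n : ℕ) : ℤ)
    have hv' : Zsqrtd.norm v = (n : ℤ) := hv
    rw [Zsqrtd.norm_mul, hw, hv', Nat.cast_mul]

/-- The prime 2 is ramified: a² + b² even forces a ≡ b (mod 2), and this is exactly divisibility by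
1 + i. -/
theorem r_two_mul (n : ℕ) : r (2 * n) = r n := by
  refine r_mul_of_forall_dvd (w := ⟨1, 1⟩) two_ne_zero (by simp [Zsqrtd.norm_def]) ?_
  rintro ⟨a, b⟩ hz
  have hz' : a * a + b * b = 2 * n := by
    have := hz
    simp only [normSet, Set.mem_ofPred_eq, Zsqrtd.norm_def] at this
    push_cast at this
    linarith
  have h2 : (2 : ℤ) ∣ a + b := by
    have h : (2 : ℤ) ∣ (a + b) * (a + b) := ⟨n + a * b, by linarith⟩
    rcases Int.prime_two.dvd_or_dvd h with h | h <;> exact h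
  obtain ⟨k, hk⟩ := h2
  refine ⟨⟨k, b - k⟩, ?_⟩
  ext
  · simp; linarith
  · simp

theorem dvd_or_dvd_star {w z : GaussianInt} (hw : Prime w) (h : w ∣ (Zsqrtd.norm z : GaussianInt)) :
    w ∣ z ∨ w ∣ star z := by
  rw [Zsqrtd.norm_eq_mul_conj] at h
  exact hw.dvd_or_dvd h

theorem star_dvd_star {w z : GaussianInt} (h : w ∣ z) : star w ∣ star z := by
  obtain ⟨v, rfl⟩ := h
  exact ⟨star v, by rw [star_mul, mul_comm]⟩

section Inert

variable {p : ℕ} [hp : Fact p.Prime] (hp3 : p % 4 = 3)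
include hp3

/-- An inert p is a Gaussian prime dividing z times its conjugate, and p is its own conjugate, so
both alternatives give p ∣ z. -/
theorem inert_dvd {n : ℕ} {z : GaussianInt} (hz : z ∈ normSet (p * n)) : (p : GaussianInt) ∣ z := by
  have hpr := prime_of_nat_prime_of_mod_four_eq_three p hp3
  have hz' : Zsqrtd.norm z = ((p * n : ℕ) : ℤ) := hz
  have h : (p : GaussianInt) ∣ (Zsqrtd.norm z : GaussianInt) := by
    rw [hz']
    exact ⟨n, by push_cast; ring⟩
  rcases dvd_or_dvd_star hpr h with h | h
  · exact h
  · have := star_dvd_star h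
    simpa using this

theorem r_inert_sq_mul (n : ℕ) : r (p * p * n) = r n := by
  refine r_mul_of_forall_dvd (w := (p : GaussianInt)) (mul_ne_zero hp.1.ne_zero hp.1.ne_zero)
    (by rw [Zsqrtd.norm_natCast]; push_cast; ring) ?_
  intro z hz
  rw [mul_assoc] at hz
  exact inert_dvd hp3 hz

theorem r_inert_mul {n : ℕ} (hn : ¬ p ∣ n) : r (p * n) = 0 := by
  rw [r_eq_ncard_normSet, Set.ncard_eq_zero (finite_normSet _), Set.eq_empty_iff_forall_notMem]
  intro z hz
  obtain ⟨v, rfl⟩ := inert_dvd hp3 hz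
  have hz' : Zsqrtd.norm ((p : GaussianInt) * v) = ((p * n : ℕ) : ℤ) := hz
  rw [Zsqrtd.norm_mul, Zsqrtd.norm_natCast, Nat.cast_mul, mul_assoc] at hz'
  have h2 := mul_left_cancel₀ (by exact_mod_cast hp.1.ne_zero : (p : ℤ) ≠ 0) hz'
  apply hn
  exact_mod_cast (Dvd.intro _ h2 : (p : ℤ) ∣ n)

end Inert

theorem prime_of_norm_prime {w : GaussianInt} {p : ℕ} (hp : p.Prime)
    (hw : Zsqrtd.norm w = (p : ℤ)) : Prime w := by
  rw [← irreducible_iff_prime]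
  have hn : w.norm.natAbs = p := by rw [hw]; simp
  constructor
  · intro h
    rw [← Zsqrtd.norm_eq_one_iff, hn] at h
    exact hp.one_lt.ne' h
  · rintro a b rfl
    rw [Zsqrtd.norm_mul, Int.natAbs_mul] at hn
    rw [← Zsqrtd.norm_eq_one_iff, ← Zsqrtd.norm_eq_one_iff]
    rw [← hn] at hp
    rcases Nat.prime_mul_iff.1 hp with h | h
    · exact Or.inr h.2
    · exact Or.inl h.2

section Split

variable {p : ℕ} [hp : Fact p.Prime] (hp1 : p % 4 = 1)
include hp1

/-- The two primes above a split p are not associated. If w = a + bi divided its conjugate it would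
divide 2a; taking norms gives p ∣ a, which is impossible when a² + b² = p. -/
theorem exists_norm_eq_not_dvd_star :
    ∃ w : GaussianInt, Zsqrtd.norm w = (p : ℤ) ∧ Prime w ∧ Prime (star w) ∧ ¬ w ∣ star w := by
  obtain ⟨a, b, hab⟩ := Nat.Prime.sq_add_sq (p := p) (by omega)
  have hw : Zsqrtd.norm (⟨a, b⟩ : GaussianInt) = (p : ℤ) := by
    rw [Zsqrtd.norm_def, ← hab]; push_cast; ring
  have hw' : Zsqrtd.norm (star (⟨a, b⟩ : GaussianInt)) = (p : ℤ) := by rw [Zsqrtd.norm_conj, hw]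
  have hp2 := prime_of_norm_prime hp.1 hw
  refine ⟨⟨a, b⟩, hw, hp2, prime_of_norm_prime hp.1 hw', ?_⟩
  intro hdvd
  have hsum : (⟨a, b⟩ : GaussianInt) ∣ ((2 * a : ℕ) : GaussianInt) := by
    have : ((2 * a : ℕ) : GaussianInt) = ⟨a, b⟩ + star (⟨a, b⟩ : GaussianInt) := by
      ext <;> simp; ring
    rw [this]
    exact dvd_add dvd_rfl hdvd
  obtain ⟨v, hv⟩ := hsum
  have hnorm := congrArg Zsqrtd.norm hv
  rw [Zsqrtd.norm_mul, hw, Zsqrtd.norm_natCast] at hnorm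
  have hdv : p ∣ (2 * a) * (2 * a) := by exact_mod_cast (Dvd.intro _ hnorm.symm)
  have h2a : p ∣ 2 * a := by
    rcases (Nat.Prime.dvd_mul hp.1).1 hdv with h | h <;> exact h
  have hpa : p ∣ a := by
    rcases (Nat.Prime.dvd_mul hp.1).1 h2a with h | h
    · have := Nat.le_of_dvd (by norm_num) h
      have := hp.1.two_le
      omega
    · exact h
  obtain ⟨c, rfl⟩ := hpa
  have hpp := hp.1.two_le
  rcases Nat.eq_zero_or_pos c with rfl | hc
  · have hb : b ^ 2 = p := by simpa using hab
    have := hp.1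
    rw [← hb] at this
    exact (Nat.Prime.not_prime_pow le_rfl) this
  · nlinarith [Nat.mul_le_mul hpp hc, Nat.zero_le (b ^ 2), Nat.pow_le_pow_left (Nat.le_mul_of_pos_right p hc) 2]

/-- Inclusion-exclusion: an element of norm p²n is divisible by w or by its conjugate, and those
divisible by both are the multiples of p. The result is a second-order recurrence in the power of p.
-/
theorem r_split_mul (n : ℕ) : r (p * (p * n)) + r n = 2 * r (p * n) := by
  obtain ⟨w, hw, hwp, hsp, hnd⟩ := exists_norm_eq_not_dvd_star hp1
  have hws : Zsqrtd.norm (star w) = (p : ℤ) := by rw [Zsqrtd.norm_conj, hw]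
  have hww : w * star w = (p : GaussianInt) := by
    rw [← Zsqrtd.norm_eq_mul_conj, hw]; simp
  have hp0 : (p : ℤ) ≠ 0 := by exact_mod_cast hp.1.ne_zero
  have hp0' : (p : GaussianInt) ≠ 0 := by exact_mod_cast hp.1.ne_zero
  have key : ∀ m (v : GaussianInt), Zsqrtd.norm v = (p : ℤ) → ∀ z, v * z ∈ normSet (p * m) ↔
      z ∈ normSet m := by
    intro m v hv z
    simp only [normSet, Set.mem_ofPred_eq, Zsqrtd.norm_mul, hv, Nat.cast_mul]
    exact mul_right_inj' hp0
  have hunion : normSet (p * (p * n)) =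
      ((w * ·) '' normSet (p * n)) ∪ ((star w * ·) '' normSet (p * n)) := by
    ext z
    constructor
    · intro hz
      have hz' : Zsqrtd.norm z = ((p * (p * n) : ℕ) : ℤ) := hz
      have h : w ∣ (Zsqrtd.norm z : GaussianInt) := by
        rw [hz', show (((p * (p * n) : ℕ) : ℤ) : GaussianInt) = (p : GaussianInt) * (p * n) by
          push_cast; ring, ← hww]
        exact ⟨star w * (w * star w * n), by ring⟩
      rcases dvd_or_dvd_star hwp h with h | h
      · obtain ⟨v, rfl⟩ := h
        exact Or.inl ⟨v, (key _ _ hw v).1 hz, rfl⟩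
      · have h2 := star_dvd_star h
        rw [star_star] at h2
        obtain ⟨v, rfl⟩ := h2
        exact Or.inr ⟨v, (key _ _ hws v).1 hz, rfl⟩
    · rintro (⟨v, hv, rfl⟩ | ⟨v, hv, rfl⟩)
      · exact (key _ _ hw v).2 hv
      · exact (key _ _ hws v).2 hv
  have hinter : ((w * ·) '' normSet (p * n)) ∩ ((star w * ·) '' normSet (p * n)) =
      (((p : GaussianInt) * ·) '' normSet n) := by
    ext z
    constructor
    · rintro ⟨⟨v, hv, rfl⟩, ⟨v', hv', h⟩⟩
      have h' : star w * v' = w * v := h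
      have hd : w ∣ star w * v' := ⟨v, h'⟩
      rcases hwp.dvd_or_dvd hd with h1 | h1
      · exact absurd h1 hnd
      · obtain ⟨t, rfl⟩ := h1
        refine ⟨t, (key _ _ hw t).1 hv', ?_⟩
        show (p : GaussianInt) * t = w * v
        rw [← h', ← hww]; ring
    · rintro ⟨t, ht, rfl⟩
      refine ⟨⟨star w * t, (key _ _ hws t).2 ht, ?_⟩, ⟨w * t, (key _ _ hw t).2 ht, ?_⟩⟩
      · show w * (star w * t) = p * t
        rw [← hww]; ring
      · show star w * (w * t) = p * t
        rw [← hww]; ring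
  have hf := Set.ncard_union_add_ncard_inter ((w * ·) '' normSet (p * n))
    ((star w * ·) '' normSet (p * n)) ((finite_normSet _).image _) ((finite_normSet _).image _)
  rw [← hunion, hinter, ncard_mul_image _ hwp.ne_zero, ncard_mul_image _ hsp.ne_zero,
    ncard_mul_image _ hp0'] at hf
  simp only [r_eq_ncard_normSet]
  omega

/-- The starting value of that recurrence. The covering is the same, but an element divisible by
both primes would force p ∣ n, so the two images are disjoint. -/
theorem r_split_mul_of_not_dvd {n : ℕ} (hn : ¬ p ∣ n) : r (p * n) = 2 * r n := by
  obtain ⟨w, hw, hwp, hsp, hnd⟩ := exists_norm_eq_not_dvd_star hp1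
  have hws : Zsqrtd.norm (star w) = (p : ℤ) := by rw [Zsqrtd.norm_conj, hw]
  have hww : w * star w = (p : GaussianInt) := by
    rw [← Zsqrtd.norm_eq_mul_conj, hw]; simp
  have hp0 : (p : ℤ) ≠ 0 := by exact_mod_cast hp.1.ne_zero
  have key : ∀ m (v : GaussianInt), Zsqrtd.norm v = (p : ℤ) → ∀ z, v * z ∈ normSet (p * m) ↔
      z ∈ normSet m := by
    intro m v hv z
    simp only [normSet, Set.mem_ofPred_eq, Zsqrtd.norm_mul, hv, Nat.cast_mul]
    exact mul_right_inj' hp0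
  have hunion : normSet (p * n) = ((w * ·) '' normSet n) ∪ ((star w * ·) '' normSet n) := by
    ext z
    constructor
    · intro hz
      have hz' : Zsqrtd.norm z = ((p * n : ℕ) : ℤ) := hz
      have h : w ∣ (Zsqrtd.norm z : GaussianInt) := by
        rw [hz', show (((p * n : ℕ) : ℤ) : GaussianInt) = (p : GaussianInt) * n by
          push_cast; ring, ← hww]
        exact ⟨star w * n, by ring⟩
      rcases dvd_or_dvd_star hwp h with h | h
      · obtain ⟨v, rfl⟩ := h
        exact Or.inl ⟨v, (key _ _ hw v).1 hz, rfl⟩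
      · have h2 := star_dvd_star h
        rw [star_star] at h2
        obtain ⟨v, rfl⟩ := h2
        exact Or.inr ⟨v, (key _ _ hws v).1 hz, rfl⟩
    · rintro (⟨v, hv, rfl⟩ | ⟨v, hv, rfl⟩)
      · exact (key _ _ hw v).2 hv
      · exact (key _ _ hws v).2 hv
  have hinter : ((w * ·) '' normSet n) ∩ ((star w * ·) '' normSet n) = ∅ := by
    rw [Set.eq_empty_iff_forall_notMem]
    rintro z ⟨⟨v, hv, rfl⟩, ⟨v', hv', h⟩⟩
    have h' : star w * v' = w * v := h
    rcases hwp.dvd_or_dvd (⟨v, h'⟩ : w ∣ star w * v') with h1 | h1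
    · exact hnd h1
    · obtain ⟨t, rfl⟩ := h1
      have hv2 : Zsqrtd.norm (w * t) = (n : ℤ) := hv'
      rw [Zsqrtd.norm_mul, hw] at hv2
      exact hn (by exact_mod_cast (Dvd.intro _ hv2 : (p : ℤ) ∣ n))
  have hf := Set.ncard_union_add_ncard_inter ((w * ·) '' normSet n)
    ((star w * ·) '' normSet n) ((finite_normSet _).image _) ((finite_normSet _).image _)
  rw [← hunion, hinter, ncard_mul_image _ hwp.ne_zero, ncard_mul_image _ hsp.ne_zero] at hf
  simp only [r_eq_ncard_normSet]
  simp at hf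
  omega

end Split

/-- The number of ideals of norm `p ^ k` of the Gaussian integers. -/
def localCount (p k : ℕ) : ℕ :=
  if p = 2 then 1 else if p % 4 = 1 then k + 1 else if Even k then 1 else 0

theorem r_prime_pow_mul {p : ℕ} (hp : p.Prime) (k : ℕ) {m : ℕ} (hm : ¬ p ∣ m) :
    r (p ^ k * m) = localCount p k * r m := by
  have : Fact p.Prime := ⟨hp⟩
  unfold localCount
  split_ifs with h2 h1 hk
  · subst h2
    induction k with
    | zero => simp
    | succ k ih => rw [pow_succ', mul_assoc, r_two_mul, ih]
  -- The recurrence has order two, so the induction carries two consecutive values.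
  · have : ∀ k, r (p ^ k * m) = (k + 1) * r m ∧ r (p ^ (k + 1) * m) = (k + 2) * r m := by
      intro k
      induction k with
      | zero => simp [r_split_mul_of_not_dvd h1 hm]
      | succ k ih =>
        refine ⟨ih.2, ?_⟩
        have h := r_split_mul h1 (p ^ k * m)
        rw [show p * (p * (p ^ k * m)) = p ^ (k + 1 + 1) * m by ring,
          show p * (p ^ k * m) = p ^ (k + 1) * m by ring, ih.1, ih.2] at h
        nlinarith
    exact (this k).1
  · have h3 : p % 4 = 3 := by have := hp.eq_two_or_odd; omega
    obtain ⟨j, rfl⟩ := hk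
    induction j with
    | zero => simp
    | succ j ih =>
      rw [show p ^ (j + 1 + (j + 1)) * m = p * p * (p ^ (j + j) * m) by ring,
        r_inert_sq_mul h3, ih]
  · have h3 : p % 4 = 3 := by have := hp.eq_two_or_odd; omega
    obtain ⟨j, rfl⟩ := Nat.not_even_iff_odd.1 hk
    rw [zero_mul]
    induction j with
    | zero => simpa using r_inert_mul h3 hm
    | succ j ih =>
      rw [show p ^ (2 * (j + 1) + 1) * m = p * p * (p ^ (2 * j + 1) * m) by ring,
        r_inert_sq_mul h3, ih (by simp)]

theorem r_prime_pow {p : ℕ} (hp : p.Prime) (k : ℕ) : r (p ^ k) = localCount p k * 4 := by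
  have h := r_prime_pow_mul hp k (m := 1) (fun h => hp.one_lt.ne' (Nat.dvd_one.1 h))
  rwa [mul_one, r_one] at h

end GaussSmooth

/-! ### Multiplicativity, the Euler product and its logarithmic derivative. -/

namespace GaussSmooth

/-- This is multiplicativity of r/4, the 4 being the number of units, written without division.
Prime powers are peeled off the first factor by `r_prime_pow_mul`. -/
theorem r_mul_of_coprime {m n : ℕ} (h : m.Coprime n) : 4 * r (m * n) = r m * r n := by
  induction m using Nat.recOnPrimeCoprime generalizing n with
  | zero =>
    obtain rfl : n = 1 := by simpa using h
    rw [mul_one, r_one, mul_comm]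
  | prime_pow p k hp =>
    rcases Nat.eq_zero_or_pos k with rfl | hk
    · rw [pow_zero, one_mul, r_one]
    · have hn : ¬ p ∣ n := fun hd =>
        hp.one_lt.ne' (Nat.Coprime.eq_one_of_dvd (Nat.Coprime.coprime_dvd_left
          (dvd_pow_self p hk.ne') h) hd)
      rw [r_prime_pow_mul hp k hn, r_prime_pow hp]
      ring
  | coprime a b ha hb hab iha ihb =>
    have hb' : b.Coprime n := Nat.Coprime.coprime_mul_left h
    have ha' : a.Coprime (b * n) := Nat.Coprime.mul_right hab (Nat.Coprime.coprime_mul_right h)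
    have h1 := iha ha'
    have h2 := ihb hb'
    have h3 := iha hab
    rw [mul_assoc]
    refine Nat.eq_of_mul_eq_mul_left (show 0 < 4 by norm_num) ?_
    calc 4 * (4 * r (a * (b * n))) = r a * (4 * r (b * n)) := by rw [h1]; ring
      _ = (4 * r (a * b)) * r n := by rw [h2, h3]; ring
      _ = _ := by ring

/-- The closed form of the local factor of the Gaussian zeta function at a rational prime,
as a function of `x = p ^ (-σ)`. -/
noncomputable def localFactor (p : ℕ) (x : ℝ) : ℝ :=
  if p = 2 then (1 - x)⁻¹ else if p % 4 = 1 then (1 - x)⁻¹ ^ 2 else (1 - x ^ 2)⁻¹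

theorem hasSum_localCount (p : ℕ) {x : ℝ} (h0 : 0 ≤ x) (h1 : x < 1) :
    HasSum (fun k => (localCount p k : ℝ) * x ^ k) (localFactor p x) := by
  unfold localCount localFactor
  split_ifs with h2 h4
  · simpa using hasSum_geometric_of_lt_one h0 h1
  · have hx : ‖x‖ < 1 := by rwa [Real.norm_of_nonneg h0]
    have ha := (hasSum_coe_mul_geometric_of_norm_lt_one hx).add (hasSum_geometric_of_lt_one h0 h1)
    convert! ha using 1
    · ext k; push_cast; ring
    · have : (1 - x) ≠ 0 := by linarith
      field_simp
      ring
  · have hx2 : x ^ 2 < 1 := by nlinarith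
    have hg := hasSum_geometric_of_lt_one (sq_nonneg x) hx2
    have hinj : Function.Injective (fun k : ℕ => 2 * k) := fun a b h => by simpa using h
    rw [← hinj.hasSum_iff]
    · convert! hg using 1
      ext k
      simp [pow_mul]
    · intro k hk
      have : ¬ Even k := by
        rintro ⟨j, rfl⟩
        exact hk ⟨j, by simp; ring⟩
      simp [this]

theorem smooth_eq_smoothNumbers (y : ℝ) (hy : 0 ≤ y) : smooth y = (⌊y⌋₊ + 1).smoothNumbers := by
  ext n
  simp only [smooth, Set.mem_ofPred_eq, Nat.mem_smoothNumbers']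
  constructor
  · rintro ⟨h1, h2⟩ p hp hd
    exact Nat.lt_succ_of_le (Nat.le_floor (h2 p hp hd))
  · intro h
    refine ⟨?_, fun p hp hd => (Nat.le_floor_iff hy).1 (Nat.lt_succ_iff.1 (h p hp hd))⟩
    -- Zero is divisible by every prime, in particular by one exceeding ⌊y⌋, so it satisfies no
    -- smoothness condition.
    by_contra hn
    obtain rfl : n = 0 := by omega
    obtain ⟨q, hq, hqp⟩ := Nat.exists_infinite_primes (⌊y⌋₊ + 1)
    exact absurd (h q hqp (dvd_zero q)) (by omega)

/-- The primes up to `y`. -/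
noncomputable def primesUpTo (y : ℝ) : Finset ℕ := (⌊y⌋₊ + 1).primesBelow

theorem mem_primesUpTo {y : ℝ} (hy : 0 ≤ y) {p : ℕ} : p ∈ primesUpTo y ↔ p.Prime ∧ (p : ℝ) ≤ y := by
  rw [primesUpTo, Nat.mem_primesBelow, Nat.lt_succ_iff, Nat.le_floor_iff hy]
  tauto

theorem rpow_neg_lt_one {p : ℕ} (hp : p.Prime) {σ : ℝ} (hσ : 0 < σ) : (p : ℝ) ^ (-σ) < 1 :=
  Real.rpow_lt_one_of_one_lt_of_neg (by exact_mod_cast hp.one_lt) (by linarith)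

/-- Only finitely many primes occur, so the Euler product needs just the convergence of each local
series, that is σ > 0 rather than σ > 1. -/
theorem H_eq_prod {σ y : ℝ} (hσ : 0 < σ) (hy : 0 ≤ y) :
    H σ y = ∏ p ∈ primesUpTo y, localFactor p ((p : ℝ) ^ (-σ)) := by
  set f : ℕ → ℝ := fun n => ((r n : ℝ) / 4) / ((n : ℕ) : ℝ) ^ σ with hf
  have hf1 : f 1 = 1 := by simp [hf, r_one]
  have hmul : ∀ {m n : ℕ}, m.Coprime n → f (m * n) = f m * f n := by
    intro m n h
    have h4 : (4 : ℝ) * r (m * n) = r m * r n := by exact_mod_cast r_mul_of_coprime h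
    simp only [hf, Nat.cast_mul]
    rw [Real.mul_rpow (by positivity) (by positivity)]
    rw [div_mul_div_comm, div_mul_div_comm, ← h4]
    congr 1
    ring
  have hpow : ∀ {p : ℕ}, p.Prime → ∀ k, f (p ^ k) = (localCount p k : ℝ) * ((p : ℝ) ^ (-σ)) ^ k := by
    intro p hp k
    simp only [hf, r_prime_pow hp]
    have hp0 : (0 : ℝ) ≤ p := by positivity
    rw [Nat.cast_pow, ← Real.rpow_natCast, ← Real.rpow_mul hp0, ← Real.rpow_natCast,
      ← Real.rpow_mul hp0, div_eq_mul_inv _ ((p : ℝ) ^ _), ← Real.rpow_neg hp0]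
    push_cast
    rw [show -(k * σ : ℝ) = -σ * k by ring]
    ring
  have hs : ∀ {p : ℕ}, p.Prime → HasSum (fun k => f (p ^ k)) (localFactor p ((p : ℝ) ^ (-σ))) := by
    intro p hp
    simp_rw [hpow hp]
    exact hasSum_localCount p (by positivity) (rpow_neg_lt_one hp hσ)
  have hE := (EulerProduct.summable_and_hasSum_smoothNumbers_prod_primesBelow_tsum hf1 hmul
    (fun hp => (hs hp).summable.norm) (⌊y⌋₊ + 1)).2.tsum_eq
  rw [H, smooth_eq_smoothNumbers y hy, hE]
  refine Finset.prod_congr rfl fun p hp => (hs ?_).tsum_eq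
  exact ((mem_primesUpTo hy).1 hp).1

/-- The contribution of the prime `p` to `-φ₁(σ)`. -/
noncomputable def primeTerm (p : ℕ) (σ : ℝ) : ℝ :=
  if p = 2 then Real.log p / ((p : ℝ) ^ σ - 1)
  else if p % 4 = 1 then 2 * Real.log p / ((p : ℝ) ^ σ - 1)
  else 2 * Real.log p / ((p : ℝ) ^ (2 * σ) - 1)

/-- `-φ₁(σ)` as a sum over primes. -/
noncomputable def saddleSum (y σ : ℝ) : ℝ := ∑ p ∈ primesUpTo y, primeTerm p σ

theorem one_lt_prime_rpow {p : ℕ} (hp : p.Prime) {σ : ℝ} (hσ : 0 < σ) : 1 < (p : ℝ) ^ σ :=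
  Real.one_lt_rpow (by exact_mod_cast hp.one_lt) hσ

theorem hasDerivAt_log_one_sub {p : ℕ} (hp : p.Prime) {σ : ℝ} (hσ : 0 < σ) (c : ℝ) (hc : 0 < c) :
    HasDerivAt (fun s : ℝ => Real.log ((1 - (p : ℝ) ^ (-(c * s)))⁻¹))
      (-(c * Real.log p / ((p : ℝ) ^ (c * σ) - 1))) σ := by
  have hp0 : (0 : ℝ) < p := by exact_mod_cast hp.pos
  have h1 : HasDerivAt (fun s : ℝ => -(c * s)) (-(c * 1)) σ := ((hasDerivAt_id σ).const_mul c).neg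
  have h2 := (h1.const_rpow hp0).const_sub 1
  have hlt := rpow_neg_lt_one hp (mul_pos hc hσ)
  have h3 := (h2.log (by linarith)).neg
  have hgt := one_lt_prime_rpow hp (mul_pos hc hσ)
  convert! h3 using 1
  · ext s
    rw [Real.log_inv]
    rfl
  · rw [Real.rpow_neg hp0.le]
    have : (p : ℝ) ^ (c * σ) - 1 ≠ 0 := by linarith
    have : (p : ℝ) ^ (c * σ) ≠ 0 := by positivity
    field_simp

theorem hasDerivAt_log_localFactor {p : ℕ} (hp : p.Prime) {σ : ℝ} (hσ : 0 < σ) :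
    HasDerivAt (fun s : ℝ => Real.log (localFactor p ((p : ℝ) ^ (-s)))) (-primeTerm p σ) σ := by
  unfold localFactor primeTerm
  have h1 := hasDerivAt_log_one_sub hp hσ 1 one_pos
  simp only [one_mul] at h1
  split_ifs with h2 h4
  · exact h1
  · simp only [Real.log_pow]
    convert! h1.const_mul 2 using 1
    ring
  · convert! hasDerivAt_log_one_sub hp hσ 2 two_pos using 1
    ext s
    rw [← Real.rpow_natCast, ← Real.rpow_mul (by positivity)]
    congr 4
    push_cast; ring

theorem localFactor_ne_zero {p : ℕ} (hp : p.Prime) {σ : ℝ} (hσ : 0 < σ) :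
    localFactor p ((p : ℝ) ^ (-σ)) ≠ 0 := by
  have hlt := rpow_neg_lt_one hp hσ
  have h0 : 0 < (p : ℝ) ^ (-σ) := Real.rpow_pos_of_pos (by exact_mod_cast hp.pos) _
  have h2 : ((p : ℝ) ^ (-σ)) ^ 2 < 1 := by nlinarith
  unfold localFactor
  split_ifs
  · exact inv_ne_zero (by linarith)
  · exact pow_ne_zero _ (inv_ne_zero (by linarith))
  · exact inv_ne_zero (by linarith)

theorem phi1_eq {σ y : ℝ} (hσ : 0 < σ) (hy : 0 ≤ y) : phi1 σ y = -saddleSum y σ := by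
  have heq : (fun s => phi s y) =ᶠ[nhds σ]
      fun s => ∑ p ∈ primesUpTo y, Real.log (localFactor p ((p : ℝ) ^ (-s))) := by
    filter_upwards [lt_mem_nhds hσ] with s hs
    rw [phi, H_eq_prod hs hy, Real.log_prod]
    exact fun p hp => localFactor_ne_zero ((mem_primesUpTo hy).1 hp).1 hs
  rw [phi1, heq.deriv_eq, saddleSum, ← Finset.sum_neg_distrib]
  exact (HasDerivAt.fun_sum fun p hp =>
    hasDerivAt_log_localFactor ((mem_primesUpTo hy).1 hp).1 hσ).deriv

/-! ### Existence and uniqueness of the saddle point. -/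

theorem primeTerm_pos {p : ℕ} (hp : p.Prime) {σ : ℝ} (hσ : 0 < σ) : 0 < primeTerm p σ := by
  have hl : 0 < Real.log p := Real.log_pos (by exact_mod_cast hp.one_lt)
  have h1 := one_lt_prime_rpow hp hσ
  have h2 := one_lt_prime_rpow hp (mul_pos two_pos hσ)
  unfold primeTerm
  split_ifs <;> apply div_pos <;> linarith

theorem primeTerm_lt {p : ℕ} (hp : p.Prime) {σ τ : ℝ} (hσ : 0 < σ) (hστ : σ < τ) :
    primeTerm p τ < primeTerm p σ := by
  have hl : 0 < Real.log p := Real.log_pos (by exact_mod_cast hp.one_lt)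
  have hp1 : (1 : ℝ) < p := by exact_mod_cast hp.one_lt
  have h1 := one_lt_prime_rpow hp hσ
  have h2 := one_lt_prime_rpow hp (mul_pos two_pos hσ)
  have h3 : (p : ℝ) ^ σ < (p : ℝ) ^ τ := Real.rpow_lt_rpow_of_exponent_lt hp1 hστ
  have h4 : (p : ℝ) ^ (2 * σ) < (p : ℝ) ^ (2 * τ) :=
    Real.rpow_lt_rpow_of_exponent_lt hp1 (by linarith)
  unfold primeTerm
  split_ifs <;> apply div_lt_div_of_pos_left <;> linarith

theorem saddleSum_strictAntiOn {y : ℝ} (hy : 2 ≤ y) : StrictAntiOn (saddleSum y) (Set.Ioi 0) := by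
  intro σ hσ τ _ hστ
  have hy0 : 0 ≤ y := by linarith
  -- Here y ≥ 2 matters: the prime 2 keeps the sum nonempty, hence strictly decreasing.
  refine Finset.sum_lt_sum_of_nonempty ⟨2, (mem_primesUpTo hy0).2 ⟨Nat.prime_two, by simpa⟩⟩ ?_
  exact fun p hp => primeTerm_lt ((mem_primesUpTo hy0).1 hp).1 hσ hστ

theorem continuousOn_saddleSum {y : ℝ} (hy : 0 ≤ y) : ContinuousOn (saddleSum y) (Set.Ioi 0) := by
  refine continuousOn_finsetSum _ fun p hp => ?_
  have hp' := ((mem_primesUpTo hy).1 hp).1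
  have hp0 : (p : ℝ) ≠ 0 := by exact_mod_cast hp'.ne_zero
  have h1 : ContinuousOn (fun σ : ℝ => (p : ℝ) ^ σ - 1) (Set.Ioi 0) :=
    (continuousOn_const.rpow continuousOn_id fun _ _ => Or.inl hp0).sub continuousOn_const
  have h2 : ContinuousOn (fun σ : ℝ => (p : ℝ) ^ (2 * σ) - 1) (Set.Ioi 0) :=
    (continuousOn_const.rpow (continuousOn_const.mul continuousOn_id)
      fun _ _ => Or.inl hp0).sub continuousOn_const
  have h1' : ∀ σ ∈ Set.Ioi (0 : ℝ), (p : ℝ) ^ σ - 1 ≠ 0 := fun σ hσ =>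
    (sub_pos.2 (one_lt_prime_rpow hp' hσ)).ne'
  have h2' : ∀ σ ∈ Set.Ioi (0 : ℝ), (p : ℝ) ^ (2 * σ) - 1 ≠ 0 := fun σ hσ =>
    (sub_pos.2 (one_lt_prime_rpow hp' (mul_pos two_pos hσ))).ne'
  unfold primeTerm
  split_ifs
  · exact continuousOn_const.div h1 h1'
  · exact continuousOn_const.div h1 h1'
  · exact continuousOn_const.div h2 h2'

/-- The term log 2 / (2^σ - 1) alone is unbounded as σ tends to 0 from the right. -/
theorem exists_saddleSum_gt {y : ℝ} (hy : 2 ≤ y) (A : ℝ) : ∃ σ > 0, A < saddleSum y σ := by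
  have hy0 : 0 ≤ y := by linarith
  have hlim : Filter.Tendsto (fun σ : ℝ => (2 : ℝ) ^ σ) (nhds 0) (nhds 1) := by
    have h : ContinuousAt (fun σ : ℝ => (2 : ℝ) ^ σ) 0 :=
      continuousAt_const.rpow continuousAt_id (Or.inl two_ne_zero)
    simpa [ContinuousAt] using h
  have hl : 0 < Real.log 2 := Real.log_pos one_lt_two
  set B := |A| + 1 with hB
  have hBpos : 0 < B := by positivity
  have hev := (hlim.eventually (gt_mem_nhds (show (1 : ℝ) < 1 + Real.log 2 / B by
    linarith [div_pos hl hBpos]))).filter_mono (nhdsWithin_le_nhds (s := Set.Ioi 0))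
  obtain ⟨σ, hσ, hσ0⟩ := (hev.and self_mem_nhdsWithin).exists
  refine ⟨σ, hσ0, ?_⟩
  have h2 : primeTerm 2 σ ≤ saddleSum y σ :=
    Finset.single_le_sum (f := fun p => primeTerm p σ)
      (fun p hp => (primeTerm_pos ((mem_primesUpTo hy0).1 hp).1 hσ0).le)
      ((mem_primesUpTo hy0).2 ⟨Nat.prime_two, by simpa⟩)
  have h3 : B < primeTerm 2 σ := by
    have h1 := one_lt_prime_rpow Nat.prime_two hσ0
    simp only [primeTerm, if_true, Nat.cast_ofNat] at h1 ⊢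
    rw [lt_div_iff₀ (by linarith)]
    have : B * ((2 : ℝ) ^ σ - 1) < B * (Real.log 2 / B) :=
      mul_lt_mul_of_pos_left (by linarith) hBpos
    rwa [mul_div_cancel₀ _ hBpos.ne'] at this
  linarith [le_abs_self A]

theorem tendsto_saddleSum {y : ℝ} (hy : 0 ≤ y) :
    Filter.Tendsto (saddleSum y) Filter.atTop (nhds 0) := by
  rw [show (0 : ℝ) = ∑ p ∈ primesUpTo y, (0 : ℝ) by simp]
  refine tendsto_finsetSum _ fun p hp => ?_
  have hp' := ((mem_primesUpTo hy).1 hp).1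
  have hp1 : (1 : ℝ) < p := by exact_mod_cast hp'.one_lt
  have h1 := Filter.tendsto_atTop_add_const_right Filter.atTop (-1)
    (tendsto_rpow_atTop_of_base_gt_one _ hp1)
  have h2 := h1.comp (Filter.tendsto_id.const_mul_atTop (two_pos (α := ℝ)))
  unfold primeTerm
  split_ifs
  · exact h1.const_div_atTop _
  · exact h1.const_div_atTop _
  · exact h2.const_div_atTop _

theorem isSaddlePoint_iff {x y α : ℝ} (hy : 0 ≤ y) :
    IsSaddlePoint x y α ↔ 0 < α ∧ saddleSum y α = Real.log x := by
  unfold IsSaddlePoint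
  constructor
  · rintro ⟨h0, h⟩
    rw [phi1_eq h0 hy] at h
    exact ⟨h0, by linarith⟩
  · rintro ⟨h0, h⟩
    rw [phi1_eq h0 hy]
    exact ⟨h0, by linarith⟩

theorem existsUnique_isSaddlePoint {x y : ℝ} (hy : 2 ≤ y) (hx : 1 < x) :
    ∃! α, IsSaddlePoint x y α := by
  have hy0 : 0 ≤ y := by linarith
  have hlx : 0 < Real.log x := Real.log_pos hx
  obtain ⟨a, ha, hal⟩ := exists_saddleSum_gt hy (Real.log x)
  obtain ⟨b, hbl, hab⟩ := ((((tendsto_saddleSum hy0).eventually (gt_mem_nhds hlx))).and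
    (Filter.eventually_gt_atTop a)).exists
  have hsub : Set.Icc a b ⊆ Set.Ioi 0 := fun t ht => lt_of_lt_of_le ha ht.1
  obtain ⟨α, hα, hαe⟩ := intermediate_value_Icc' hab.le
    ((continuousOn_saddleSum hy0).mono hsub) ⟨hbl.le, hal.le⟩
  refine ⟨α, (isSaddlePoint_iff hy0).2 ⟨hsub hα, hαe⟩, ?_⟩
  intro β hβ
  obtain ⟨hβ0, hβe⟩ := (isSaddlePoint_iff hy0).1 hβ
  exact (saddleSum_strictAntiOn hy).injOn hβ0 (hsub hα) (hβe.trans hαe.symm)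

theorem alphaG_spec {x y : ℝ} (hy : 2 ≤ y) (hx : 1 < x) :
    0 < alphaG x y ∧ saddleSum y (alphaG x y) = Real.log x :=
  (isSaddlePoint_iff (by linarith)).1
    (Classical.epsilon_spec (existsUnique_isSaddlePoint hy hx).exists)

end GaussSmooth

/-! ### Growth of Dirichlet series with regular partial sums near the line Re s = 1. -/

namespace GaussSmooth

open Complex Filter Topology MeasureTheory

section Growth

/-- The error term `∑_{k ≤ t} f k - c t`. -/
noncomputable def sumError (f : ℕ → ℂ) (c : ℂ) (t : ℝ) : ℂ :=
  ∑ k ∈ Finset.Icc 1 ⌊t⌋₊, f k - c * t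

/-- The Mellin transform of `∑_{k ≤ t} f k - c t` over `t > N`. -/
noncomputable def tailMellin (f : ℕ → ℂ) (c : ℂ) (N : ℕ) (s : ℂ) : ℂ :=
  mellin (Set.indicator (Set.Ioi (N : ℝ)) (sumError f c)) (-s)

/-- The Euler-Maclaurin approximation of the Dirichlet series of `f`, cut at `N`. -/
noncomputable def cutSeries (f : ℕ → ℂ) (c : ℂ) (N : ℕ) (s : ℂ) : ℂ :=
  ∑ k ∈ Finset.Icc 1 N, f k * (k : ℂ) ^ (-s) - (∑ k ∈ Finset.Icc 1 N, f k) * (N : ℂ) ^ (-s)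
    + c * (s / (s - 1)) * (N : ℂ) ^ (1 - s) + s * tailMellin f c N s

variable {f : ℕ → ℂ} {c : ℂ} {B : ℝ}

theorem norm_sumError_le (hS : ∀ n : ℕ, ‖∑ k ∈ Finset.Icc 1 n, f k - c * n‖ ≤ B) {t : ℝ}
    (ht : 0 ≤ t) : ‖sumError f c t‖ ≤ B + ‖c‖ := by
  have h1 : sumError f c t = (∑ k ∈ Finset.Icc 1 ⌊t⌋₊, f k - c * (⌊t⌋₊ : ℕ)) +
      c * (((⌊t⌋₊ : ℝ) - t : ℝ) : ℂ) := by
    rw [sumError]; push_cast; ring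
  rw [h1]
  refine (norm_add_le _ _).trans (add_le_add (hS _) ?_)
  rw [norm_mul, norm_real]
  have h2 : ‖(⌊t⌋₊ : ℝ) - t‖ ≤ 1 := by
    rw [Real.norm_eq_abs, abs_le]
    constructor <;> linarith [Nat.floor_le ht, Nat.lt_floor_add_one t]
  nlinarith [norm_nonneg c]

theorem measurable_sumError (f : ℕ → ℂ) (c : ℂ) : Measurable (sumError f c) := by
  have h : Measurable fun n : ℕ => ∑ k ∈ Finset.Icc 1 n, f k := measurable_from_top
  exact (h.comp Nat.measurable_floor).sub (measurable_const.mul Complex.measurable_ofReal)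

theorem locallyIntegrableOn_tail (hS : ∀ n : ℕ, ‖∑ k ∈ Finset.Icc 1 n, f k - c * n‖ ≤ B) (N : ℕ) :
    LocallyIntegrableOn (Set.indicator (Set.Ioi (N : ℝ)) (sumError f c)) (Set.Ioi 0) := by
  have hloc : LocallyIntegrable (fun _ : ℝ => B + ‖c‖) volume := locallyIntegrable_const _
  refine (hloc.mono (((measurable_sumError f c).indicator measurableSet_Ioi).aestronglyMeasurable)
    (Eventually.of_forall fun t => ?_)).locallyIntegrableOn _
  refine le_trans ?_ (le_abs_self _)
  by_cases ht : t ∈ Set.Ioi (N : ℝ)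
  · rw [Set.indicator_of_mem ht]
    exact norm_sumError_le hS ((Nat.cast_nonneg N).trans (le_of_lt ht))
  · rw [Set.indicator_of_notMem ht, norm_zero]
    exact (norm_nonneg _).trans (norm_sumError_le hS le_rfl)

theorem isBigO_tail_top (hS : ∀ n : ℕ, ‖∑ k ∈ Finset.Icc 1 n, f k - c * n‖ ≤ B) (N : ℕ) :
    (Set.indicator (Set.Ioi (N : ℝ)) (sumError f c)) =O[atTop] fun t : ℝ => t ^ (-(0 : ℝ)) := by
  refine Asymptotics.IsBigO.of_bound (B + ‖c‖) ?_
  filter_upwards [eventually_gt_atTop (N : ℝ)] with t ht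
  rw [Set.indicator_of_mem (show t ∈ Set.Ioi (N : ℝ) from ht)]
  simpa using norm_sumError_le hS ((Nat.cast_nonneg N).trans (le_of_lt ht))

theorem isBigO_tail_zero {N : ℕ} (hN : 1 ≤ N) (b : ℝ) :
    (Set.indicator (Set.Ioi (N : ℝ)) (sumError f c)) =O[𝓝[>] 0] fun t : ℝ => t ^ (-b) := by
  have : (Set.indicator (Set.Ioi (N : ℝ)) (sumError f c)) =ᶠ[𝓝[>] 0] fun _ => 0 := by
    filter_upwards [nhdsWithin_le_nhds (gt_mem_nhds (show (0 : ℝ) < N by exact_mod_cast hN))]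
      with t ht
    exact Set.indicator_of_notMem (not_lt.2 (le_of_lt ht)) _
  exact this.trans_isBigO (Asymptotics.isBigO_zero _ _)

theorem differentiableAt_tailMellin (hS : ∀ n : ℕ, ‖∑ k ∈ Finset.Icc 1 n, f k - c * n‖ ≤ B)
    {N : ℕ} (hN : 1 ≤ N) {s : ℂ} (hs : 0 < s.re) : DifferentiableAt ℂ (tailMellin f c N) s := by
  have h : DifferentiableAt ℂ (mellin (Set.indicator (Set.Ioi (N : ℝ)) (sumError f c))) (-s) :=
    mellin_differentiableAt_of_isBigO_rpow (a := 0) (b := -s.re - 1)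
      (locallyIntegrableOn_tail hS N) (isBigO_tail_top hS N) (by simpa using hs)
      (isBigO_tail_zero hN _) (by simp)
  exact h.comp s differentiableAt_id.neg

theorem tailMellin_eq (N : ℕ) (s : ℂ) :
    tailMellin f c N s = ∫ t in Set.Ioi (N : ℝ), (t : ℂ) ^ (-s - 1) * sumError f c t := by
  rw [tailMellin, mellin]
  have : ∀ t : ℝ, (t : ℂ) ^ (-s - 1) • Set.indicator (Set.Ioi (N : ℝ)) (sumError f c) t =
      Set.indicator (Set.Ioi (N : ℝ)) (fun t : ℝ => (t : ℂ) ^ (-s - 1) * sumError f c t) t := by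
    intro t
    by_cases ht : t ∈ Set.Ioi (N : ℝ) <;> simp [ht]
  simp_rw [this]
  rw [setIntegral_indicator measurableSet_Ioi]
  congr 2
  exact Set.inter_eq_right.2 (Set.Ioi_subset_Ioi (Nat.cast_nonneg N))

theorem norm_tailMellin_le (hS : ∀ n : ℕ, ‖∑ k ∈ Finset.Icc 1 n, f k - c * n‖ ≤ B)
    {N : ℕ} (hN : 1 ≤ N) {s : ℂ} (hs : 0 < s.re) :
    ‖tailMellin f c N s‖ ≤ (B + ‖c‖) * ((N : ℝ) ^ (-s.re) / s.re) := by
  have hN0 : (0 : ℝ) < N := by exact_mod_cast hN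
  have hint := integrableOn_Ioi_rpow_of_lt (a := -s.re - 1) (by linarith) hN0
  rw [tailMellin_eq]
  calc ‖∫ t in Set.Ioi (N : ℝ), (t : ℂ) ^ (-s - 1) * sumError f c t‖
      ≤ ∫ t in Set.Ioi (N : ℝ), t ^ (-s.re - 1) * (B + ‖c‖) := by
        refine norm_integral_le_of_norm_le (hint.mul_const _) ?_
        refine (ae_restrict_iff' measurableSet_Ioi).2 (Eventually.of_forall fun t ht => ?_)
        have ht0 : 0 < t := hN0.trans ht
        rw [norm_mul, Complex.norm_cpow_eq_rpow_re_of_pos ht0]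
        simp only [sub_re, neg_re, one_re]
        exact mul_le_mul_of_nonneg_left (norm_sumError_le hS ht0.le) (by positivity)
    _ = _ := by
        rw [integral_mul_const, integral_Ioi_rpow_of_lt (by linarith) hN0]
        rw [show -s.re - 1 + 1 = -s.re by ring, neg_div_neg_eq]
        ring

/-- Abel summation for the part of the series beyond N. The right side makes sense for Re s > 0, s ≠
1, and so continues the series past Re s = 1 with N still free. -/
theorem LSeries_eq_cutSeries (hf : ∀ n, ‖f n‖ ≤ 1)
    (hS : ∀ n : ℕ, ‖∑ k ∈ Finset.Icc 1 n, f k - c * n‖ ≤ B) {N : ℕ} (hN : 1 ≤ N) {s : ℂ}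
    (hs : 1 < s.re) : LSeries f s = cutSeries f c N s := by
  have hN0 : (0 : ℝ) < N := by exact_mod_cast hN
  -- Deleting the first N coefficients makes the Abel integral start at N instead of 1.
  set g : ℕ → ℂ := fun n => if n ≤ N then 0 else f n with hg
  have hsum : LSeriesSummable f s :=
    LSeriesSummable_of_bounded_of_one_lt_re (m := 1) (fun n _ => hf n) hs
  have hgn : ∀ n, ‖g n‖ ≤ 1 := by
    intro n
    simp only [hg]
    split_ifs
    · simp
    · exact hf n
  have hsumg : LSeriesSummable g s :=
    LSeriesSummable_of_bounded_of_one_lt_re (m := 1) (fun n _ => hgn n) hs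
  have hdiff : LSeries f s - LSeries g s = ∑ k ∈ Finset.Icc 1 N, f k * (k : ℂ) ^ (-s) := by
    rw [LSeries, LSeries, ← hsum.tsum_sub hsumg]
    rw [tsum_eq_sum (s := Finset.Icc 1 N)]
    · refine Finset.sum_congr rfl fun k hk => ?_
      obtain ⟨h1, h2⟩ := Finset.mem_Icc.1 hk
      have hk0 : k ≠ 0 := by omega
      simp [hg, LSeries.term_of_ne_zero hk0, h2, cpow_neg, div_eq_mul_inv]
    · intro k hk
      rcases Nat.eq_zero_or_pos k with rfl | hk0
      · simp
      · have : ¬ k ≤ N := fun h => hk (Finset.mem_Icc.2 ⟨hk0, h⟩)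
        simp [hg, LSeries.term_of_ne_zero hk0.ne', this]
  have hpart : ∀ n, ∑ k ∈ Finset.Icc 1 n, g k =
      if n ≤ N then 0 else ∑ k ∈ Finset.Icc 1 n, f k - ∑ k ∈ Finset.Icc 1 N, f k := by
    intro n
    split_ifs with h
    · refine Finset.sum_eq_zero fun k hk => ?_
      have := (Finset.mem_Icc.1 hk).2
      simp only [hg]
      rw [if_pos (by omega)]
    · rw [eq_sub_iff_add_eq]
      have hsub : Finset.Icc 1 N ⊆ Finset.Icc 1 n := Finset.Icc_subset_Icc le_rfl (by omega)
      rw [← Finset.sum_sdiff hsub, ← Finset.sum_sdiff (f := f) hsub,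
        Finset.sum_eq_zero (s := Finset.Icc 1 N) (f := g), add_zero]
      · congr 1
        refine Finset.sum_congr rfl fun k hk => ?_
        simp only [Finset.mem_sdiff, Finset.mem_Icc, not_and] at hk
        simp only [hg]
        rw [if_neg (hk.2 hk.1.1)]
      · intro k hk
        simp only [hg]
        rw [if_pos (Finset.mem_Icc.1 hk).2]
  have hO : (fun n ↦ ∑ k ∈ Finset.Icc 1 n, ‖g k‖) =O[atTop] fun n ↦ (n : ℝ) ^ (1 : ℝ) := by
    refine Asymptotics.IsBigO.of_bound 1 (Eventually.of_forall fun n => ?_)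
    rw [Real.rpow_one, one_mul, Real.norm_of_nonneg (Finset.sum_nonneg fun _ _ => norm_nonneg _),
      Real.norm_of_nonneg (Nat.cast_nonneg n)]
    calc ∑ k ∈ Finset.Icc 1 n, ‖g k‖ ≤ ∑ k ∈ Finset.Icc 1 n, (1 : ℝ) :=
          Finset.sum_le_sum fun k _ => hgn k
      _ = n := by simp
  have hL := LSeries_eq_mul_integral' g zero_le_one hs hO
  have hI1 : IntegrableOn (fun t : ℝ => (t : ℂ) ^ (-s - 1) * sumError f c t) (Set.Ioi (N : ℝ)) := by
    have hint := (integrableOn_Ioi_rpow_of_lt (a := -s.re - 1) (by linarith) hN0).mul_const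
      (B + ‖c‖)
    refine hint.mono' ?_ ?_
    · refine AEStronglyMeasurable.mul ?_ (measurable_sumError f c).aestronglyMeasurable
      refine ContinuousOn.aestronglyMeasurable (fun t ht => ?_) measurableSet_Ioi
      exact (continuousAt_ofReal_cpow_const _ _ (Or.inr (hN0.trans ht).ne')).continuousWithinAt
    · refine (ae_restrict_iff' measurableSet_Ioi).2 (Eventually.of_forall fun t ht => ?_)
      have ht0 : 0 < t := hN0.trans ht
      rw [norm_mul, Complex.norm_cpow_eq_rpow_re_of_pos ht0]
      simp only [sub_re, neg_re, one_re]
      exact mul_le_mul_of_nonneg_left (norm_sumError_le hS ht0.le) (by positivity)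
  have hI2 : IntegrableOn (fun t : ℝ => (t : ℂ) ^ (-s)) (Set.Ioi (N : ℝ)) :=
    integrableOn_Ioi_cpow_of_lt (by simpa using hs) hN0
  have hI3 : IntegrableOn (fun t : ℝ => (t : ℂ) ^ (-s - 1)) (Set.Ioi (N : ℝ)) :=
    integrableOn_Ioi_cpow_of_lt (by simp; linarith) hN0
  have hint : ∫ t in Set.Ioi (1 : ℝ), (∑ k ∈ Finset.Icc 1 ⌊t⌋₊, g k) * (t : ℂ) ^ (-(s + 1)) =
      ∫ t in Set.Ioi (N : ℝ), ((t : ℂ) ^ (-s - 1) * sumError f c t + c * (t : ℂ) ^ (-s) -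
        (∑ k ∈ Finset.Icc 1 N, f k) * (t : ℂ) ^ (-s - 1)) := by
    rw [← integral_indicator measurableSet_Ioi, ← integral_indicator measurableSet_Ioi]
    refine integral_congr_ae ?_
    have hne : ∀ m : ℝ, ∀ᵐ t : ℝ, t ≠ m := fun m => by
      simp [ae_iff]
    filter_upwards [hne N] with t htN
    by_cases ht : (N : ℝ) < t
    · have ht0 : 0 < t := hN0.trans ht
      have ht1 : (1 : ℝ) < t := lt_of_le_of_lt (by exact_mod_cast hN) ht
      rw [Set.indicator_of_mem (show t ∈ Set.Ioi (1 : ℝ) from ht1),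
        Set.indicator_of_mem (show t ∈ Set.Ioi (N : ℝ) from ht), hpart]
      have hcp : (t : ℂ) ^ (-s) = t * (t : ℂ) ^ (-s - 1) := by
        rw [cpow_sub _ _ (by exact_mod_cast ht0.ne'), cpow_one]
        field_simp [show (t : ℂ) ≠ 0 by exact_mod_cast ht0.ne']
      rw [show -(s + 1) = -s - 1 by ring, hcp, sumError]
      split_ifs with h
      · have : ⌊t⌋₊ = N := le_antisymm h (Nat.le_floor ht.le)
        rw [this]; ring
      · ring
    · rw [Set.indicator_of_notMem (show t ∉ Set.Ioi (N : ℝ) from ht)]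
      by_cases ht1 : t ∈ Set.Ioi (1 : ℝ)
      · rw [Set.indicator_of_mem ht1, hpart, if_pos, zero_mul]
        exact Nat.floor_le_of_le (not_lt.1 ht)
      · rw [Set.indicator_of_notMem ht1]
  have hs1 : s - 1 ≠ 0 := by
    intro h
    have := congrArg re h
    simp at this
    linarith
  have hs0 : s ≠ 0 := by
    rintro rfl
    simp at hs
    linarith
  have hI12 : IntegrableOn (fun t : ℝ => (t : ℂ) ^ (-s - 1) * sumError f c t + c * (t : ℂ) ^ (-s))
      (Set.Ioi (N : ℝ)) := hI1.add (hI2.const_mul c)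
  rw [hint, integral_sub hI12 (hI3.const_mul _),
    integral_add hI1 (hI2.const_mul c), integral_const_mul, integral_const_mul,
    integral_Ioi_cpow_of_lt (by simpa using hs) hN0,
    integral_Ioi_cpow_of_lt (by simp; linarith) hN0, ← tailMellin_eq] at hL
  rw [cutSeries, ← hdiff, hL, show -s - 1 + 1 = -s by ring, show -s + 1 = 1 - s by ring]
  have h1s : 1 - s ≠ 0 := by
    intro h
    apply hs1
    linear_combination -h
  push_cast
  rw [show s - 1 = -(1 - s) by ring]
  field_simp
  ring

theorem differentiableAt_cutSeries (hS : ∀ n : ℕ, ‖∑ k ∈ Finset.Icc 1 n, f k - c * n‖ ≤ B)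
    {N : ℕ} (hN : 1 ≤ N) {s : ℂ} (hs : 0 < s.re) (hs1 : s ≠ 1) :
    DifferentiableAt ℂ (cutSeries f c N) s := by
  have hN0 : (N : ℂ) ≠ 0 := Nat.cast_ne_zero.2 (by omega)
  have h1 : DifferentiableAt ℂ (fun s : ℂ => ∑ k ∈ Finset.Icc 1 N, f k * (k : ℂ) ^ (-s)) s := by
    refine DifferentiableAt.fun_sum fun k hk => ?_
    have hk0 : (k : ℂ) ≠ 0 := by
      have := (Finset.mem_Icc.1 hk).1
      exact_mod_cast (by omega : k ≠ 0)
    exact (differentiableAt_fun_id.fun_neg.const_cpow (Or.inl hk0)).const_mul _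
  have h2 : DifferentiableAt ℂ (fun s : ℂ => (∑ k ∈ Finset.Icc 1 N, f k) * (N : ℂ) ^ (-s)) s :=
    (differentiableAt_fun_id.fun_neg.const_cpow (Or.inl hN0)).const_mul _
  have h3a : DifferentiableAt ℂ (fun s : ℂ => s / (s - 1)) s :=
    DifferentiableAt.fun_div (by fun_prop) (by fun_prop) (sub_ne_zero.2 hs1)
  have h3b : DifferentiableAt ℂ (fun s : ℂ => (N : ℂ) ^ (1 - s)) s :=
    DifferentiableAt.const_cpow (by fun_prop) (Or.inl hN0)
  have h3 : DifferentiableAt ℂ (fun s : ℂ => c * (s / (s - 1)) * (N : ℂ) ^ (1 - s)) s :=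
    (h3a.const_mul c).fun_mul h3b
  have h4 : DifferentiableAt ℂ (fun s : ℂ => s * tailMellin f c N s) s :=
    differentiableAt_fun_id.fun_mul (differentiableAt_tailMellin hS hN hs)
  have h5 := ((h1.fun_sub h2).fun_add h3).fun_add h4
  refine h5.congr_of_eventuallyEq (Eventually.of_forall fun z => ?_)
  rw [cutSeries]

/-- With N at least of order |s|, every piece is O(N^(1/50)). One factor N^(1/100) is lost by going
left to Re s = 99/100 and another pays for the harmonic sum. In the tail the factor |s| is absorbed
by N^(-1). -/
theorem norm_cutSeries_le (hf : ∀ n, ‖f n‖ ≤ 1)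
    (hS : ∀ n : ℕ, ‖∑ k ∈ Finset.Icc 1 n, f k - c * n‖ ≤ B) {N : ℕ} (hN : 1 ≤ N) {s : ℂ}
    (hs : 99 / 100 ≤ s.re) (hs1 : 1 / 2 ≤ |s.im|) (hsN : ‖s‖ ≤ 5 * N) :
    ‖cutSeries f c N s‖ ≤ (102 + 3 * ‖c‖ + 10 * (B + ‖c‖)) * (N : ℝ) ^ (1 / 50 : ℝ) := by
  have hN1 : (1 : ℝ) ≤ N := by exact_mod_cast hN
  have hN0 : (0 : ℝ) < N := by linarith
  have hBc : 0 ≤ B + ‖c‖ := (norm_nonneg _).trans (norm_sumError_le hS le_rfl)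
  have hpow : (N : ℝ) ^ (1 / 100 : ℝ) ≤ (N : ℝ) ^ (1 / 50 : ℝ) :=
    Real.rpow_le_rpow_of_exponent_le hN1 (by norm_num)
  have hpow0 : 0 < (N : ℝ) ^ (1 / 50 : ℝ) := by positivity
  have hNs : ‖(N : ℂ) ^ (-s)‖ ≤ (N : ℝ)⁻¹ * (N : ℝ) ^ (1 / 100 : ℝ) := by
    rw [Complex.norm_natCast_cpow_of_pos (by omega), neg_re, ← Real.rpow_neg_one,
      ← Real.rpow_add hN0]
    exact Real.rpow_le_rpow_of_exponent_le hN1 (by linarith)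
  have e1 : ‖∑ k ∈ Finset.Icc 1 N, f k * (k : ℂ) ^ (-s)‖ ≤ 101 * (N : ℝ) ^ (1 / 50 : ℝ) := by
    calc ‖∑ k ∈ Finset.Icc 1 N, f k * (k : ℂ) ^ (-s)‖
        ≤ ∑ k ∈ Finset.Icc 1 N, (N : ℝ) ^ (1 / 100 : ℝ) * ((k : ℝ)⁻¹) := by
          refine norm_sum_le_of_le _ fun k hk => ?_
          obtain ⟨h1, h2⟩ := Finset.mem_Icc.1 hk
          have hk1 : (1 : ℝ) ≤ k := by exact_mod_cast h1
          have hk0 : (0 : ℝ) < k := by linarith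
          rw [norm_mul, Complex.norm_natCast_cpow_of_pos (by omega), neg_re]
          calc ‖f k‖ * (k : ℝ) ^ (-s.re) ≤ 1 * (k : ℝ) ^ (1 / 100 - 1 : ℝ) :=
                mul_le_mul (hf k) (Real.rpow_le_rpow_of_exponent_le hk1 (by linarith))
                  (by positivity) zero_le_one
            _ = (k : ℝ) ^ (1 / 100 : ℝ) * (k : ℝ)⁻¹ := by
                rw [one_mul, Real.rpow_sub hk0, Real.rpow_one, div_eq_mul_inv]
            _ ≤ _ := by
                gcongr
      _ = (N : ℝ) ^ (1 / 100 : ℝ) * ∑ k ∈ Finset.Icc 1 N, (k : ℝ)⁻¹ := by rw [Finset.mul_sum]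
      _ ≤ (N : ℝ) ^ (1 / 100 : ℝ) * (1 + 100 * (N : ℝ) ^ (1 / 100 : ℝ)) := by
          gcongr
          have h := harmonic_le_one_add_log N
          rw [harmonic_eq_sum_Icc] at h
          push_cast at h
          refine h.trans ?_
          have := Real.log_le_rpow_div hN0.le (show (0 : ℝ) < 1 / 100 by norm_num)
          have h100 : (N : ℝ) ^ (1 / 100 : ℝ) / (1 / 100) = 100 * (N : ℝ) ^ (1 / 100 : ℝ) := by ring
          linarith
      _ = (N : ℝ) ^ (1 / 100 : ℝ) + 100 * (N : ℝ) ^ (1 / 50 : ℝ) := by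
          have : (N : ℝ) ^ (1 / 50 : ℝ) = (N : ℝ) ^ (1 / 100 : ℝ) * (N : ℝ) ^ (1 / 100 : ℝ) := by
            rw [← Real.rpow_add hN0]; norm_num
          rw [this]; ring
      _ ≤ _ := by linarith
  have e2 : ‖(∑ k ∈ Finset.Icc 1 N, f k) * (N : ℂ) ^ (-s)‖ ≤ (N : ℝ) ^ (1 / 50 : ℝ) := by
    rw [norm_mul]
    have h1 : ‖∑ k ∈ Finset.Icc 1 N, f k‖ ≤ N := by
      refine (norm_sum_le_of_le _ fun k _ => hf k).trans ?_
      simp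
    calc _ ≤ N * ((N : ℝ)⁻¹ * (N : ℝ) ^ (1 / 100 : ℝ)) := by gcongr
      _ = (N : ℝ) ^ (1 / 100 : ℝ) := by field_simp
      _ ≤ _ := hpow
  have him : 1 / 2 ≤ ‖s - 1‖ := by
    refine hs1.trans ?_
    simpa using abs_im_le_norm (s - 1)
  have hsne : s - 1 ≠ 0 := by
    intro h
    rw [h, norm_zero] at him
    norm_num at him
  have e3 : ‖c * (s / (s - 1)) * (N : ℂ) ^ (1 - s)‖ ≤ 3 * ‖c‖ * (N : ℝ) ^ (1 / 50 : ℝ) := by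
    have h1 : ‖s / (s - 1)‖ ≤ 3 := by
      have : s / (s - 1) = 1 + (s - 1)⁻¹ := by field_simp; ring
      rw [this]
      refine (norm_add_le _ _).trans ?_
      rw [norm_inv, norm_one]
      have : ‖s - 1‖⁻¹ ≤ (1 / 2 : ℝ)⁻¹ := inv_anti₀ (by norm_num) him
      norm_num at this ⊢
      linarith
    have h2 : ‖(N : ℂ) ^ (1 - s)‖ ≤ (N : ℝ) ^ (1 / 50 : ℝ) := by
      rw [Complex.norm_natCast_cpow_of_pos (by omega)]
      refine Real.rpow_le_rpow_of_exponent_le hN1 ?_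
      simp only [sub_re, one_re]
      linarith
    rw [norm_mul, norm_mul]
    calc _ ≤ ‖c‖ * 3 * (N : ℝ) ^ (1 / 50 : ℝ) := by gcongr
      _ = _ := by ring
  have e4 : ‖s * tailMellin f c N s‖ ≤ 10 * (B + ‖c‖) * (N : ℝ) ^ (1 / 50 : ℝ) := by
    rw [norm_mul]
    have h1 := norm_tailMellin_le hS hN (s := s) (by linarith)
    have h2 : (N : ℝ) ^ (-s.re) / s.re ≤ 2 * ((N : ℝ)⁻¹ * (N : ℝ) ^ (1 / 50 : ℝ)) := by
      rw [div_le_iff₀ (by linarith)]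
      have : (N : ℝ) ^ (-s.re) ≤ (N : ℝ)⁻¹ * (N : ℝ) ^ (1 / 50 : ℝ) := by
        rw [← Real.rpow_neg_one, ← Real.rpow_add hN0]
        exact Real.rpow_le_rpow_of_exponent_le hN1 (by linarith)
      have h0 : 0 < (N : ℝ)⁻¹ * (N : ℝ) ^ (1 / 50 : ℝ) := by positivity
      nlinarith
    calc _ ≤ (5 * N) * ((B + ‖c‖) * (2 * ((N : ℝ)⁻¹ * (N : ℝ) ^ (1 / 50 : ℝ)))) := by
          gcongr
          exact h1.trans (mul_le_mul_of_nonneg_left h2 hBc)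
      _ = _ := by field_simp; ring
  rw [cutSeries]
  calc _ ≤ 101 * (N : ℝ) ^ (1 / 50 : ℝ) + (N : ℝ) ^ (1 / 50 : ℝ) +
        3 * ‖c‖ * (N : ℝ) ^ (1 / 50 : ℝ) + 10 * (B + ‖c‖) * (N : ℝ) ^ (1 / 50 : ℝ) :=
        (norm_add_le _ _).trans (add_le_add ((norm_add_le _ _).trans (add_le_add
          ((norm_sub_le _ _).trans (add_le_add e1 e2)) e3)) e4)
    _ = _ := by ring

/-- The Dirichlet series of a bounded sequence with regular partial sums, and its derivatives, grow
slowly in vertical strips to the right of `1`. -/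
theorem exists_norm_iteratedDeriv_LSeries_le (hf : ∀ n, ‖f n‖ ≤ 1)
    (hS : ∀ n : ℕ, ‖∑ k ∈ Finset.Icc 1 n, f k - c * n‖ ≤ B) :
    ∃ C : ℝ, 1 ≤ C ∧ ∀ s : ℂ, 1 < s.re → s.re ≤ 2 → 1 ≤ |s.im| → ∀ j ≤ 3,
      ‖iteratedDeriv j (LSeries f) s‖ ≤ C * |s.im| ^ (1 / 50 : ℝ) := by
  set D := 102 + 3 * ‖c‖ + 10 * (B + ‖c‖) with hD
  have hBc : 0 ≤ B + ‖c‖ := (norm_nonneg _).trans (norm_sumError_le hS le_rfl)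
  have hD1 : 1 ≤ D := by
    have := norm_nonneg c
    linarith
  refine ⟨6 * (D * 2) * 100 ^ 3, by nlinarith, ?_⟩
  intro s hs hs2 him j hj
  set T := |s.im| with hT
  -- The cut is placed at the height of s, which balances the finite sum against the tail.
  set N := ⌈T⌉₊ with hN
  have hTN : T ≤ N := Nat.le_ceil T
  have hN1 : 1 ≤ N := by
    have : (1 : ℝ) ≤ N := him.trans hTN
    exact_mod_cast this
  have hN2 : (N : ℝ) ≤ 2 * T := by
    have := Nat.ceil_lt_add_one (show 0 ≤ T by linarith)
    linarith
  -- Cauchy's estimate below uses a disc of radius 1/100 that may cross Re s = 1, so it is applied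
  -- to `cutSeries`, which is analytic there.
  have heq : LSeries f =ᶠ[𝓝 s] cutSeries f c N := by
    filter_upwards [(isOpen_lt continuous_const continuous_re).mem_nhds hs] with z hz
    exact LSeries_eq_cutSeries hf hS hN1 hz
  rw [heq.iteratedDeriv_eq]
  have hball : ∀ z ∈ Metric.closedBall s (1 / 100), 99 / 100 ≤ z.re ∧ 1 / 2 ≤ |z.im| ∧
      ‖z‖ ≤ 5 * N := by
    intro z hz
    rw [Metric.mem_closedBall, dist_eq_norm] at hz
    have h1 := (abs_re_le_norm (z - s)).trans hz
    have h2 := (abs_im_le_norm (z - s)).trans hz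
    rw [sub_re, abs_le] at h1
    rw [sub_im] at h2
    have h3 : |z.im| ≥ T - 1 / 100 := by
      have := abs_sub_abs_le_abs_sub s.im z.im
      rw [abs_sub_comm] at this
      linarith
    have h4 : |z.im| ≤ T + 1 / 100 := by
      have := abs_sub_abs_le_abs_sub z.im s.im
      linarith
    refine ⟨by linarith, by linarith, ?_⟩
    have h5 := norm_le_abs_re_add_abs_im z
    have h6 : |z.re| ≤ 3 := abs_le.2 ⟨by linarith, by linarith⟩
    linarith
  have hdiff : DiffContOnCl ℂ (cutSeries f c N) (Metric.ball s (1 / 100)) := by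
    refine DifferentiableOn.diffContOnCl ?_
    intro z hz
    have hz' := hball z (Metric.closure_ball_subset_closedBall hz)
    refine (differentiableAt_cutSeries hS hN1 (by linarith [hz'.1]) ?_).differentiableWithinAt
    rintro rfl
    have := hz'.2.1
    norm_num at this
  have hNpow : (N : ℝ) ^ (1 / 50 : ℝ) ≤ 2 * T ^ (1 / 50 : ℝ) := by
    have hT0 : 0 ≤ T := abs_nonneg _
    calc (N : ℝ) ^ (1 / 50 : ℝ) ≤ (2 * T) ^ (1 / 50 : ℝ) := by gcongr
      _ = 2 ^ (1 / 50 : ℝ) * T ^ (1 / 50 : ℝ) := Real.mul_rpow (by norm_num) hT0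
      _ ≤ 2 * T ^ (1 / 50 : ℝ) := by
        gcongr
        calc (2 : ℝ) ^ (1 / 50 : ℝ) ≤ 2 ^ (1 : ℝ) :=
              Real.rpow_le_rpow_of_exponent_le one_le_two (by norm_num)
          _ = 2 := Real.rpow_one 2
  have hb := norm_iteratedDeriv_le_of_forall_mem_sphere_norm_le (n := j) (by norm_num) hdiff
    (C := D * (N : ℝ) ^ (1 / 50 : ℝ)) (fun z hz => by
      have hz' := hball z (Metric.sphere_subset_closedBall hz)
      exact norm_cutSeries_le hf hS hN1 hz'.1 hz'.2.1 hz'.2.2)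
  refine hb.trans ?_
  have hT0 : 0 ≤ T ^ (1 / 50 : ℝ) := by positivity
  have hfac : (j.factorial : ℝ) / (1 / 100) ^ j ≤ 6 * 100 ^ 3 := by
    interval_cases j <;> norm_num [Nat.factorial]
  calc (j.factorial : ℝ) * (D * (N : ℝ) ^ (1 / 50 : ℝ)) / (1 / 100) ^ j
      = (j.factorial : ℝ) / (1 / 100) ^ j * (D * (N : ℝ) ^ (1 / 50 : ℝ)) := by ring
    _ ≤ (6 * 100 ^ 3) * (D * (2 * T ^ (1 / 50 : ℝ))) := by gcongr
    _ = _ := by ring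

end Growth

end GaussSmooth

/-! ### Character series modulo 4: growth, lower bounds, logarithmic derivatives. -/

namespace GaussSmooth

open Complex Filter Topology MeasureTheory

/-- Partial sums of a `4`-periodic sequence are linear up to a bounded error. -/
theorem exists_norm_sum_sub_le_of_periodic {f : ℕ → ℂ} (hf : ∀ n, f (n + 4) = f n) :
    ∃ c : ℂ, ∃ B : ℝ, ∀ n : ℕ, ‖∑ k ∈ Finset.Icc 1 n, f k - c * n‖ ≤ B := by
  set c : ℂ := (f 1 + f 2 + f 3 + f 4) / 4 with hc
  set d : ℕ → ℂ := fun n => ∑ k ∈ Finset.Icc 1 n, f k - c * n with hd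
  have hw : ∀ n, f (n + 1) + f (n + 2) + f (n + 3) + f (n + 4) = f 1 + f 2 + f 3 + f 4 := by
    intro n
    induction n with
    | zero => simp
    | succ n ih =>
      rw [← ih, show n + 1 + 4 = (n + 1) + 4 by rfl, hf (n + 1)]
      rw [show n + 1 + 1 = n + 2 by rfl, show n + 1 + 2 = n + 3 by rfl,
        show n + 1 + 3 = n + 4 by rfl]
      ring
  -- With c the mean of one period, the deviation from c n is itself periodic, hence bounded by its
  -- first four values.
  have hper : Function.Periodic d 4 := by
    intro n
    simp only [hd]
    rw [Finset.sum_Icc_succ_top (by omega), Finset.sum_Icc_succ_top (by omega),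
      Finset.sum_Icc_succ_top (by omega), Finset.sum_Icc_succ_top (by omega)]
    have := hw n
    push_cast
    linear_combination this + 4 * hc - (4 * hc - 4 * hc) - 8 * hc + 4 * hc
  refine ⟨c, ∑ i ∈ Finset.range 4, ‖d i‖, fun n => ?_⟩
  have h : d n = d (n % 4) := (hper.map_mod_nat n).symm
  show ‖d n‖ ≤ _
  rw [h]
  exact Finset.single_le_sum (f := fun i => ‖d i‖) (fun _ _ => norm_nonneg _)
    (Finset.mem_range.2 (Nat.mod_lt n (by norm_num)))

/-- The Dirichlet series of a character modulo `4`. -/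
noncomputable def charSeries (ψ : DirichletCharacter ℂ 4) : ℂ → ℂ := LSeries fun n => ψ n

theorem exists_norm_sum_char_sub_le (ψ : DirichletCharacter ℂ 4) :
    ∃ c : ℂ, ∃ B : ℝ, ∀ n : ℕ, ‖∑ k ∈ Finset.Icc 1 n, ψ k - c * n‖ ≤ B := by
  refine exists_norm_sum_sub_le_of_periodic (f := fun n => ψ n) fun n => ?_
  have h : ((n + 4 : ℕ) : ZMod 4) = n := by
    push_cast
    rw [show (4 : ZMod 4) = 0 by decide, add_zero]
  exact congrArg ψ h

theorem exists_norm_iteratedDeriv_charSeries_le (ψ : DirichletCharacter ℂ 4) :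
    ∃ C : ℝ, 1 ≤ C ∧ ∀ s : ℂ, 1 < s.re → s.re ≤ 2 → 1 ≤ |s.im| → ∀ j ≤ 3,
      ‖iteratedDeriv j (charSeries ψ) s‖ ≤ C * |s.im| ^ (1 / 50 : ℝ) := by
  obtain ⟨c, B, h⟩ := exists_norm_sum_char_sub_le ψ
  exact exists_norm_iteratedDeriv_LSeries_le (fun n => ψ.norm_le_one n) h

/-- Cutting at N = 1 makes the two finite sums cancel and leaves a simple pole plus a bounded term.
This controls the cubed factor in the 3-4-1 inequality. -/
theorem exists_norm_charSeries_real_le (ψ : DirichletCharacter ℂ 4) :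
    ∃ K : ℝ, 1 ≤ K ∧ ∀ x : ℝ, 0 < x → x ≤ 1 → ‖charSeries ψ (1 + x)‖ ≤ K / x := by
  obtain ⟨c, B, hS⟩ := exists_norm_sum_char_sub_le ψ
  have hB : 0 ≤ B + ‖c‖ := (norm_nonneg _).trans (norm_sumError_le hS le_rfl)
  refine ⟨1 + 2 * ‖c‖ + 2 * (B + ‖c‖), by linarith [norm_nonneg c], ?_⟩
  intro x hx hx1
  have hre : ((1 + x : ℂ)).re = 1 + x := by simp
  have h1 : charSeries ψ (1 + x) = c * ((1 + x) / x) + (1 + x) * tailMellin (fun n => ψ n) c 1 (1 + x) := by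
    rw [charSeries, LSeries_eq_cutSeries (fun n => ψ.norm_le_one n) hS le_rfl (by rw [hre]; linarith),
      cutSeries]
    simp
  have hn : ‖(1 + x : ℂ)‖ = 1 + x := by
    rw [← ofReal_one, ← ofReal_add, norm_real, Real.norm_of_nonneg (by linarith)]
  have h2 := norm_tailMellin_le hS (N := 1) le_rfl (s := 1 + x) (by rw [hre]; linarith)
  rw [hre, Nat.cast_one, Real.one_rpow] at h2
  rw [h1]
  refine (norm_add_le _ _).trans ?_
  rw [norm_mul, norm_mul, norm_div, hn, norm_real, Real.norm_of_nonneg hx.le]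
  have h3 : ‖c‖ * ((1 + x) / x) ≤ 2 * ‖c‖ / x := by
    rw [mul_div_assoc', div_le_div_iff_of_pos_right hx]
    nlinarith [norm_nonneg c]
  have h4 : (1 + x) * ‖tailMellin (fun n => ψ n) c 1 (1 + x)‖ ≤ (1 + x) * ((B + ‖c‖) * (1 / (1 + x))) :=
    mul_le_mul_of_nonneg_left h2 (by linarith)
  have h5 : (1 + x) * ((B + ‖c‖) * (1 / (1 + x))) = B + ‖c‖ := by field_simp
  have h6 : (1 + 2 * ‖c‖ + 2 * (B + ‖c‖)) / x = 2 * ‖c‖ / x + (1 + 2 * (B + ‖c‖)) / x := by ring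
  have h7 : 1 + 2 * (B + ‖c‖) ≤ (1 + 2 * (B + ‖c‖)) / x := by
    rw [le_div_iff₀ hx]; nlinarith
  linarith

theorem analyticAt_charSeries (ψ : DirichletCharacter ℂ 4) {s : ℂ} (hs : 1 < s.re) :
    AnalyticAt ℂ (charSeries ψ) s := by
  refine LSeries_analyticOnNhd _ s ?_
  show LSeries.abscissaOfAbsConv _ < _
  rw [DirichletCharacter.absicssaOfAbsConv_eq_one (by norm_num)]
  exact_mod_cast hs

theorem hasDerivAt_iteratedDeriv_charSeries (ψ : DirichletCharacter ℂ 4) (j : ℕ) {s : ℂ}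
    (hs : 1 < s.re) : HasDerivAt (iteratedDeriv j (charSeries ψ))
      (iteratedDeriv (j + 1) (charSeries ψ) s) s := by
  rw [iteratedDeriv_succ, iteratedDeriv_eq_iterate]
  exact ((analyticAt_charSeries ψ hs).iterated_deriv j).differentiableAt.hasDerivAt

theorem charSeries_ne_zero (ψ : DirichletCharacter ℂ 4) {s : ℂ} (hs : 1 < s.re) :
    charSeries ψ s ≠ 0 :=
  DirichletCharacter.LSeries_ne_zero_of_one_lt_re ψ hs

/-- A quantitative form of the nonvanishing on the line `Re s = 1`. -/
theorem exists_le_norm_charSeries (ψ : DirichletCharacter ℂ 4) (hψ : ψ ^ 2 = 1) :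
    ∃ D : ℝ, 1 ≤ D ∧ ∀ s : ℂ, 1 < s.re → s.re ≤ 2 → 1 ≤ |s.im| →
      1 ≤ D * (|s.im| ^ (1 / 50 : ℝ)) ^ 4 * ‖charSeries ψ s‖ := by
  obtain ⟨C, hC1, hC⟩ := exists_norm_iteratedDeriv_charSeries_le ψ
  obtain ⟨C₀, hC₀1, hC₀⟩ := exists_norm_iteratedDeriv_charSeries_le 1
  obtain ⟨K, hK1, hK⟩ := exists_norm_charSeries_real_le 1
  set A := C + 2 * C₀ with hA
  have hA1 : 1 ≤ A := by linarith
  refine ⟨16 * K ^ 3 * A ^ 4, ?_, ?_⟩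
  · have h1 : 1 ≤ K ^ 3 := one_le_pow₀ hK1
    have h2 : 1 ≤ A ^ 4 := one_le_pow₀ hA1
    nlinarith
  intro s hs1 hs2 him
  set t := s.im with ht
  set τ := |t| ^ (1 / 50 : ℝ) with hτ
  have hτ1 : 1 ≤ τ := Real.one_le_rpow him (by norm_num)
  set M := A * τ with hM
  have hM1 : 1 ≤ M := by nlinarith
  have hM0 : 0 < M := by linarith
  have hK0 : 0 < K := by linarith
  -- M bounds both the derivative of the series at height t and the trivial character series at
  -- height 2t. The value b, normalised by 16 b K³ M⁴ = 1, will be the lower bound.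
  set b := 1 / (16 * K ^ 3 * M ^ 4) with hb
  have hb0 : 0 < b := by positivity
  have hb1 : b ≤ 1 := by
    rw [hb, div_le_one (by positivity)]
    nlinarith [one_le_pow₀ hK1 (n := 3), one_le_pow₀ hM1 (n := 4)]
  -- The 3-4-1 inequality; since ψ² = 1 its last factor is the trivial character series at height
  -- 2t, bounded by M.
  have hp : ∀ x : ℝ, 0 < x → x ≤ 1 → x ^ 3 ≤ K ^ 3 * M * ‖charSeries ψ (1 + x + I * t)‖ ^ 4 := by
    intro x hx hx1
    have h := DirichletCharacter.norm_LSeries_product_ge_one ψ hx t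
    rw [hψ, norm_mul, norm_mul, norm_pow, norm_pow] at h
    change ‖charSeries 1 (1 + x)‖ ^ 3 * ‖charSeries ψ (1 + x + I * t)‖ ^ 4 *
      ‖charSeries 1 (1 + x + 2 * I * t)‖ ≥ 1 at h
    have h1 := hK x hx hx1
    have h2 : ‖charSeries 1 (1 + x + 2 * I * t)‖ ≤ M := by
      have hi : (1 + x + 2 * I * t : ℂ).im = 2 * t := by simp
      have hr : (1 + x + 2 * I * t : ℂ).re = 1 + x := by simp
      have h3 := hC₀ (1 + x + 2 * I * t) (by rw [hr]; linarith) (by rw [hr]; linarith)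
        (by rw [hi, abs_mul, abs_two]; linarith) 0 (by norm_num)
      rw [iteratedDeriv_zero, hi, abs_mul, abs_two, Real.mul_rpow (by norm_num) (abs_nonneg _)] at h3
      refine h3.trans ?_
      have h4 : (2 : ℝ) ^ (1 / 50 : ℝ) ≤ 2 := by
        calc (2 : ℝ) ^ (1 / 50 : ℝ) ≤ 2 ^ (1 : ℝ) :=
              Real.rpow_le_rpow_of_exponent_le one_le_two (by norm_num)
          _ = 2 := Real.rpow_one 2
      calc C₀ * (2 ^ (1 / 50 : ℝ) * τ) ≤ C₀ * (2 * τ) := by gcongr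
        _ = 2 * C₀ * τ := by ring
        _ ≤ M := by
          rw [hM, hA]
          nlinarith
    have h5 : 1 ≤ (K / x) ^ 3 * ‖charSeries ψ (1 + x + I * t)‖ ^ 4 * M := by
      refine h.le.trans ?_
      gcongr
    rw [div_pow] at h5
    calc x ^ 3 = x ^ 3 * 1 := by ring
      _ ≤ x ^ 3 * (K ^ 3 / x ^ 3 * ‖charSeries ψ (1 + x + I * t)‖ ^ 4 * M) := by gcongr
      _ = _ := by field_simp
  have hbK : 16 * b * (K ^ 3 * M ^ 4) = 1 := by
    rw [hb]; field_simp
  -- At distance at least δ from the line, 3-4-1 gives the bound 2b, because (2b)⁴ K³ M = δ³. From a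
  -- point closer to the line, moving to distance δ costs at most M δ = b by the mean value
  -- inequality.
  set δ := b / M with hδ
  have hδ0 : 0 < δ := by positivity
  have hδ1 : δ ≤ 1 := by
    rw [hδ, div_le_one hM0]; linarith
  have hlow : ∀ x : ℝ, δ ≤ x → x ≤ 1 → 2 * b ≤ ‖charSeries ψ (1 + x + I * t)‖ := by
    intro x hx hx1
    refine le_of_pow_le_pow_left₀ (n := 4) (by norm_num) (norm_nonneg _) ?_
    have h1 := hp x (hδ0.trans_le hx) hx1
    have h2 : δ ^ 3 ≤ x ^ 3 := by gcongr
    have h3 : (2 * b) ^ 4 * (K ^ 3 * M) = δ ^ 3 := by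
      have h4 : δ * M = b := by rw [hδ]; field_simp
      have h5 : M ^ 3 ≠ 0 := by positivity
      apply mul_right_cancel₀ h5
      calc (2 * b) ^ 4 * (K ^ 3 * M) * M ^ 3 = b ^ 3 * (16 * b * (K ^ 3 * M ^ 4)) := by ring
        _ = (δ * M) ^ 3 := by rw [hbK, h4]; ring
        _ = _ := by ring
    have h6 : 0 < K ^ 3 * M := by positivity
    refine le_of_mul_le_mul_right ?_ h6
    rw [h3]
    linarith
  have hmain : b ≤ ‖charSeries ψ s‖ := by
    have hsx : s = 1 + ((s.re - 1 : ℝ) : ℂ) + I * t := by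
      apply Complex.ext <;> simp [ht]
    rcases le_or_gt δ (s.re - 1) with h | h
    · have := hlow (s.re - 1) h (by linarith)
      rw [← hsx] at this
      linarith
    · set z : ℂ := 1 + (δ : ℂ) + I * t with hz
      have hconv : Convex ℝ {w : ℂ | 1 < w.re ∧ w.re ≤ 2 ∧ w.im = t} := by
        have h1 : Convex ℝ {w : ℂ | 1 < w.re} := convex_halfSpace_re_gt 1
        have h2 : Convex ℝ {w : ℂ | w.re ≤ 2} := convex_halfSpace_re_le 2
        have h3 : Convex ℝ {w : ℂ | w.im = t} := by
          have h3a := (convex_halfSpace_im_le t).inter (convex_halfSpace_im_ge t)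
          convert! h3a using 1
          ext w
          simp [le_antisymm_iff]
        exact h1.inter (h2.inter h3)
      have hzm : z ∈ {w : ℂ | 1 < w.re ∧ w.re ≤ 2 ∧ w.im = t} := by
        refine ⟨?_, ?_, ?_⟩ <;> simp [hz] <;> linarith
      have hsm : s ∈ {w : ℂ | 1 < w.re ∧ w.re ≤ 2 ∧ w.im = t} := ⟨hs1, hs2, rfl⟩
      have hmv := hconv.norm_image_sub_le_of_norm_deriv_le (𝕜 := ℂ) (f := charSeries ψ) (C := M)
        (fun w hw => (analyticAt_charSeries ψ hw.1).differentiableAt) (fun w hw => by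
          have h4 := hC w hw.1 hw.2.1 (by rw [hw.2.2]; exact him) 1 (by norm_num)
          rw [iteratedDeriv_one, hw.2.2] at h4
          refine h4.trans ?_
          rw [hM]
          gcongr
          linarith) hzm hsm
      have hdist : ‖s - z‖ ≤ δ := by
        have h1 : s - z = ((s.re - 1 - δ : ℝ) : ℂ) := by
          apply Complex.ext
          · simp [hz]; ring
          · simp [hz, ht]
        rw [h1, norm_real, Real.norm_eq_abs, abs_le]
        constructor <;> linarith
      have h5 := hlow δ le_rfl hδ1
      have h6 : ‖charSeries ψ z‖ - ‖charSeries ψ s‖ ≤ ‖charSeries ψ s - charSeries ψ z‖ := by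
        rw [norm_sub_rev]
        exact norm_sub_norm_le _ _
      have h7 : M * ‖s - z‖ ≤ b := by
        calc M * ‖s - z‖ ≤ M * δ := by gcongr
          _ = b := by rw [hδ]; field_simp
      linarith
  calc (1 : ℝ) = 16 * K ^ 3 * A ^ 4 * τ ^ 4 * b := by
        rw [hb, hM]; field_simp
    _ ≤ _ := by gcongr

/-- The logarithmic derivative of a character series. -/
noncomputable def charLogDeriv (ψ : DirichletCharacter ℂ 4) (s : ℂ) : ℂ :=
  iteratedDeriv 1 (charSeries ψ) s / charSeries ψ s

/-- The derivative of `charLogDeriv`. -/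
noncomputable def charLogDeriv₁ (ψ : DirichletCharacter ℂ 4) (s : ℂ) : ℂ :=
  iteratedDeriv 2 (charSeries ψ) s / charSeries ψ s - charLogDeriv ψ s ^ 2

/-- The second derivative of `charLogDeriv`. -/
noncomputable def charLogDeriv₂ (ψ : DirichletCharacter ℂ 4) (s : ℂ) : ℂ :=
  iteratedDeriv 3 (charSeries ψ) s / charSeries ψ s
    - iteratedDeriv 2 (charSeries ψ) s / charSeries ψ s * charLogDeriv ψ s
    - 2 * charLogDeriv ψ s * charLogDeriv₁ ψ s

theorem hasDerivAt_iteratedDeriv_div_charSeries (ψ : DirichletCharacter ℂ 4) (j : ℕ) {s : ℂ}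
    (hs : 1 < s.re) :
    HasDerivAt (fun z => iteratedDeriv j (charSeries ψ) z / charSeries ψ z)
      (iteratedDeriv (j + 1) (charSeries ψ) s / charSeries ψ s
        - iteratedDeriv j (charSeries ψ) s / charSeries ψ s * charLogDeriv ψ s) s := by
  have h0 := hasDerivAt_iteratedDeriv_charSeries ψ 0 hs
  rw [iteratedDeriv_zero] at h0
  have hne := charSeries_ne_zero ψ hs
  convert! (hasDerivAt_iteratedDeriv_charSeries ψ j hs).fun_div h0 hne using 1
  rw [charLogDeriv]
  field_simp

theorem hasDerivAt_charLogDeriv (ψ : DirichletCharacter ℂ 4) {s : ℂ} (hs : 1 < s.re) :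
    HasDerivAt (charLogDeriv ψ) (charLogDeriv₁ ψ s) s := by
  have h := hasDerivAt_iteratedDeriv_div_charSeries ψ 1 hs
  convert! h using 1
  rw [charLogDeriv₁, charLogDeriv]
  ring

theorem hasDerivAt_charLogDeriv₁ (ψ : DirichletCharacter ℂ 4) {s : ℂ} (hs : 1 < s.re) :
    HasDerivAt (charLogDeriv₁ ψ) (charLogDeriv₂ ψ s) s := by
  have h := (hasDerivAt_iteratedDeriv_div_charSeries ψ 2 hs).fun_sub
    ((hasDerivAt_charLogDeriv ψ hs).fun_pow 2)
  convert! h using 1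
  rw [charLogDeriv₂]
  push_cast
  ring

theorem exists_norm_charLogDeriv_le (ψ : DirichletCharacter ℂ 4) (hψ : ψ ^ 2 = 1) :
    ∃ C : ℝ, 0 ≤ C ∧ ∀ s : ℂ, 1 < s.re → s.re ≤ 2 → 1 ≤ |s.im| →
      ‖charLogDeriv ψ s‖ ≤ C * |s.im| ^ (2 / 5 : ℝ) ∧
      ‖charLogDeriv₁ ψ s‖ ≤ C * |s.im| ^ (2 / 5 : ℝ) ∧
      ‖charLogDeriv₂ ψ s‖ ≤ C * |s.im| ^ (2 / 5 : ℝ) := by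
  obtain ⟨C, hC1, hC⟩ := exists_norm_iteratedDeriv_charSeries_le ψ
  obtain ⟨D, hD1, hD⟩ := exists_le_norm_charSeries ψ hψ
  set E := C * D with hE
  have hE1 : 1 ≤ E := by nlinarith
  refine ⟨8 * E ^ 3, by positivity, ?_⟩
  intro s hs1 hs2 him
  set τ := |s.im| ^ (1 / 50 : ℝ) with hτ
  have hτ1 : 1 ≤ τ := Real.one_le_rpow him (by norm_num)
  -- Each quotient L^(j)/L is O(τ⁵), and the expressions are at most cubic in the quotients, so τ¹⁵
  -- would do. Any exponent of |t| below 1/2 suffices for square-integrability after division by s.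
  have hτ20 : |s.im| ^ (2 / 5 : ℝ) = τ ^ 20 := by
    rw [hτ, ← Real.rpow_natCast, ← Real.rpow_mul (abs_nonneg _)]
    norm_num
  have hne := norm_pos_iff.2 (charSeries_ne_zero ψ hs1)
  set P := E * τ ^ 5 with hP
  have hP1 : 1 ≤ P := by
    have := one_le_pow₀ hτ1 (n := 5)
    nlinarith
  have hquot : ∀ j ≤ 3, ‖iteratedDeriv j (charSeries ψ) s / charSeries ψ s‖ ≤ P := by
    intro j hj
    rw [norm_div, div_le_iff₀ hne]
    have h1 := hC s hs1 hs2 him j hj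
    have h2 := hD s hs1 hs2 him
    calc ‖iteratedDeriv j (charSeries ψ) s‖ ≤ C * τ * 1 := by rw [mul_one]; exact h1
      _ ≤ C * τ * (D * τ ^ 4 * ‖charSeries ψ s‖) := by gcongr
      _ = P * ‖charSeries ψ s‖ := by rw [hP, hE]; ring
  have q0 : ‖charLogDeriv ψ s‖ ≤ P := hquot 1 (by norm_num)
  have q1 : ‖charLogDeriv₁ ψ s‖ ≤ 2 * P ^ 2 := by
    rw [charLogDeriv₁]
    refine (norm_sub_le _ _).trans ?_
    rw [norm_pow]
    have h1 := hquot 2 (by norm_num)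
    have h2 : ‖charLogDeriv ψ s‖ ^ 2 ≤ P ^ 2 := by gcongr
    nlinarith
  have q2 : ‖charLogDeriv₂ ψ s‖ ≤ 8 * P ^ 3 := by
    rw [charLogDeriv₂]
    refine (norm_sub_le _ _).trans ?_
    refine (add_le_add_left (norm_sub_le _ _) _).trans ?_
    rw [norm_mul, norm_mul, norm_mul, RCLike.norm_ofNat]
    have h1 := hquot 3 (by norm_num)
    have h2 := hquot 2 (by norm_num)
    have h3 : ‖iteratedDeriv 2 (charSeries ψ) s / charSeries ψ s‖ * ‖charLogDeriv ψ s‖ ≤ P * P := by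
      gcongr
    have h4 : 2 * ‖charLogDeriv ψ s‖ * ‖charLogDeriv₁ ψ s‖ ≤ 2 * P * (2 * P ^ 2) := by gcongr
    have h5 : P ≤ P ^ 3 := le_self_pow₀ hP1 (by norm_num)
    have h6 : P * P ≤ P ^ 3 := by nlinarith
    nlinarith
  have hP3 : P ^ 3 ≤ E ^ 3 * τ ^ 20 := by
    rw [hP, mul_pow, ← pow_mul]
    gcongr
    · norm_num
  have hP13 : P ≤ P ^ 3 := le_self_pow₀ hP1 (by norm_num)
  have hP23 : P ^ 2 ≤ P ^ 3 := pow_le_pow_right₀ hP1 (by norm_num)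
  have hP0 : 0 ≤ P ^ 3 := by positivity
  rw [hτ20]
  refine ⟨?_, ?_, ?_⟩ <;> nlinarith

end GaussSmooth

/-! ### The Chebyshev function of the class 1 modulo 4 and its Mellin transform. -/

namespace GaussSmooth

open Complex Filter Topology MeasureTheory
open scoped ArithmeticFunction

/-- The nontrivial character modulo `4`. -/
noncomputable def chi4 : DirichletCharacter ℂ 4 := ZMod.χ₄.ringHomComp (Int.castRingHom ℂ)

theorem chi4_apply (n : ℕ) : chi4 n = ((ZMod.χ₄ n : ℤ) : ℂ) := rfl

theorem chi4_sq : chi4 ^ 2 = 1 :=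
  (ZMod.isQuadratic_χ₄.comp _).sq_eq_one

theorem chi4_ne_one : chi4 ≠ 1 := by
  intro h
  have h3 := congrArg (fun χ : DirichletCharacter ℂ 4 => χ ((3 : ℕ) : ZMod 4)) h
  simp only [chi4_apply, ZMod.χ₄_nat_three_mod_four (show 3 % 4 = 3 by rfl)] at h3
  rw [MulChar.one_apply (by decide)] at h3
  norm_num at h3

/-- `2 Λ(n)` on the residue class `1` modulo `4`. -/
noncomputable def splitMangoldt (n : ℕ) : ℝ := if n % 4 = 1 then 2 * Λ n else 0

theorem splitMangoldt_nonneg (n : ℕ) : 0 ≤ splitMangoldt n := by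
  unfold splitMangoldt
  split_ifs
  · exact mul_nonneg two_pos.le ArithmeticFunction.vonMangoldt_nonneg
  · exact le_rfl

theorem splitMangoldt_le (n : ℕ) : splitMangoldt n ≤ 2 * Λ n := by
  have : 0 ≤ Λ n := ArithmeticFunction.vonMangoldt_nonneg
  unfold splitMangoldt
  split_ifs <;> linarith

/-- Orthogonality of the two characters modulo 4; it explains the weight 2 in `splitMangoldt`, which
gives the class density one. -/
theorem one_add_chi4 (n : ℕ) :
    (1 : DirichletCharacter ℂ 4) n + chi4 n = if n % 4 = 1 then 2 else 0 := by
  have hn : (n : ZMod 4) = ((n % 4 : ℕ) : ZMod 4) := by simp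
  rw [chi4_apply, hn]
  have h4 := Nat.mod_lt n (show 0 < 4 by norm_num)
  interval_cases h : n % 4
  · rw [MulChar.map_nonunit _ (by decide)]
    simp
  · rw [MulChar.one_apply (by decide), ZMod.χ₄_nat_one_mod_four rfl]
    norm_num
  · rw [MulChar.map_nonunit _ (by decide), show ZMod.χ₄ ((2 : ℕ) : ZMod 4) = 0 by decide]
    simp
  · rw [MulChar.one_apply (by decide), ZMod.χ₄_nat_three_mod_four rfl]
    norm_num

/-- The logarithmic derivative of the product of the two character series modulo `4`. -/
theorem LSeries_splitMangoldt {s : ℂ} (hs : 1 < s.re) :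
    LSeries (fun n => (splitMangoldt n : ℂ)) s = -(charLogDeriv 1 s + charLogDeriv chi4 s) := by
  have h1 := DirichletCharacter.LSeries_twist_vonMangoldt_eq (1 : DirichletCharacter ℂ 4) hs
  have h2 := DirichletCharacter.LSeries_twist_vonMangoldt_eq chi4 hs
  have s1 := DirichletCharacter.LSeriesSummable_twist_vonMangoldt (1 : DirichletCharacter ℂ 4) hs
  have s2 := DirichletCharacter.LSeriesSummable_twist_vonMangoldt chi4 hs
  have h3 := LSeries_add s1 s2
  rw [h1, h2] at h3
  rw [charLogDeriv, charLogDeriv, iteratedDeriv_one, iteratedDeriv_one]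
  have h4 : (fun n => (splitMangoldt n : ℂ)) =
      ((fun n : ℕ => (1 : DirichletCharacter ℂ 4) n) * fun n => (Λ n : ℂ)) +
        ((fun n : ℕ => chi4 n) * fun n => (Λ n : ℂ)) := by
    ext n
    simp only [Pi.add_apply, Pi.mul_apply]
    rw [← add_mul, one_add_chi4, splitMangoldt]
    split_ifs <;> simp
  rw [h4]
  refine h3.trans ?_
  rw [charSeries, charSeries]
  ring

/-- `∑_{n ≤ x, n ≡ 1 (4)} 2 Λ(n)`. -/
noncomputable def splitPsi (x : ℝ) : ℝ := ∑ n ∈ Finset.Icc 1 ⌊x⌋₊, splitMangoldt n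

theorem splitPsi_mono : Monotone splitPsi := by
  intro a b hab
  refine Finset.sum_le_sum_of_subset_of_nonneg
    (Finset.Icc_subset_Icc le_rfl (Nat.floor_le_floor hab)) fun n _ _ => splitMangoldt_nonneg n

theorem splitPsi_nonneg (x : ℝ) : 0 ≤ splitPsi x :=
  Finset.sum_nonneg fun n _ => splitMangoldt_nonneg n

theorem splitPsi_le {x : ℝ} (hx : 0 ≤ x) : splitPsi x ≤ 2 * (Real.log 4 + 4) * x := by
  have h1 : splitPsi x ≤ 2 * Chebyshev.psi x := by
    rw [splitPsi, Chebyshev.psi, Finset.mul_sum]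
    exact Finset.sum_le_sum fun n _ => splitMangoldt_le n
  have h2 := Chebyshev.psi_le_const_mul_self hx
  linarith

/-- `∑_{n ≤ x, n ≡ 1 (4)} 2 Λ(n) - x` for `x > 1`. -/
noncomputable def splitError : ℝ → ℂ :=
  Set.indicator (Set.Ioi 1) fun x => ((splitPsi x - x : ℝ) : ℂ)

theorem norm_splitError_le (x : ℝ) : ‖splitError x‖ ≤ 20 * |x| := by
  unfold splitError
  by_cases hx : x ∈ Set.Ioi (1 : ℝ)
  · have hx0 : 0 ≤ x := zero_le_one.trans (le_of_lt hx)
    rw [Set.indicator_of_mem hx, norm_real, Real.norm_eq_abs, abs_of_nonneg hx0, abs_le]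
    have h1 := splitPsi_le hx0
    have h2 := splitPsi_nonneg x
    have h3 : Real.log 4 ≤ 4 - 1 := Real.log_le_sub_one_of_pos (by norm_num)
    constructor <;> nlinarith
  · rw [Set.indicator_of_notMem hx, norm_zero]
    positivity

theorem measurable_splitError : Measurable splitError := by
  refine Measurable.indicator ?_ measurableSet_Ioi
  exact Complex.measurable_ofReal.comp (splitPsi_mono.measurable.sub measurable_id)

theorem locallyIntegrableOn_splitError : LocallyIntegrableOn splitError (Set.Ioi 0) := by
  have hc : Continuous fun x : ℝ => 20 * |x| := by fun_prop
  refine (hc.locallyIntegrable.mono measurable_splitError.aestronglyMeasurable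
    (Eventually.of_forall fun x => ?_)).locallyIntegrableOn _
  exact (norm_splitError_le x).trans (le_abs_self _)

theorem isBigO_splitError_top : splitError =O[atTop] fun x : ℝ => x ^ (-(-1 : ℝ)) := by
  refine Asymptotics.IsBigO.of_bound 20 (Eventually.of_forall fun x => ?_)
  rw [neg_neg, Real.rpow_one]
  exact norm_splitError_le x

theorem isBigO_splitError_zero (b : ℝ) : splitError =O[𝓝[>] 0] fun x : ℝ => x ^ (-b) := by
  have : splitError =ᶠ[𝓝[>] 0] fun _ => 0 := by
    filter_upwards [nhdsWithin_le_nhds (gt_mem_nhds (show (0 : ℝ) < 1 by norm_num))] with t ht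
    exact Set.indicator_of_notMem (not_lt.2 (le_of_lt ht)) _
  exact this.trans_isBigO (Asymptotics.isBigO_zero _ _)

/-- `log² x (∑_{n ≤ x, n ≡ 1 (4)} 2 Λ(n) - x)`. -/
noncomputable def logSqError (x : ℝ) : ℂ := Real.log x • (Real.log x • splitError x)

/-- The Mellin transform of `splitError`. -/
noncomputable def errorTransform (s : ℂ) : ℂ := mellin splitError (-s)

theorem locallyIntegrableOn_log_smul {f : ℝ → ℂ} (hf : LocallyIntegrableOn f (Set.Ioi 0)) :
    LocallyIntegrableOn (fun x => Real.log x • f x) (Set.Ioi 0) :=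
  hf.continuousOn_smul isOpen_Ioi.isLocallyClosed (Real.continuousOn_log.mono fun _ hx => (ne_of_gt hx))

theorem hasDerivAt_errorTransform {s : ℂ} (hs : 1 < s.re) :
    HasDerivAt errorTransform (-mellin (fun x => Real.log x • splitError x) (-s)) s := by
  have h := (mellin_hasDerivAt_of_isBigO_rpow (s := -s) (a := -1) (b := -s.re - 1)
    locallyIntegrableOn_splitError isBigO_splitError_top (by simpa using hs)
    (isBigO_splitError_zero _) (by simp)).2
  have h2 := h.scomp s (hasDerivAt_neg s)
  simpa [errorTransform, Function.comp_def] using! h2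

theorem mellin_log_smul_splitError {s : ℂ} (hs : 1 < s.re) :
    MellinConvergent logSqError (-s) ∧
    HasDerivAt (fun s => -mellin (fun x => Real.log x • splitError x) (-s))
      (mellin logSqError (-s)) s := by
  set a := (-1 - s.re) / 2 with ha
  have htop : (fun x => Real.log x • splitError x) =O[atTop] fun x : ℝ => x ^ (-a) :=
    isBigO_rpow_top_log_smul (a := -1) (by rw [ha]; linarith) isBigO_splitError_top
  have hbot : (fun x => Real.log x • splitError x) =O[𝓝[>] 0] fun x : ℝ => x ^ (-(-s.re - 1)) :=
    isBigO_rpow_zero_log_smul (a := -s.re - 2) (by linarith) (isBigO_splitError_zero _)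
  have h := mellin_hasDerivAt_of_isBigO_rpow (s := -s) (a := a) (b := -s.re - 1)
    (locallyIntegrableOn_log_smul locallyIntegrableOn_splitError) htop
    (by rw [neg_re, ha]; linarith) hbot (by simp)
  refine ⟨h.1, ?_⟩
  have h2 := (h.2.scomp s (hasDerivAt_neg s)).fun_neg
  convert! h2 using 1
  simp
  rfl

/-- Each factor log x is a derivative of the Mellin transform. In the argument that follows, j such
factors yield a relative error (log x)^(-2j/3); j = 2 is the first value for which the exponent
exceeds 1. -/
theorem iteratedDeriv_errorTransform {s : ℂ} (hs : 1 < s.re) :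
    iteratedDeriv 2 errorTransform s = mellin logSqError (-s) := by
  rw [iteratedDeriv_succ, iteratedDeriv_one]
  have h : deriv errorTransform =ᶠ[𝓝 s]
      fun s => -mellin (fun x => Real.log x • splitError x) (-s) := by
    filter_upwards [(isOpen_lt continuous_const continuous_re).mem_nhds hs] with z hz
    exact (hasDerivAt_errorTransform hz).deriv
  rw [h.deriv_eq]
  exact (mellin_log_smul_splitError hs).2.deriv

/-- Abel summation gives the transform of `splitPsi` as -L'/L divided by s; subtracting x
contributes -1/(s - 1), which is to cancel the pole at 1. -/
theorem errorTransform_eq {s : ℂ} (hs : 1 < s.re) :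
    errorTransform s = -(charLogDeriv 1 s + charLogDeriv chi4 s) / s - 1 / (s - 1) := by
  have hO : (fun n ↦ ∑ k ∈ Finset.Icc 1 n, splitMangoldt k) =O[atTop]
      fun n ↦ (n : ℝ) ^ (1 : ℝ) := by
    refine Asymptotics.IsBigO.of_bound (2 * (Real.log 4 + 4)) (Eventually.of_forall fun n => ?_)
    rw [Real.rpow_one, Real.norm_of_nonneg (Finset.sum_nonneg fun k _ => splitMangoldt_nonneg k),
      Real.norm_of_nonneg (Nat.cast_nonneg n)]
    simpa [splitPsi] using splitPsi_le (Nat.cast_nonneg n)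
  have hL := LSeries_eq_mul_integral_of_nonneg splitMangoldt zero_le_one hs hO splitMangoldt_nonneg
  rw [LSeries_splitMangoldt hs] at hL
  have hs0 : s ≠ 0 := by
    rintro rfl
    simp at hs
    linarith
  have hs1 : s - 1 ≠ 0 := by
    intro h
    have := congrArg re h
    simp at this
    linarith
  have hconv : MellinConvergent splitError (-s) :=
    mellinConvergent_of_isBigO_rpow (a := -1) (b := -s.re - 1)
      locallyIntegrableOn_splitError isBigO_splitError_top (by simpa using hs)
      (isBigO_splitError_zero _) (by simp)
  have hI1 : IntegrableOn (fun t : ℝ => (t : ℂ) ^ (-s - 1) * ((splitPsi t - t : ℝ) : ℂ))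
      (Set.Ioi 1) := by
    have := hconv.mono_set (Set.Ioi_subset_Ioi (zero_le_one (α := ℝ)))
    refine this.congr_fun (fun t ht => ?_) measurableSet_Ioi
    simp only [splitError, Set.indicator_of_mem ht, smul_eq_mul]
  have hI2 : IntegrableOn (fun t : ℝ => (t : ℂ) ^ (-s)) (Set.Ioi 1) :=
    integrableOn_Ioi_cpow_of_lt (by simpa using hs) one_pos
  have hE : errorTransform s = ∫ t in Set.Ioi (1 : ℝ),
      (t : ℂ) ^ (-s - 1) * ((splitPsi t - t : ℝ) : ℂ) := by
    rw [errorTransform, mellin]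
    have : ∀ t : ℝ, (t : ℂ) ^ (-s - 1) • splitError t = Set.indicator (Set.Ioi 1)
        (fun t : ℝ => (t : ℂ) ^ (-s - 1) * ((splitPsi t - t : ℝ) : ℂ)) t := by
      intro t
      by_cases ht : t ∈ Set.Ioi (1 : ℝ)
      · simp only [splitError, Set.indicator_of_mem ht, smul_eq_mul]
      · simp only [splitError, Set.indicator_of_notMem ht, smul_zero]
    simp_rw [this]
    rw [setIntegral_indicator measurableSet_Ioi]
    congr 2
    exact Set.inter_eq_right.2 (Set.Ioi_subset_Ioi zero_le_one)
  have hsplit : ∫ t in Set.Ioi (1 : ℝ),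
      (∑ k ∈ Finset.Icc 1 ⌊t⌋₊, (splitMangoldt k : ℂ)) * (t : ℂ) ^ (-(s + 1)) =
      errorTransform s + 1 / (s - 1) := by
    have h1 : ∫ t in Set.Ioi (1 : ℝ), (t : ℂ) ^ (-s) = 1 / (s - 1) := by
      rw [integral_Ioi_cpow_of_lt (by simpa using hs) one_pos, ofReal_one, one_cpow,
        show -s + 1 = -(s - 1) by ring, neg_div_neg_eq]
    rw [hE, ← h1, ← integral_add hI1 hI2]
    refine setIntegral_congr_fun measurableSet_Ioi fun t ht => ?_
    have ht0 : (t : ℂ) ≠ 0 := by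
      exact_mod_cast (zero_lt_one.trans ht).ne'
    have hcp : (t : ℂ) ^ (-s) = t * (t : ℂ) ^ (-s - 1) := by
      rw [cpow_sub _ _ ht0, cpow_one]
      field_simp
    simp only [splitPsi]
    rw [hcp, show -(s + 1) = -s - 1 by ring]
    push_cast
    ring
  rw [hsplit] at hL
  rw [hL]
  field_simp
  ring

end GaussSmooth

/-! ### Bounds for the Mellin transform up to the line Re s = 1. -/

namespace GaussSmooth

open Complex Filter Topology MeasureTheory

/-- In the second derivative of -q(s)/s - 1/(s - 1) every term has a denominator of size at least
|t|, while q and its derivatives are O(|t|^(2/5)). -/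
theorem exists_norm_mellin_logSqError_le_of_one_le :
    ∃ C : ℝ, 0 ≤ C ∧ ∀ s : ℂ, 1 < s.re → s.re ≤ 2 → 1 ≤ |s.im| →
      ‖mellin logSqError (-s)‖ ≤ C * |s.im| ^ (-(3 / 5) : ℝ) := by
  obtain ⟨C₁, hC₁0, hC₁⟩ := exists_norm_charLogDeriv_le 1 (one_pow 2)
  obtain ⟨C₂, hC₂0, hC₂⟩ := exists_norm_charLogDeriv_le chi4 chi4_sq
  set A := C₁ + C₂ with hA
  refine ⟨5 * A + 2, by positivity, ?_⟩
  intro s hs1 hs2 him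
  set t := |s.im| with ht
  have ht0 : 0 < t := by linarith
  set q : ℂ → ℂ := fun z => charLogDeriv 1 z + charLogDeriv chi4 z with hq
  set q₁ : ℂ → ℂ := fun z => charLogDeriv₁ 1 z + charLogDeriv₁ chi4 z with hq₁
  set q₂ : ℂ → ℂ := fun z => charLogDeriv₂ 1 z + charLogDeriv₂ chi4 z with hq₂
  have hdq : ∀ z : ℂ, 1 < z.re → HasDerivAt q (q₁ z) z := fun z hz =>
    (hasDerivAt_charLogDeriv 1 hz).add (hasDerivAt_charLogDeriv chi4 hz)
  have hdq₁ : ∀ z : ℂ, 1 < z.re → HasDerivAt q₁ (q₂ z) z := fun z hz =>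
    (hasDerivAt_charLogDeriv₁ 1 hz).add (hasDerivAt_charLogDeriv₁ chi4 hz)
  have hne : ∀ z : ℂ, 1 < z.re → z ≠ 0 ∧ z - 1 ≠ 0 := by
    intro z hz
    constructor
    · rintro rfl
      simp at hz
      linarith
    · intro h
      have := congrArg re h
      simp at this
      linarith
  have hmem : {z : ℂ | 1 < z.re} ∈ 𝓝 s := (isOpen_lt continuous_const continuous_re).mem_nhds hs1
  have hd1 : ∀ z : ℂ, 1 < z.re → HasDerivAt (fun w => -q w / w - 1 / (w - 1))
      (-(q₁ z / z) + q z / z ^ 2 + 1 / (z - 1) ^ 2) z := by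
    intro z hz
    obtain ⟨h0, h1⟩ := hne z hz
    have h := ((hdq z hz).fun_neg.fun_div (hasDerivAt_id z) h0).fun_sub
      ((hasDerivAt_const z (1 : ℂ)).fun_div ((hasDerivAt_id z).sub_const 1) h1)
    convert! h using 1
    simp only [id]
    field_simp
    ring
  have hd2 : HasDerivAt (fun z => -(q₁ z / z) + q z / z ^ 2 + 1 / (z - 1) ^ 2)
      (-(q₂ s / s) + 2 * (q₁ s / s ^ 2) - 2 * (q s / s ^ 3) - 2 / (s - 1) ^ 3) s := by
    obtain ⟨h0, h1⟩ := hne s hs1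
    have h := (((hdq₁ s hs1).fun_div (hasDerivAt_id s) h0).fun_neg.fun_add
      ((hdq s hs1).fun_div ((hasDerivAt_id s).fun_pow 2) (pow_ne_zero 2 h0))).fun_add
      ((hasDerivAt_const s (1 : ℂ)).fun_div (((hasDerivAt_id s).sub_const 1).fun_pow 2)
        (pow_ne_zero 2 h1))
    convert! h using 1
    simp only [id]
    push_cast
    field_simp
    ring
  have heq : mellin logSqError (-s) =
      -(q₂ s / s) + 2 * (q₁ s / s ^ 2) - 2 * (q s / s ^ 3) - 2 / (s - 1) ^ 3 := by
    rw [← iteratedDeriv_errorTransform hs1, iteratedDeriv_succ, iteratedDeriv_one]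
    have h1 : deriv errorTransform =ᶠ[𝓝 s]
        fun z => -(q₁ z / z) + q z / z ^ 2 + 1 / (z - 1) ^ 2 := by
      filter_upwards [hmem] with z hz
      have h2 : errorTransform =ᶠ[𝓝 z] fun w => -q w / w - 1 / (w - 1) := by
        filter_upwards [(isOpen_lt continuous_const continuous_re).mem_nhds hz] with w hw
        exact errorTransform_eq hw
      rw [h2.deriv_eq]
      exact (hd1 z hz).deriv
    rw [h1.deriv_eq]
    exact hd2.deriv
  obtain ⟨a0, a1, a2⟩ := hC₁ s hs1 hs2 him
  obtain ⟨b0, b1, b2⟩ := hC₂ s hs1 hs2 him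
  rw [← ht] at a0 a1 a2 b0 b1 b2
  set τ := t ^ (2 / 5 : ℝ) with hτ
  have hτ0 : 0 < τ := by positivity
  have e0 : ‖q s‖ ≤ A * τ := (norm_add_le _ _).trans (by rw [hA]; linarith)
  have e1 : ‖q₁ s‖ ≤ A * τ := (norm_add_le _ _).trans (by rw [hA]; linarith)
  have e2 : ‖q₂ s‖ ≤ A * τ := (norm_add_le _ _).trans (by rw [hA]; linarith)
  have hst : t ≤ ‖s‖ := abs_im_le_norm s
  have hst1 : t ≤ ‖s - 1‖ := by simpa using abs_im_le_norm (s - 1)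
  have hτt : t ^ (-(3 / 5) : ℝ) = τ / t := by
    rw [hτ, ← Real.rpow_sub_one ht0.ne']
    norm_num
  have hA0 : 0 ≤ A * τ := by positivity
  have hpow : ∀ (w : ℂ) (k : ℕ), t ≤ ‖w‖ → 1 ≤ k → t ≤ ‖w ^ k‖ := by
    intro w k hw hk
    rw [norm_pow]
    exact hw.trans (le_self_pow₀ (him.trans hw) (by omega))
  have f2 : ‖q₂ s / s‖ ≤ A * τ / t := by
    rw [norm_div]
    exact div_le_div₀ hA0 e2 ht0 hst
  have f1 : ‖q₁ s / s ^ 2‖ ≤ A * τ / t := by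
    rw [norm_div]
    exact div_le_div₀ hA0 e1 ht0 (hpow _ _ hst (by norm_num))
  have f0 : ‖q s / s ^ 3‖ ≤ A * τ / t := by
    rw [norm_div]
    exact div_le_div₀ hA0 e0 ht0 (hpow _ _ hst (by norm_num))
  have f3 : ‖2 / (s - 1) ^ 3‖ ≤ 2 * τ / t := by
    rw [norm_div, RCLike.norm_ofNat]
    refine div_le_div₀ (by positivity) ?_ ht0 (hpow _ _ hst1 (by norm_num))
    have : 1 ≤ τ := Real.one_le_rpow him (by norm_num)
    linarith
  rw [heq, hτt]
  calc _ ≤ ‖q₂ s / s‖ + 2 * ‖q₁ s / s ^ 2‖ + 2 * ‖q s / s ^ 3‖ + ‖2 / (s - 1) ^ 3‖ := by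
        refine (norm_sub_le _ _).trans (add_le_add ((norm_sub_le _ _).trans (add_le_add
          ((norm_add_le _ _).trans (add_le_add ?_ ?_)) ?_)) le_rfl)
        · rw [norm_neg]
        · rw [norm_mul, RCLike.norm_ofNat]
        · rw [norm_mul, RCLike.norm_ofNat]
    _ ≤ A * τ / t + 2 * (A * τ / t) + 2 * (A * τ / t) + 2 * τ / t := by linarith
    _ = _ := by ring

/-- The continuation of `errorTransform` to a neighbourhood of the half-plane `Re s ≥ 1`. -/
noncomputable def errorTransformExt (s : ℂ) : ℂ :=
  -(deriv (DirichletCharacter.LFunctionTrivChar₁ 4) s / DirichletCharacter.LFunctionTrivChar₁ 4 s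
    + deriv (DirichletCharacter.LFunction chi4) s / DirichletCharacter.LFunction chi4 s + 1) / s

/-- Analyticity on the closed half-plane is the nonvanishing of the L-functions on Re s ≥ 1,
together with that of (s - 1) L(s, χ₀) at s = 1. -/
theorem analyticAt_errorTransformExt {s : ℂ} (hs : 1 ≤ s.re) :
    AnalyticAt ℂ errorTransformExt s := by
  have h1 : AnalyticAt ℂ (DirichletCharacter.LFunctionTrivChar₁ 4) s :=
    (DirichletCharacter.differentiable_LFunctionTrivChar₁ 4).analyticAt s
  have h2 : AnalyticAt ℂ (DirichletCharacter.LFunction chi4) s :=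
    (DirichletCharacter.differentiable_LFunction chi4_ne_one).analyticAt s
  have n1 : DirichletCharacter.LFunctionTrivChar₁ 4 s ≠ 0 := by
    by_cases h : s = 1
    · rw [h]
      exact DirichletCharacter.LFunctionTrivChar₁_apply_one_ne_zero 4
    · rw [DirichletCharacter.LFunctionTrivChar₁, Function.update_of_ne h]
      exact mul_ne_zero (sub_ne_zero.2 h)
        (DirichletCharacter.LFunction_ne_zero_of_one_le_re _ (Or.inr h) hs)
  have n2 : DirichletCharacter.LFunction chi4 s ≠ 0 :=
    DirichletCharacter.LFunction_ne_zero_of_one_le_re _ (Or.inl chi4_ne_one) hs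
  have hs0 : s ≠ 0 := by
    rintro rfl
    norm_num at hs
  exact (((h1.deriv.fun_div h1 n1).fun_add (h2.deriv.fun_div h2 n2)).fun_add
    analyticAt_const).fun_neg.fun_div analyticAt_id hs0

theorem charLogDeriv_eq (ψ : DirichletCharacter ℂ 4) {s : ℂ} (hs : 1 < s.re) :
    charLogDeriv ψ s =
      deriv (DirichletCharacter.LFunction ψ) s / DirichletCharacter.LFunction ψ s := by
  rw [charLogDeriv, iteratedDeriv_one, DirichletCharacter.deriv_LFunction_eq_deriv_LSeries ψ hs,
    DirichletCharacter.LFunction_eq_LSeries ψ hs]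
  rfl

/-- The factor s - 1 in `LFunctionTrivChar₁` contributes 1/(s - 1) to the logarithmic derivative;
with the added 1 this is s/(s - 1), and division by s leaves the polar term of `errorTransform_eq`.
-/
theorem errorTransformExt_eq {s : ℂ} (hs : 1 < s.re) : errorTransformExt s = errorTransform s := by
  have hs1 : s ≠ 1 := by
    rintro rfl
    simp at hs
  have hs0 : s ≠ 0 := by
    rintro rfl
    simp at hs
    linarith
  have hs1' : s - 1 ≠ 0 := sub_ne_zero.2 hs1
  have hL : DirichletCharacter.LFunctionTrivChar 4 s ≠ 0 :=
    DirichletCharacter.LFunction_ne_zero_of_one_le_re _ (Or.inr hs1) hs.le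
  rw [errorTransform_eq hs, charLogDeriv_eq 1 hs, charLogDeriv_eq chi4 hs, errorTransformExt,
    DirichletCharacter.deriv_LFunctionTrivChar₁_apply_of_ne_one 4 hs1,
    DirichletCharacter.LFunctionTrivChar₁, Function.update_of_ne hs1]
  have hX : DirichletCharacter.LFunction chi4 s ≠ 0 :=
    DirichletCharacter.LFunction_ne_zero_of_one_le_re _ (Or.inl chi4_ne_one) hs.le
  change _ = -(deriv (DirichletCharacter.LFunctionTrivChar 4) s /
    DirichletCharacter.LFunctionTrivChar 4 s + _) / s - _
  field_simp
  ring

/-- At small height the growth bounds say nothing, but the continuation is analytic on a compact box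
that includes the edge Re s = 1. -/
theorem exists_norm_mellin_logSqError_le_of_le_one :
    ∃ C : ℝ, 0 ≤ C ∧ ∀ s : ℂ, 1 < s.re → s.re ≤ 2 → |s.im| ≤ 1 →
      ‖mellin logSqError (-s)‖ ≤ C := by
  have hcomp : IsCompact (Set.Icc (1 : ℝ) 2 ×ℂ Set.Icc (-1 : ℝ) 1) :=
    isCompact_Icc.reProdIm isCompact_Icc
  have hcont : ContinuousOn (iteratedDeriv 2 errorTransformExt)
      (Set.Icc (1 : ℝ) 2 ×ℂ Set.Icc (-1 : ℝ) 1) := by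
    intro z hz
    have hz1 : 1 ≤ z.re := (Complex.mem_reProdIm.1 hz).1.1
    rw [iteratedDeriv_eq_iterate]
    exact ((analyticAt_errorTransformExt hz1).iterated_deriv 2).continuousAt.continuousWithinAt
  obtain ⟨C, hC⟩ := hcomp.exists_bound_of_continuousOn hcont
  refine ⟨max C 0, le_max_right _ _, ?_⟩
  intro s hs1 hs2 him
  have heq : errorTransform =ᶠ[𝓝 s] errorTransformExt := by
    filter_upwards [(isOpen_lt continuous_const continuous_re).mem_nhds hs1] with w hw
    exact (errorTransformExt_eq hw).symm
  rw [← iteratedDeriv_errorTransform hs1, heq.iteratedDeriv_eq]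
  exact (hC s (Complex.mem_reProdIm.2 ⟨⟨hs1.le, hs2⟩, abs_le.1 him⟩)).trans (le_max_left _ _)

theorem exists_norm_mellin_logSqError_le :
    ∃ C : ℝ, 0 ≤ C ∧ ∀ s : ℂ, 1 < s.re → s.re ≤ 2 →
      ‖mellin logSqError (-s)‖ ≤ C * (1 + |s.im|) ^ (-(3 / 5) : ℝ) := by
  obtain ⟨C₁, hC₁0, hC₁⟩ := exists_norm_mellin_logSqError_le_of_one_le
  obtain ⟨C₂, hC₂0, hC₂⟩ := exists_norm_mellin_logSqError_le_of_le_one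
  have h2 : (1 / 2 : ℝ) ≤ 2 ^ (-(3 / 5) : ℝ) := by
    calc (1 / 2 : ℝ) = 2 ^ (-1 : ℝ) := by rw [Real.rpow_neg_one]; norm_num
      _ ≤ _ := Real.rpow_le_rpow_of_exponent_le one_le_two (by norm_num)
  refine ⟨2 * (C₁ + C₂), by positivity, ?_⟩
  intro s hs1 hs2
  have h0 := abs_nonneg s.im
  rcases le_total 1 |s.im| with h | h
  · have h3 : (2 * |s.im|) ^ (-(3 / 5) : ℝ) ≤ (1 + |s.im|) ^ (-(3 / 5) : ℝ) :=
      Real.rpow_le_rpow_of_nonpos (by linarith) (by linarith) (by norm_num)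
    rw [Real.mul_rpow two_pos.le h0] at h3
    have h4 : 0 < |s.im| ^ (-(3 / 5) : ℝ) := Real.rpow_pos_of_pos (by linarith) _
    have h5 : |s.im| ^ (-(3 / 5) : ℝ) ≤ 2 * (1 + |s.im|) ^ (-(3 / 5) : ℝ) := by nlinarith
    calc _ ≤ C₁ * |s.im| ^ (-(3 / 5) : ℝ) := hC₁ s hs1 hs2 h
      _ ≤ (C₁ + C₂) * (2 * (1 + |s.im|) ^ (-(3 / 5) : ℝ)) := by gcongr; linarith
      _ = _ := by ring
  · have h3 : (2 : ℝ) ^ (-(3 / 5) : ℝ) ≤ (1 + |s.im|) ^ (-(3 / 5) : ℝ) :=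
      Real.rpow_le_rpow_of_nonpos (by linarith) (by linarith) (by norm_num)
    calc _ ≤ C₂ := hC₂ s hs1 hs2 h
      _ ≤ (C₁ + C₂) * (2 * (1 + |s.im|) ^ (-(3 / 5) : ℝ)) := by nlinarith
      _ = _ := by ring

end GaussSmooth

/-! ### From the L² bound to the prime number theorem modulo 4. -/

namespace GaussSmooth

open Complex Filter Topology MeasureTheory
open scoped FourierTransform SchwartzMap ContDiff

/-- `logSqError` in logarithmic scale, with an exponential damping factor. -/
noncomputable def dampedError (δ u : ℝ) : ℂ :=
  Real.exp ((1 + δ) * u) • logSqError (Real.exp (-u))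

/-- The substitution x = e^(-u) makes the Fourier transform the Mellin transform on the line Re s =
1 + δ. The damping δ > 0 keeps the function integrable, and all bounds are uniform in δ. -/
theorem fourier_dampedError (δ ξ : ℝ) :
    𝓕 (dampedError δ) ξ = mellin logSqError (-(1 + δ - 2 * Real.pi * ξ * I)) := by
  rw [mellin_eq_fourier]
  have h1 : (-(1 + δ - 2 * Real.pi * ξ * I) : ℂ).re = -(1 + δ) := by simp
  have h2 : (-(1 + δ - 2 * Real.pi * ξ * I) : ℂ).im = 2 * Real.pi * ξ := by simp
  rw [h1, h2, neg_neg, mul_div_cancel_left₀ _ (by positivity)]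
  rfl

theorem integrable_dampedError {δ : ℝ} (hδ : 0 < δ) : Integrable (dampedError δ) := by
  have h := (mellin_log_smul_splitError (s := 1 + δ) (by simpa using hδ)).1
  have himage : (fun u : ℝ => Real.exp (-u)) '' Set.univ = Set.Ioi 0 := by
    ext x
    simp only [Set.image_univ, Set.mem_range, Set.mem_Ioi]
    constructor
    · rintro ⟨u, rfl⟩
      exact Real.exp_pos _
    · intro hx
      exact ⟨-Real.log x, by rw [neg_neg, Real.exp_log hx]⟩
  have hderiv : ∀ u ∈ Set.univ, HasDerivWithinAt (fun u : ℝ => Real.exp (-u)) (-Real.exp (-u))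
      Set.univ u := by
    intro u _
    have := ((Real.hasDerivAt_exp (-u)).comp u (hasDerivAt_neg u)).hasDerivWithinAt (s := Set.univ)
    simpa [Function.comp_def] using! this
  have hinj : Set.InjOn (fun u : ℝ => Real.exp (-u)) Set.univ := by
    intro a _ b _ hab
    exact neg_injective (Real.exp_injective hab)
  rw [MellinConvergent, ← himage, integrableOn_image_iff_integrableOn_abs_deriv_smul
    MeasurableSet.univ hderiv hinj, integrableOn_univ] at h
  refine h.congr (Eventually.of_forall fun u => ?_)
  have hpos := Real.exp_pos (-u)
  have hcp : ((Real.exp (-u) : ℝ) : ℂ) ^ (-(1 + δ : ℂ) - 1) =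
      ((Real.exp (-u) ^ (-(1 + δ) - 1) : ℝ) : ℂ) := by
    rw [ofReal_cpow hpos.le]
    push_cast
    rfl
  simp only [dampedError]
  rw [hcp, abs_neg, abs_of_pos hpos, ← Real.exp_mul]
  rw [real_smul, smul_eq_mul, real_smul, ← mul_assoc, ← ofReal_mul, ← Real.exp_add]
  congr 3
  ring

/-- The Fourier transform of `dampedError δ` is square-integrable, uniformly in `δ`. -/
theorem exists_norm_integral_dampedError_le :
    ∃ K : ℝ, 0 ≤ K ∧ ∀ δ : ℝ, 0 < δ → δ ≤ 1 → ∀ b : 𝓢(ℝ, ℂ),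
      ‖∫ u, dampedError δ u * b u‖ ≤ K * Real.sqrt (∫ u, ‖b u‖ ^ 2) := by
  obtain ⟨C, hC0, hC⟩ := exists_norm_mellin_logSqError_le
  set w : ℝ → ℝ := fun ξ => (1 + ‖ξ‖) ^ (-(3 / 5) : ℝ) with hw
  have hwc : Continuous w := by
    refine Continuous.rpow_const (by fun_prop) fun ξ => Or.inl ?_
    positivity
  have hw0 : ∀ ξ, 0 ≤ w ξ := fun ξ => by positivity
  -- The exponent 6/5 exceeds 1, so the majorant is square-integrable.
  have hw2 : ∀ ξ, w ξ ^ 2 = (1 + ‖ξ‖) ^ (-(6 / 5) : ℝ) := fun ξ => by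
    rw [hw, ← Real.rpow_natCast, ← Real.rpow_mul (by positivity)]
    norm_num
  have hwint : Integrable fun ξ => w ξ ^ 2 := by
    simp_rw [hw2]
    exact integrable_one_add_norm (by norm_num)
  have hwL : MemLp w (ENNReal.ofReal 2) := by
    rw [ENNReal.ofReal_ofNat]
    exact (memLp_two_iff_integrable_sq hwc.aestronglyMeasurable).2 hwint
  refine ⟨C * Real.sqrt (∫ ξ, w ξ ^ 2), by positivity, ?_⟩
  intro δ hδ hδ1 b
  have hΦ : ∀ ξ, ‖𝓕 (dampedError δ) ξ‖ ≤ C * w ξ := by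
    intro ξ
    rw [fourier_dampedError]
    have hre : (1 + δ - 2 * Real.pi * ξ * I : ℂ).re = 1 + δ := by simp
    have him : (1 + δ - 2 * Real.pi * ξ * I : ℂ).im = -(2 * Real.pi * ξ) := by simp
    refine (hC _ (by rw [hre]; linarith) (by rw [hre]; linarith)).trans ?_
    rw [him, abs_neg, abs_mul, abs_of_pos (by positivity : 0 < 2 * Real.pi)]
    refine mul_le_mul_of_nonneg_left ?_ hC0
    refine Real.rpow_le_rpow_of_nonpos (by positivity) ?_ (by norm_num)
    rw [Real.norm_eq_abs]
    have := Real.pi_gt_three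
    nlinarith [abs_nonneg ξ]
  -- Writing b as the Fourier transform of g moves the transform onto `dampedError δ`. After
  -- Cauchy-Schwarz, Plancherel's formula is needed only for the Schwartz function g.
  set g : 𝓢(ℝ, ℂ) := 𝓕⁻ b with hg
  have hgb : 𝓕 g = b := FourierTransform.fourier_fourierInv_eq b
  have hflip : ∫ u, dampedError δ u * b u = ∫ ξ, 𝓕 (dampedError δ) ξ * g ξ := by
    have h := VectorFourier.integral_bilin_fourierIntegral_eq_flip (μ := volume) (ν := volume)
      (ContinuousLinearMap.mul ℂ ℂ) (L := innerₗ ℝ)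
      Real.continuous_fourierChar continuous_inner (integrable_dampedError hδ) g.integrable
    rw [← hgb]
    simpa using! h.symm
  have hplan : ∫ ξ, ‖g ξ‖ ^ 2 = ∫ u, ‖b u‖ ^ 2 := by
    rw [← hgb]
    exact (SchwartzMap.integral_norm_sq_fourier g).symm
  have hgL : MemLp (fun ξ => ‖g ξ‖) (ENNReal.ofReal 2) := by
    rw [ENNReal.ofReal_ofNat]
    exact (g.memLp 2).norm
  rw [hflip]
  have hgi : Integrable fun ξ => w ξ * ‖g ξ‖ := by
    have h1 : MemLp w 2 := by simpa using hwL
    have h2 : MemLp (fun ξ => ‖g ξ‖) 2 := by simpa using hgL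
    exact h1.integrable_mul h2
  calc ‖∫ ξ, 𝓕 (dampedError δ) ξ * g ξ‖ ≤ ∫ ξ, C * (w ξ * ‖g ξ‖) := by
        refine norm_integral_le_of_norm_le (hgi.const_mul C) (Eventually.of_forall fun ξ => ?_)
        rw [norm_mul, ← mul_assoc]
        exact mul_le_mul_of_nonneg_right (hΦ ξ) (norm_nonneg _)
    _ = C * ∫ ξ, w ξ * ‖g ξ‖ := integral_const_mul _ _
    _ ≤ C * ((∫ ξ, w ξ ^ (2 : ℝ)) ^ (1 / 2 : ℝ) * (∫ ξ, ‖g ξ‖ ^ (2 : ℝ)) ^ (1 / 2 : ℝ)) := by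
        refine mul_le_mul_of_nonneg_left ?_ hC0
        exact integral_mul_le_Lp_mul_Lq_of_nonneg Real.HolderConjugate.two_two
          (Eventually.of_forall hw0) (Eventually.of_forall fun _ => norm_nonneg _) hwL hgL
    _ = _ := by
        simp only [Real.rpow_two]
        rw [hplan, ← Real.sqrt_eq_rpow, ← Real.sqrt_eq_rpow, mul_assoc]

/-- If `dampedError δ` has a definite sign and size on an interval, then that interval is short. -/
theorem exists_mul_sqrt_le :
    ∃ K : ℝ, 0 ≤ K ∧ ∀ δ : ℝ, 0 < δ → δ ≤ 1 → ∀ c η m e : ℝ, 0 < η → 0 ≤ m → |e| = 1 →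
      (∀ u, |u - c| < η / 2 → m ≤ e * (dampedError δ u).re) → m * Real.sqrt η ≤ K := by
  obtain ⟨K, hK0, hK⟩ := exists_norm_integral_dampedError_le
  refine ⟨2 * K, by positivity, ?_⟩
  intro δ hδ hδ1 c η m e hη hm he h
  -- The bump is 1 on an interval of length η/2, so the pairing is at least m η/2; its support has
  -- length η, so its L² norm is at most √η.
  let f : ContDiffBump c := ⟨η / 4, η / 2, by positivity, by linarith⟩
  have hcs : HasCompactSupport fun u => ((f u : ℝ) : ℂ) :=
    f.hasCompactSupport.comp_left ofReal_zero
  have hcd : ContDiff ℝ ∞ fun u => ((f u : ℝ) : ℂ) := ofRealCLM.contDiff.comp f.contDiff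
  set b : 𝓢(ℝ, ℂ) := hcs.toSchwartzMap hcd with hb
  have hbu : ∀ u, b u = ((f u : ℝ) : ℂ) := fun u => rfl
  have hf0 : ∀ u, u ∉ Metric.ball c (η / 2) → f u = 0 := fun u hu =>
    f.zero_of_le_dist (not_lt.1 (fun h => hu (Metric.mem_ball.2 h)))
  have hmain := hK δ hδ hδ1 b
  have hsq : ∫ u, ‖b u‖ ^ 2 ≤ η := by
    have h1 : ∫ u, Set.indicator (Metric.ball c (η / 2)) (fun _ => (1 : ℝ)) u = η := by
      rw [integral_indicator Metric.isOpen_ball.measurableSet, setIntegral_const, smul_eq_mul,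
        mul_one, Real.volume_real_ball (by positivity)]
      ring
    rw [← h1]
    refine integral_mono_of_nonneg (Eventually.of_forall fun u => by positivity) ?_
      (Eventually.of_forall fun u => ?_)
    · exact (integrable_indicator_iff Metric.isOpen_ball.measurableSet).2
        (integrableOn_const (by exact measure_ball_lt_top.ne))
    · simp only [hbu, norm_real]
      by_cases hu : u ∈ Metric.ball c (η / 2)
      · rw [Set.indicator_of_mem hu, Real.norm_of_nonneg f.nonneg]
        exact pow_le_one₀ f.nonneg f.le_one
      · rw [Set.indicator_of_notMem hu, hf0 u hu]
        simp
  have hint : Integrable fun u => dampedError δ u * b u := by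
    have := (integrable_dampedError hδ).bdd_mul (c := 1) b.continuous.aestronglyMeasurable
      (Eventually.of_forall fun u => by
        rw [hbu, norm_real, Real.norm_of_nonneg f.nonneg]; exact f.le_one)
    simpa [mul_comm] using this
  have hlow : m * (η / 2) ≤ e * (∫ u, dampedError δ u * b u).re := by
    have h1 : ∫ u, Set.indicator (Metric.closedBall c (η / 4)) (fun _ => m) u = m * (η / 2) := by
      rw [integral_indicator Metric.isClosed_closedBall.measurableSet, setIntegral_const,
        smul_eq_mul, Real.volume_real_closedBall (by positivity)]
      ring
    have h2 : (∫ u, dampedError δ u * b u).re = ∫ u, (dampedError δ u).re * f u := by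
      have := integral_re hint
      simp only [RCLike.re_to_complex] at this
      rw [← this]
      refine integral_congr_ae (Eventually.of_forall fun u => ?_)
      simp [hbu]
    have h3 : Integrable fun u => (dampedError δ u).re * f u := by
      refine hint.re.congr (Eventually.of_forall fun u => ?_)
      simp [hbu]
    rw [← h1, h2, ← integral_const_mul]
    refine integral_mono ?_ (h3.const_mul e) fun u => ?_
    · exact (integrable_indicator_iff Metric.isClosed_closedBall.measurableSet).2
        (integrableOn_const (by exact measure_closedBall_lt_top.ne))
    · show Set.indicator (Metric.closedBall c (η / 4)) (fun _ => m) u ≤ _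
      by_cases hu : u ∈ Metric.ball c (η / 2)
      · have h4 := h u (by rwa [Metric.mem_ball, Real.dist_eq] at hu)
        by_cases hu2 : u ∈ Metric.closedBall c (η / 4)
        · rw [Set.indicator_of_mem hu2, f.one_of_mem_closedBall hu2, mul_one]
          exact h4
        · rw [Set.indicator_of_notMem hu2, ← mul_assoc]
          exact mul_nonneg (hm.trans h4) f.nonneg
      · rw [hf0 u hu, mul_zero, mul_zero]
        refine le_of_eq (Set.indicator_of_notMem (fun hu2 => hu ?_) _)
        exact Metric.closedBall_subset_ball (by linarith) hu2
  have hup : e * (∫ u, dampedError δ u * b u).re ≤ K * Real.sqrt η := by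
    calc e * (∫ u, dampedError δ u * b u).re ≤ |e * (∫ u, dampedError δ u * b u).re| := le_abs_self _
      _ = |(∫ u, dampedError δ u * b u).re| := by rw [abs_mul, he, one_mul]
      _ ≤ ‖∫ u, dampedError δ u * b u‖ := abs_re_le_norm _
      _ ≤ K * Real.sqrt (∫ u, ‖b u‖ ^ 2) := hmain
      _ ≤ K * Real.sqrt η := by gcongr
  have hs : Real.sqrt η * Real.sqrt η = η := Real.mul_self_sqrt hη.le
  have hs0 : 0 < Real.sqrt η := Real.sqrt_pos.2 hη
  have h5 : m * (Real.sqrt η * Real.sqrt η / 2) ≤ K * Real.sqrt η := by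
    rw [hs]; linarith
  refine le_of_mul_le_mul_right ?_ hs0
  linarith

/-- The relative error in the prime number theorem, in logarithmic scale. -/
noncomputable def relError (v : ℝ) : ℝ := splitPsi (Real.exp v) * Real.exp (-v) - 1

theorem re_dampedError (δ : ℝ) {v : ℝ} (hv : 0 < v) :
    (dampedError δ (-v)).re = Real.exp (-(δ * v)) * (v ^ 2 * relError v) := by
  have h1 : Real.exp v ∈ Set.Ioi (1 : ℝ) := by
    simpa using hv
  rw [dampedError, neg_neg, logSqError, splitError, Set.indicator_of_mem h1, Real.log_exp, relError]
  simp only [real_smul, ← ofReal_mul, ofReal_re]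
  have h2 : Real.exp ((1 + δ) * -v) = Real.exp (-(δ * v)) * Real.exp (-v) := by
    rw [← Real.exp_add]; ring_nf
  have h3 : Real.exp v * Real.exp (-v) = 1 := by rw [← Real.exp_add]; simp
  rw [h2]
  linear_combination (-Real.exp (-(δ * v)) * v ^ 2) * h3

theorem abs_relError_le {v : ℝ} (hv : 0 < v) : |relError v| ≤ 20 := by
  have h := norm_splitError_le (Real.exp v)
  rw [splitError, Set.indicator_of_mem (show Real.exp v ∈ Set.Ioi (1 : ℝ) by simpa using hv),
    norm_real, Real.norm_eq_abs, abs_of_pos (Real.exp_pos v)] at h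
  have h3 : Real.exp v * Real.exp (-v) = 1 := by rw [← Real.exp_add]; simp
  have h4 : relError v = (splitPsi (Real.exp v) - Real.exp v) * Real.exp (-v) := by
    rw [relError]; linear_combination h3
  rw [h4, abs_mul, abs_of_pos (Real.exp_pos (-v))]
  calc _ ≤ 20 * Real.exp v * Real.exp (-v) := by gcongr
    _ = 20 := by rw [mul_assoc, h3, mul_one]

/-- The monotonicity of `splitPsi` limits how fast the relative error can decrease. -/
theorem relError_ge {v w : ℝ} (hvw : v ≤ w) :
    (1 + relError v) * (1 - (w - v)) ≤ 1 + relError w := by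
  have h1 : splitPsi (Real.exp v) ≤ splitPsi (Real.exp w) := splitPsi_mono (Real.exp_le_exp.2 hvw)
  have h2 : Real.exp (-w) = Real.exp (-v) * Real.exp (-(w - v)) := by
    rw [← Real.exp_add]; ring_nf
  have h3 : 1 - (w - v) ≤ Real.exp (-(w - v)) := by
    have := Real.add_one_le_exp (-(w - v)); linarith
  have h4 := splitPsi_nonneg (Real.exp v)
  have e0 := Real.exp_pos (-v)
  simp only [relError, add_sub_cancel]
  calc splitPsi (Real.exp v) * Real.exp (-v) * (1 - (w - v))
      ≤ splitPsi (Real.exp v) * Real.exp (-v) * Real.exp (-(w - v)) := by gcongr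
    _ = splitPsi (Real.exp v) * Real.exp (-w) := by rw [h2]; ring
    _ ≤ _ := by gcongr

/-- A relative error of size ε at v persists, at size ε/2 at least, on an adjacent interval of
length proportional to ε: to the right if it is positive, to the left if negative.
`exists_mul_sqrt_le` on that interval bounds v² ε √ε. -/
theorem exists_relError_pow_le :
    ∃ K : ℝ, 0 ≤ K ∧ ∀ v : ℝ, 2 ≤ v → |relError v| ^ 3 * v ^ 4 ≤ K := by
  obtain ⟨K, hK0, hK⟩ := exists_mul_sqrt_le
  refine ⟨400 * 42 * K ^ 2, by positivity, ?_⟩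
  intro v hv
  have hv0 : 0 < v := by linarith
  rcases eq_or_ne (relError v) 0 with h0 | h0
  · rw [h0]
    simp
    positivity
  set ε := |relError v| with hε
  have hε0 : 0 < ε := abs_pos.2 h0
  have hε20 : ε ≤ 20 := abs_relError_le hv0
  -- As ε ≤ 20, this gives (1 + ε) η ≤ ε/2, which is the loss allowed over the interval.
  set η := ε / 42 with hη
  have hη0 : 0 < η := by positivity
  have hη1 : η ≤ 1 / 2 := by rw [hη]; linarith
  -- The factor 1/20 is (1/5)(1/2)(1/2): the damping is at least 1/5, w² at least v²/2 and the error
  -- at least ε/2.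
  set m := v ^ 2 * ε / 20 with hm
  have hm0 : 0 ≤ m := by positivity
  -- The damping parameter is δ = 1/v, so that the damping is bounded below near v; the uniformity
  -- in δ is used here.
  have hexp : ∀ w, w ≤ v + 1 / 2 → 1 / 5 ≤ Real.exp (-(1 / v * w)) := by
    intro w hw
    have h1 : 1 / v * w ≤ 3 / 2 := by
      rw [one_div_mul_eq_div, div_le_iff₀ hv0]
      nlinarith
    have h2 : Real.exp (-(3 / 2)) ≤ Real.exp (-(1 / v * w)) := Real.exp_le_exp.2 (by linarith)
    have h3 : Real.exp (3 / 2) ≤ 5 := by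
      have h4 : Real.exp (3 / 2) ^ 2 ≤ 5 ^ 2 := by
        rw [← Real.exp_nat_mul]
        have h5 : Real.exp (((2 : ℕ) : ℝ) * (3 / 2)) = Real.exp 1 ^ 3 := by
          rw [← Real.exp_nat_mul]; norm_num
        rw [h5]
        have h6 := Real.exp_one_lt_d9
        calc Real.exp 1 ^ 3 ≤ 2.7182818286 ^ 3 := by gcongr
          _ ≤ 5 ^ 2 := by norm_num
      exact le_of_pow_le_pow_left₀ two_ne_zero (by norm_num) h4
    refine le_trans ?_ h2
    rw [Real.exp_neg, one_div]
    exact inv_anti₀ (Real.exp_pos _) h3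
  have key : m * Real.sqrt η ≤ K := by
    rcases lt_or_gt_of_ne h0 with hneg | hpos
    · have hεe : ε = -relError v := abs_of_neg hneg
      refine hK (1 / v) (by positivity) (by rw [div_le_one hv0]; linarith) (-(v - η / 2)) η m (-1)
        hη0 hm0 (by simp) fun u hu => ?_
      rw [abs_lt] at hu
      set w := -u with hw
      have hw1 : v - η < w := by linarith
      have hw2 : w < v := by linarith
      have hw0 : 0 < w := by linarith
      rw [show u = -w by rw [hw, neg_neg], re_dampedError _ hw0]
      have h1 := relError_ge hw2.le
      have hle1 : ε ≤ 1 := by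
        rw [hεe, relError]
        have := mul_nonneg (splitPsi_nonneg (Real.exp v)) (Real.exp_pos (-v)).le
        linarith
      have h2 : ε / 2 ≤ -relError w := by
        by_contra hcon
        push Not at hcon
        have h3 : 1 + relError v = 1 - ε := by rw [hεe]; ring
        rw [h3] at h1
        have h4 : 1 - η ≤ 1 - (v - w) := by linarith
        have h5 : (1 - ε / 2) * (1 - η) ≤ (1 + relError w) * (1 - (v - w)) :=
          mul_le_mul (by linarith) h4 (by linarith) (by linarith)
        rw [hη] at h5
        nlinarith
      have h6 := hexp w (by linarith)
      have h7 : v ^ 2 / 2 ≤ w ^ 2 := by nlinarith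
      have h8 : v ^ 2 / 2 * (ε / 2) ≤ w ^ 2 * -relError w :=
        mul_le_mul h7 h2 (by positivity) (by positivity)
      calc m = 1 / 5 * (v ^ 2 / 2 * (ε / 2)) := by rw [hm]; ring
        _ ≤ Real.exp (-(1 / v * w)) * (w ^ 2 * -relError w) :=
          mul_le_mul h6 h8 (by positivity) (Real.exp_pos _).le
        _ = _ := by ring
    · have hεe : ε = relError v := abs_of_pos hpos
      refine hK (1 / v) (by positivity) (by rw [div_le_one hv0]; linarith) (-(v + η / 2)) η m 1
        hη0 hm0 (by simp) fun u hu => ?_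
      rw [abs_lt] at hu
      set w := -u with hw
      have hw1 : v < w := by linarith
      have hw2 : w < v + η := by linarith
      have hw0 : 0 < w := by linarith
      rw [show u = -w by rw [hw, neg_neg], re_dampedError _ hw0]
      have h1 := relError_ge hw1.le
      have h2 : ε / 2 ≤ relError w := by
        rw [← hεe] at h1
        have h4 : (1 + ε) * (1 - η) ≤ (1 + ε) * (1 - (w - v)) := by
          gcongr
          linarith
        rw [hη] at h4
        nlinarith
      have h6 := hexp w (by linarith)
      have h7 : v ^ 2 / 2 ≤ w ^ 2 := by nlinarith
      have h8 : v ^ 2 / 2 * (ε / 2) ≤ w ^ 2 * relError w :=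
        mul_le_mul h7 h2 (by positivity) (by positivity)
      calc m = 1 / 5 * (v ^ 2 / 2 * (ε / 2)) := by rw [hm]; ring
        _ ≤ Real.exp (-(1 / v * w)) * (w ^ 2 * relError w) :=
          mul_le_mul h6 h8 (by positivity) (Real.exp_pos _).le
        _ = _ := by ring
  have h9 : (m * Real.sqrt η) ^ 2 ≤ K ^ 2 := by gcongr
  rw [mul_pow, Real.sq_sqrt hη0.le, hm, hη] at h9
  nlinarith

/-- The prime number theorem for the residue class `1` modulo `4`, with an error term that is
integrable with respect to `dx / x²`. -/
theorem exists_abs_splitPsi_sub_le :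
    ∃ K : ℝ, 0 ≤ K ∧ ∀ x : ℝ, 1 ≤ x →
      |splitPsi x - x| ≤ K * x * (1 + Real.log x) ^ (-(4 / 3) : ℝ) := by
  obtain ⟨K, hK0, hK⟩ := exists_relError_pow_le
  have hsmall : ∀ x : ℝ, 1 ≤ x → |splitPsi x - x| ≤ 20 * x := by
    intro x hx
    have h1 := splitPsi_le (zero_le_one.trans hx)
    have h2 := splitPsi_nonneg x
    have h3 : Real.log 4 ≤ 4 - 1 := Real.log_le_sub_one_of_pos (by norm_num)
    rw [abs_le]
    constructor <;> nlinarith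
  set κ := K ^ (1 / 3 : ℝ) with hκ
  have hκ0 : 0 ≤ κ := by positivity
  have hκ3 : κ ^ 3 = K := by
    rw [hκ, ← Real.rpow_natCast, ← Real.rpow_mul hK0]
    norm_num
  refine ⟨180 + 9 * κ, by positivity, ?_⟩
  intro x hx
  have hx0 : 0 < x := by linarith
  set v := Real.log x with hv
  have hv0 : 0 ≤ v := Real.log_nonneg hx
  have hxv : x = Real.exp v := (Real.exp_log hx0).symm
  set P := (1 + v) ^ (-(4 / 3) : ℝ) with hP
  have hP0 : 0 < P := Real.rpow_pos_of_pos (by linarith) _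
  rcases le_total v 2 with h | h
  · have h1 : (1 / 9 : ℝ) ≤ P := by
      have h2 : (3 : ℝ) ^ (-(4 / 3) : ℝ) ≤ P :=
        Real.rpow_le_rpow_of_nonpos (by linarith) (by linarith) (by norm_num)
      refine le_trans ?_ h2
      calc (1 / 9 : ℝ) = 3 ^ (-2 : ℝ) := by rw [Real.rpow_neg (by norm_num)]; norm_num
        _ ≤ _ := Real.rpow_le_rpow_of_exponent_le (by norm_num) (by norm_num)
    have h3 : 20 * x ≤ 180 * x * P := by nlinarith
    have h4 : 0 ≤ 9 * κ * x * P := by positivity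
    linarith [hsmall x hx]
  · have hv2 := hK v h
    have h3 : Real.exp v * Real.exp (-v) = 1 := by rw [← Real.exp_add]; simp
    have h4 : splitPsi x - x = x * relError v := by
      rw [← hxv] at h3
      rw [relError, ← hxv]
      linear_combination -(splitPsi x) * h3
    have h5 : |relError v| ≤ κ * v ^ (-(4 / 3) : ℝ) := by
      refine le_of_pow_le_pow_left₀ (n := 3) (by norm_num) (by positivity) ?_
      have h6 : (v ^ (-(4 / 3) : ℝ)) ^ 3 = (v ^ 4)⁻¹ := by
        rw [← Real.rpow_natCast, ← Real.rpow_mul hv0, ← Real.rpow_natCast, ← Real.rpow_neg hv0]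
        norm_num
      rw [mul_pow, hκ3, h6, ← div_eq_mul_inv, le_div_iff₀ (by positivity)]
      exact hv2
    have h7 : v ^ (-(4 / 3) : ℝ) ≤ 9 * P := by
      have h8 : (3 * v) ^ (-(4 / 3) : ℝ) ≤ P :=
        Real.rpow_le_rpow_of_nonpos (by linarith) (by linarith) (by norm_num)
      rw [Real.mul_rpow (by norm_num) hv0] at h8
      have h1 : (1 / 9 : ℝ) ≤ 3 ^ (-(4 / 3) : ℝ) := by
        calc (1 / 9 : ℝ) = 3 ^ (-2 : ℝ) := by rw [Real.rpow_neg (by norm_num)]; norm_num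
          _ ≤ _ := Real.rpow_le_rpow_of_exponent_le (by norm_num) (by norm_num)
      have h9 : 0 ≤ v ^ (-(4 / 3) : ℝ) := by positivity
      nlinarith
    rw [h4, abs_mul, abs_of_pos hx0]
    calc x * |relError v| ≤ x * (κ * (9 * P)) := by
          gcongr
          exact h5.trans (by gcongr)
      _ = 9 * κ * x * P := by ring
      _ ≤ _ := by
        have : 0 ≤ 180 * x * P := by positivity
        linarith

end GaussSmooth

/-! ### Passage to primes and Abel summation. -/

namespace GaussSmooth

open Filter Topology MeasureTheory

/-- `2 log p` at the primes `p ≡ 1 (4)`. -/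
noncomputable def splitWeight (n : ℕ) : ℝ := if n.Prime ∧ n % 4 = 1 then 2 * Real.log n else 0

/-- `∑_{p ≤ x, p ≡ 1 (4)} 2 log p`. -/
noncomputable def splitTheta (x : ℝ) : ℝ := ∑ n ∈ Finset.Icc 0 ⌊x⌋₊, splitWeight n

theorem splitWeight_zero : splitWeight 0 = 0 := by simp [splitWeight]

theorem splitTheta_eq_Icc_one (x : ℝ) : splitTheta x = ∑ n ∈ Finset.Icc 1 ⌊x⌋₊, splitWeight n := by
  rw [splitTheta, ← Finset.insert_Icc_add_one_left_eq_Icc (Nat.zero_le _), Finset.sum_insert (by simp),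
    splitWeight_zero, zero_add]
  rfl

theorem abs_splitPsi_sub_splitTheta_le {x : ℝ} (hx : 1 ≤ x) :
    |splitPsi x - splitTheta x| ≤ 4 * Real.sqrt x * Real.log x := by
  have h1 := Chebyshev.psi_sub_theta_le hx
  have hL : ∀ n : ℕ, 0 ≤ ArithmeticFunction.vonMangoldt n := fun n =>
    ArithmeticFunction.vonMangoldt_nonneg
  have h2 : Chebyshev.psi x - Chebyshev.theta x =
      ∑ n ∈ Finset.Icc 1 ⌊x⌋₊, (ArithmeticFunction.vonMangoldt n -
        if n.Prime then Real.log n else 0) := by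
    rw [Finset.sum_sub_distrib, ← Finset.sum_filter]
    rfl
  have h3 : ∀ n : ℕ, 0 ≤ splitMangoldt n - splitWeight n ∧ splitMangoldt n - splitWeight n ≤
      2 * (ArithmeticFunction.vonMangoldt n - if n.Prime then Real.log n else 0) := by
    intro n
    unfold splitMangoldt splitWeight
    by_cases hp : n.Prime
    · have := ArithmeticFunction.vonMangoldt_apply_prime hp
      by_cases h4 : n % 4 = 1
      · simp [hp, h4, this]
      · simp [hp, h4, this]
    · have := hL n
      by_cases h4 : n % 4 = 1
      · simp [hp, h4, this]
      · simp [hp, h4, this]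
  have h4 : splitPsi x - splitTheta x =
      ∑ n ∈ Finset.Icc 1 ⌊x⌋₊, (splitMangoldt n - splitWeight n) := by
    rw [splitTheta_eq_Icc_one, splitPsi, Finset.sum_sub_distrib]
  rw [abs_of_nonneg (by rw [h4]; exact Finset.sum_nonneg fun n _ => (h3 n).1)]
  calc splitPsi x - splitTheta x ≤ 2 * (Chebyshev.psi x - Chebyshev.theta x) := by
        rw [h2, h4, Finset.mul_sum]
        exact Finset.sum_le_sum fun n _ => (h3 n).2
    _ ≤ 2 * (2 * Real.sqrt x * Real.log x) := by linarith
    _ = _ := by ring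

theorem exists_abs_splitTheta_sub_le :
    ∃ K : ℝ, 0 ≤ K ∧ ∀ x : ℝ, 1 ≤ x →
      |splitTheta x - x| ≤ K * x * (1 + Real.log x) ^ (-(4 / 3) : ℝ) := by
  obtain ⟨K, hK0, hK⟩ := exists_abs_splitPsi_sub_le
  refine ⟨K + 864, by positivity, ?_⟩
  intro x hx
  have hx0 : 0 < x := by linarith
  set v := Real.log x with hv
  have hv0 : 0 ≤ v := Real.log_nonneg hx
  have h1 := abs_splitPsi_sub_splitTheta_le hx
  have h2 := hK x hx
  have h3 : |splitTheta x - x| ≤ |splitPsi x - x| + |splitPsi x - splitTheta x| := by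
    have := abs_sub_le (splitTheta x) (splitPsi x) x
    rw [abs_sub_comm (splitTheta x) (splitPsi x)] at this
    linarith
  have h4 : Real.sqrt x * v ≤ 216 * x * (1 + v) ^ (-(4 / 3) : ℝ) := by
    have h5 : (1 + v) ^ 3 ≤ 216 * Real.sqrt x := by
      have h6 : 1 + v ≤ 6 * Real.exp (v / 6) := by
        have := Real.add_one_le_exp (v / 6); linarith
      have h7 : Real.exp (v / 6) ^ 3 = Real.sqrt x := by
        rw [← Real.exp_nat_mul, Real.sqrt_eq_rpow, Real.rpow_def_of_pos hx0]
        congr 1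
        push_cast
        ring
      calc (1 + v) ^ 3 ≤ (6 * Real.exp (v / 6)) ^ 3 := by gcongr
        _ = _ := by rw [mul_pow, h7]; norm_num
    have h8 : (1 + v) ^ (4 / 3 : ℝ) * v ≤ (1 + v) ^ 3 := by
      have h9 : (1 + v) ^ (4 / 3 : ℝ) ≤ (1 + v) ^ 2 := by
        rw [← Real.rpow_two]
        exact Real.rpow_le_rpow_of_exponent_le (by linarith) (by norm_num)
      calc (1 + v) ^ (4 / 3 : ℝ) * v ≤ (1 + v) ^ 2 * (1 + v) := by gcongr; linarith
        _ = _ := by ring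
    have h10 : 0 < (1 + v) ^ (4 / 3 : ℝ) := Real.rpow_pos_of_pos (by linarith) _
    rw [Real.rpow_neg (by linarith), ← div_eq_mul_inv, le_div_iff₀ h10]
    have hs : Real.sqrt x * Real.sqrt x = x := Real.mul_self_sqrt hx0.le
    calc Real.sqrt x * v * (1 + v) ^ (4 / 3 : ℝ) = Real.sqrt x * ((1 + v) ^ (4 / 3 : ℝ) * v) := by ring
      _ ≤ Real.sqrt x * (216 * Real.sqrt x) := mul_le_mul_of_nonneg_left (h8.trans h5) (Real.sqrt_nonneg x)
      _ = 216 * x := by linear_combination 216 * hs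
  calc _ ≤ K * x * (1 + v) ^ (-(4 / 3) : ℝ) + 4 * (Real.sqrt x * v) := by linarith
    _ ≤ K * x * (1 + v) ^ (-(4 / 3) : ℝ) + 4 * (216 * x * (1 + v) ^ (-(4 / 3) : ℝ)) := by gcongr
    _ = _ := by ring

/-- Abel summation against `n ^ (-σ)`. -/
theorem sum_rpow_neg_mul_eq {c : ℕ → ℝ} (hc : c 0 = 0) (σ : ℝ) (y : ℝ) :
    ∑ n ∈ Finset.Icc 0 ⌊y⌋₊, (n : ℝ) ^ (-σ) * c n =
      y ^ (-σ) * ∑ n ∈ Finset.Icc 0 ⌊y⌋₊, c n +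
        σ * ∫ t in Set.Ioc 1 y, t ^ (-σ - 1) * ∑ n ∈ Finset.Icc 0 ⌊t⌋₊, c n := by
  have hd : ∀ t : ℝ, 0 < t → HasDerivAt (fun t : ℝ => t ^ (-σ)) (-σ * t ^ (-σ - 1)) t := fun t ht =>
    Real.hasDerivAt_rpow_const (Or.inl ht.ne')
  have hcont : ContinuousOn (fun t : ℝ => -σ * t ^ (-σ - 1)) (Set.Icc 1 y) := by
    refine continuousOn_const.mul (ContinuousOn.rpow_const continuousOn_id fun t ht => Or.inl ?_)
    exact (zero_lt_one.trans_le ht.1).ne'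
  have h := sum_mul_eq_sub_integral_mul₀ (f := fun t : ℝ => t ^ (-σ)) c hc y
    (fun t ht => (hd t (zero_lt_one.trans_le ht.1)).differentiableAt)
    ((hcont.integrableOn_Icc).congr_fun
      (fun t ht => (hd t (zero_lt_one.trans_le ht.1)).deriv.symm) measurableSet_Icc)
  rw [h, sub_eq_add_neg, ← integral_const_mul, ← integral_neg]
  congr 1
  refine setIntegral_congr_fun measurableSet_Ioc fun t ht => ?_
  rw [(hd t (zero_lt_one.trans ht.1)).deriv]
  ring

/-! ### The function (e^w - 1) / w. -/

section ExpMean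

/-- The mean of `v ↦ e^{wv}` over `[0, 1]`, that is `(e^w - 1) / w`. -/
noncomputable def expMean (w : ℝ) : ℝ := ∫ v in (0 : ℝ)..1, Real.exp (w * v)

theorem intervalIntegrable_exp_mul (w a b : ℝ) :
    IntervalIntegrable (fun v => Real.exp (w * v)) volume a b :=
  (by fun_prop : Continuous fun v => Real.exp (w * v)).intervalIntegrable _ _

theorem mul_expMean (w : ℝ) : w * expMean w = Real.exp w - 1 := by
  have h : ∀ v ∈ Set.uIcc (0 : ℝ) 1, HasDerivAt (fun v => Real.exp (w * v)) (w * Real.exp (w * v)) v := by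
    intro v _
    have := ((hasDerivAt_id v).const_mul w).exp
    simpa [mul_comm] using! this
  have hi := intervalIntegral.integral_eq_sub_of_hasDerivAt h
    ((intervalIntegrable_exp_mul w 0 1).const_mul w)
  rw [intervalIntegral.integral_const_mul] at hi
  rw [expMean, hi]
  simp

theorem expMean_eq {w : ℝ} (hw : w ≠ 0) : expMean w = (Real.exp w - 1) / w := by
  rw [← mul_expMean, mul_div_cancel_left₀ _ hw]

theorem expMean_zero : expMean 0 = 1 := by simp [expMean]

theorem integral_sub_half : ∫ v in (0 : ℝ)..1, (v - 1 / 2) = 0 := by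
  rw [intervalIntegral.integral_sub (f := fun v : ℝ => v) (continuous_id.intervalIntegrable _ _)
    intervalIntegrable_const, integral_id]
  norm_num

/-- Jensen's inequality, proved by the tangent line of the exponential at the midpoint. -/
theorem exp_half_le_expMean (w : ℝ) : Real.exp (w / 2) ≤ expMean w := by
  have h1 : ∫ v in (0 : ℝ)..1, Real.exp (w / 2) * (1 + w * (v - 1 / 2)) = Real.exp (w / 2) := by
    rw [intervalIntegral.integral_const_mul, intervalIntegral.integral_add intervalIntegrable_const
      ((by fun_prop : Continuous fun v : ℝ => w * (v - 1 / 2)).intervalIntegrable _ _),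
      intervalIntegral.integral_const_mul, integral_sub_half]
    simp
  rw [← h1]
  refine intervalIntegral.integral_mono_on zero_le_one
    ((by fun_prop : Continuous fun v : ℝ => Real.exp (w / 2) * (1 + w * (v - 1 / 2))).intervalIntegrable
      _ _) (intervalIntegrable_exp_mul w 0 1) fun v _ => ?_
  have h2 : Real.exp (w * v) = Real.exp (w / 2) * Real.exp (w * (v - 1 / 2)) := by
    rw [← Real.exp_add]; ring_nf
  rw [h2]
  refine mul_le_mul_of_nonneg_left ?_ (Real.exp_pos _).le
  linarith [Real.add_one_le_exp (w * (v - 1 / 2))]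

theorem expMean_pos (w : ℝ) : 0 < expMean w := (Real.exp_pos _).trans_le (exp_half_le_expMean w)

theorem half_le_expMean {w : ℝ} (hw : -1 ≤ w) : 1 / 2 ≤ expMean w := by
  refine le_trans ?_ (exp_half_le_expMean w)
  linarith [Real.add_one_le_exp (w / 2)]

/-- The logarithmic derivative of `expMean` is at least 1/6 for w ≥ -1. For w ≥ 0 the weight e^(wv)
increases in v, so the mean of v against it is at least 1/2; for -1 ≤ w ≤ 0 the weight lies between
1/3 and 1. This makes the equation `expMean w = u` stable. -/
theorem expMean_add_ge {w h : ℝ} (hw : -1 ≤ w) (hh : 0 ≤ h) :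
    expMean w * (1 + h / 6) ≤ expMean (w + h) := by
  have hcont : Continuous fun v : ℝ => v * Real.exp (w * v) := by fun_prop
  have h1 : expMean w / 6 ≤ ∫ v in (0 : ℝ)..1, v * Real.exp (w * v) := by
    rcases le_total 0 w with h0 | h0
    · have h2 : (0 : ℝ) ≤ ∫ v in (0 : ℝ)..1, (v - 1 / 2) * Real.exp (w * v) := by
        have h3 : ∫ v in (0 : ℝ)..1, (v - 1 / 2) * Real.exp (w / 2) = 0 := by
          rw [intervalIntegral.integral_mul_const, integral_sub_half, zero_mul]
        refine h3.symm.le.trans ?_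
        refine intervalIntegral.integral_mono_on zero_le_one
          ((by fun_prop : Continuous fun v : ℝ => (v - 1 / 2) * Real.exp (w / 2)).intervalIntegrable _ _)
          ((by fun_prop : Continuous fun v : ℝ => (v - 1 / 2) * Real.exp (w * v)).intervalIntegrable _ _)
          fun v _ => ?_
        rcases le_total v (1 / 2) with hv | hv
        · refine mul_le_mul_of_nonpos_left (Real.exp_le_exp.2 ?_) (by linarith)
          nlinarith
        · refine mul_le_mul_of_nonneg_left (Real.exp_le_exp.2 ?_) (by linarith)
          nlinarith
      have h4 : ∫ v in (0 : ℝ)..1, (v - 1 / 2) * Real.exp (w * v) =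
          (∫ v in (0 : ℝ)..1, v * Real.exp (w * v)) - 1 / 2 * expMean w := by
        rw [expMean, ← intervalIntegral.integral_const_mul, ← intervalIntegral.integral_sub
          (hcont.intervalIntegrable _ _) ((intervalIntegrable_exp_mul w 0 1).const_mul _)]
        congr 1
        ext v
        ring
      have := expMean_pos w
      linarith
    · have h2 : expMean w ≤ 1 := by
        have : expMean w ≤ ∫ v in (0 : ℝ)..1, (1 : ℝ) := by
          refine intervalIntegral.integral_mono_on zero_le_one (intervalIntegrable_exp_mul w 0 1)
            (by simp) fun v hv => ?_
          rw [Real.exp_le_one_iff]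
          exact mul_nonpos_of_nonpos_of_nonneg h0 hv.1
        simpa using this
      have h3 : ∫ v in (0 : ℝ)..1, v * (1 / 3 : ℝ) = 1 / 6 := by
        rw [intervalIntegral.integral_mul_const, integral_id]
        norm_num
      have h4 : ∫ v in (0 : ℝ)..1, v * (1 / 3 : ℝ) ≤ ∫ v in (0 : ℝ)..1, v * Real.exp (w * v) := by
        refine intervalIntegral.integral_mono_on zero_le_one
          ((by fun_prop : Continuous fun v : ℝ => v * (1 / 3 : ℝ)).intervalIntegrable _ _)
          (hcont.intervalIntegrable _ _) fun v hv => ?_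
        refine mul_le_mul_of_nonneg_left ?_ hv.1
        have h5 : Real.exp (-1) ≤ Real.exp (w * v) := Real.exp_le_exp.2 (by nlinarith [hv.1, hv.2])
        refine le_trans ?_ h5
        rw [Real.exp_neg, one_div]
        exact inv_anti₀ (Real.exp_pos _) (by linarith [Real.exp_one_lt_d9])
      linarith
  have h5 : expMean w + h * ∫ v in (0 : ℝ)..1, v * Real.exp (w * v) ≤ expMean (w + h) := by
    rw [expMean, ← intervalIntegral.integral_const_mul, ← intervalIntegral.integral_add
      (intervalIntegrable_exp_mul w 0 1) ((hcont.intervalIntegrable _ _).const_mul _)]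
    refine intervalIntegral.integral_mono_on zero_le_one
      ((intervalIntegrable_exp_mul w 0 1).add ((hcont.intervalIntegrable _ _).const_mul _))
      (intervalIntegrable_exp_mul (w + h) 0 1) fun v hv => ?_
    have h6 : Real.exp ((w + h) * v) = Real.exp (w * v) * Real.exp (h * v) := by
      rw [← Real.exp_add]; ring_nf
    rw [h6]
    have := Real.add_one_le_exp (h * v)
    nlinarith [Real.exp_pos (w * v)]
  nlinarith

/-- Boundary terms of Abel summation have size e^w; this compares them with the main term L ·
`expMean w`. -/
theorem exp_le_mul_expMean {w L : ℝ} (hw : -1 ≤ w) (hwL : w ≤ L) (hL : 1 ≤ L) :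
    Real.exp w ≤ 6 * (L * expMean w) := by
  have hE := expMean_pos w
  rcases le_total 1 w with h | h
  · have h1 := mul_expMean w
    have h2 : 2 ≤ Real.exp w := by linarith [Real.add_one_le_exp w]
    nlinarith
  · have h1 : Real.exp w ≤ 3 := (Real.exp_le_exp.2 h).trans (by linarith [Real.exp_one_lt_d9])
    have h2 := half_le_expMean hw
    nlinarith

end ExpMean

/-! ### The sum over split primes. -/

section PrimeSum

/-- `∑_{p ≤ y, p ≡ 1 (4)} 2 log p / p ^ σ`. -/
noncomputable def splitSum (y σ : ℝ) : ℝ := ∑ n ∈ Finset.Icc 0 ⌊y⌋₊, (n : ℝ) ^ (-σ) * splitWeight n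

theorem integral_rpow_neg_eq {y w σ : ℝ} (hy : 1 < y) (hσ : σ = 1 - w / Real.log y) :
    ∫ t in Set.Ioc 1 y, t ^ (-σ) = Real.log y * expMean w := by
  have hL : 0 < Real.log y := Real.log_pos hy
  have hy0 : 0 < y := by linarith
  rw [← intervalIntegral.integral_of_le hy.le]
  rcases eq_or_ne w 0 with rfl | hw
  · have h1 : -σ = -1 := by rw [hσ]; simp
    rw [h1, expMean_zero, mul_one]
    simp_rw [Real.rpow_neg_one]
    rw [integral_inv_of_pos one_pos hy0, div_one]
  · have hs : -σ + 1 = w / Real.log y := by rw [hσ]; ring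
    have hs0 : w / Real.log y ≠ 0 := div_ne_zero hw hL.ne'
    rw [integral_rpow (Or.inr ⟨fun h => hs0 (by rw [← hs, h]; norm_num), ?_⟩), hs, Real.one_rpow,
      expMean_eq hw, Real.rpow_def_of_pos hy0, mul_div_cancel₀ _ hL.ne']
    · field_simp
    · rw [Set.uIcc_of_le hy.le]
      exact fun h => by linarith [h.1]

theorem rpow_neg_eq_exp {y w σ : ℝ} (hy : 1 < y) (hσ : σ = 1 - w / Real.log y) :
    y ^ (-σ) * y = Real.exp w := by
  have hL : 0 < Real.log y := Real.log_pos hy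
  have hy0 : 0 < y := by linarith
  rw [← Real.rpow_add_one hy0.ne', Real.rpow_def_of_pos hy0]
  congr 1
  rw [hσ]
  field_simp
  ring

/-- The bound is uniform in y because the exponent 4/3 exceeds 1. -/
theorem integral_inv_mul_log_rpow_le {y : ℝ} (hy : 1 ≤ y) :
    IntegrableOn (fun t => t⁻¹ * (1 + Real.log t) ^ (-(4 / 3) : ℝ)) (Set.Ioc 1 y) ∧
    ∫ t in Set.Ioc 1 y, t⁻¹ * (1 + Real.log t) ^ (-(4 / 3) : ℝ) ≤ 3 := by
  have hpos : ∀ t ∈ Set.Icc 1 y, 0 < t ∧ 0 < 1 + Real.log t := fun t ht =>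
    ⟨zero_lt_one.trans_le ht.1, by linarith [Real.log_nonneg ht.1]⟩
  have hc : ContinuousOn (fun t => t⁻¹ * (1 + Real.log t) ^ (-(4 / 3) : ℝ)) (Set.Icc 1 y) := by
    refine (continuousOn_inv₀.mono fun t ht => (hpos t ht).1.ne').mul (ContinuousOn.rpow_const ?_ ?_)
    · exact continuousOn_const.add (Real.continuousOn_log.mono fun t ht => (hpos t ht).1.ne')
    · exact fun t ht => Or.inl (hpos t ht).2.ne'
  refine ⟨hc.integrableOn_Icc.mono_set Set.Ioc_subset_Icc_self, ?_⟩
  have hd : ∀ t ∈ Set.uIcc 1 y, HasDerivAt (fun t => -3 * (1 + Real.log t) ^ (-(1 / 3) : ℝ))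
      (t⁻¹ * (1 + Real.log t) ^ (-(4 / 3) : ℝ)) t := by
    intro t ht
    rw [Set.uIcc_of_le hy] at ht
    obtain ⟨h0, h1⟩ := hpos t ht
    have h := (((Real.hasDerivAt_log h0.ne').const_add 1).rpow_const (p := -(1 / 3)) (Or.inl h1.ne')).const_mul
      (-3)
    convert! h using 1
    rw [show (-(1 / 3) - 1 : ℝ) = -(4 / 3) by norm_num]
    ring
  rw [← intervalIntegral.integral_of_le hy, intervalIntegral.integral_eq_sub_of_hasDerivAt hd
    ((hc.mono (by rw [Set.uIcc_of_le hy])).intervalIntegrable)]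
  have : 0 ≤ (1 + Real.log y) ^ (-(1 / 3) : ℝ) :=
    (Real.rpow_pos_of_pos (hpos y ⟨hy, le_rfl⟩).2 _).le
  simp
  linarith

/-- The sum over split primes is close to its expected value `log y (e^w - 1) / w`
at `σ = 1 - w / log y`. -/
theorem exists_abs_splitSum_sub_le :
    ∃ C : ℝ, 0 ≤ C ∧ ∀ y w σ : ℝ, 1 < y → 1 ≤ Real.log y → -1 ≤ w → w ≤ Real.log y →
      σ = 1 - w / Real.log y →
      |splitSum y σ - Real.log y * expMean w| ≤ C * expMean w := by
  obtain ⟨K, hK0, hK⟩ := exists_abs_splitTheta_sub_le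
  refine ⟨2 + 22 * K, by positivity, ?_⟩
  intro y w σ hy hL hw hwL hσ
  set L := Real.log y with hLdef
  have hL0 : 0 < L := by linarith
  have hy0 : 0 < y := by linarith
  have hE := expMean_pos w
  have hE2 := half_le_expMean hw
  have hσ0 : 0 ≤ σ := by
    rw [hσ, sub_nonneg, div_le_one hL0]; exact hwL
  have hσ2 : σ ≤ 2 := by
    rw [hσ]
    have : -1 ≤ w / L := by rw [le_div_iff₀ hL0]; linarith
    linarith
  have hT := integral_rpow_neg_eq hy hσ
  have hyw := rpow_neg_eq_exp hy hσ
  set R : ℝ → ℝ := fun t => splitTheta t - t with hR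
  have hRm : Measurable R := by
    have h : Measurable fun n : ℕ => ∑ k ∈ Finset.Icc 0 n, splitWeight k := measurable_from_top
    exact (h.comp Nat.measurable_floor).sub measurable_id
  have hpos : ∀ t ∈ Set.Ioc 1 y, 0 < t := fun t ht => zero_lt_one.trans ht.1
  have hI1 : IntegrableOn (fun t : ℝ => t ^ (-σ)) (Set.Ioc 1 y) := by
    refine (ContinuousOn.integrableOn_Icc ?_).mono_set Set.Ioc_subset_Icc_self
    exact ContinuousOn.rpow_const continuousOn_id fun t ht => Or.inl (zero_lt_one.trans_le ht.1).ne'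
  obtain ⟨hI2, hI2le⟩ := integral_inv_mul_log_rpow_le hy.le
  -- The range is split at √y. Below, t^(-σ) is at most 2 E(w) / t, by Jensen when w ≥ 0, and the
  -- error weight is integrable against dt/t. Above, the error weight itself is at most 2/L.
  have hbound : ∀ t ∈ Set.Ioc 1 y, ‖t ^ (-σ - 1) * R t‖ ≤
      K * (2 * expMean w * (t⁻¹ * (1 + Real.log t) ^ (-(4 / 3) : ℝ)) + 2 / L * t ^ (-σ)) := by
    intro t ht
    have ht0 := hpos t ht
    have hlt : 0 ≤ Real.log t := Real.log_nonneg ht.1.le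
    have hltL : Real.log t ≤ L := Real.log_le_log ht0 ht.2
    set P := (1 + Real.log t) ^ (-(4 / 3) : ℝ) with hP
    have hP0 : 0 < P := Real.rpow_pos_of_pos (by linarith) _
    have h1 : ‖t ^ (-σ - 1) * R t‖ ≤ K * (t ^ (-σ) * P) := by
      rw [norm_mul, Real.norm_of_nonneg (by positivity), Real.norm_eq_abs]
      calc t ^ (-σ - 1) * |R t| ≤ t ^ (-σ - 1) * (K * t * P) := by
            gcongr
            exact hK t ht.1.le
        _ = K * ((t ^ (-σ - 1) * t) * P) := by ring
        _ = _ := by rw [← Real.rpow_add_one ht0.ne', sub_add_cancel]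
    refine h1.trans (mul_le_mul_of_nonneg_left ?_ hK0)
    have htσ : 0 < t ^ (-σ) := by positivity
    rcases le_total (Real.log t) (L / 2) with h | h
    · have h2 : t ^ (-σ) ≤ 2 * expMean w * t⁻¹ := by
        have h3 : t ^ (-σ) = Real.exp (w * (Real.log t / L)) * t⁻¹ := by
          rw [Real.rpow_def_of_pos ht0, ← Real.exp_log (inv_pos.2 ht0), ← Real.exp_add, Real.log_inv]
          congr 1
          rw [hσ]
          field_simp
          ring
        rw [h3]
        refine mul_le_mul_of_nonneg_right ?_ (by positivity)
        rcases le_total 0 w with h0 | h0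
        · have h4 : Real.log t / L ≤ 1 / 2 := by rw [div_le_iff₀ hL0]; linarith
          have h5 : Real.exp (w * (Real.log t / L)) ≤ Real.exp (w / 2) :=
            Real.exp_le_exp.2 (by nlinarith)
          linarith [exp_half_le_expMean w]
        · have h5 : Real.exp (w * (Real.log t / L)) ≤ 1 := by
            rw [Real.exp_le_one_iff]
            exact mul_nonpos_of_nonpos_of_nonneg h0 (by positivity)
          linarith
      calc t ^ (-σ) * P ≤ 2 * expMean w * t⁻¹ * P := by gcongr
        _ = 2 * expMean w * (t⁻¹ * P) := by ring
        _ ≤ _ := by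
          have : 0 ≤ 2 / L * t ^ (-σ) := by positivity
          linarith
    · have h2 : P ≤ 2 / L := by
        have h3 : P ≤ (1 + Real.log t) ^ (-1 : ℝ) :=
          Real.rpow_le_rpow_of_exponent_le (by linarith) (by norm_num)
        rw [Real.rpow_neg_one] at h3
        refine h3.trans ?_
        rw [inv_eq_one_div, div_le_div_iff₀ (by linarith) hL0]
        linarith
      calc t ^ (-σ) * P ≤ t ^ (-σ) * (2 / L) := by gcongr
        _ = 2 / L * t ^ (-σ) := by ring
        _ ≤ _ := by
          have : 0 ≤ 2 * expMean w * (t⁻¹ * P) := by positivity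
          linarith
  have hIb : IntegrableOn (fun t => K * (2 * expMean w * (t⁻¹ * (1 + Real.log t) ^ (-(4 / 3) : ℝ)) +
      2 / L * t ^ (-σ))) (Set.Ioc 1 y) := ((hI2.const_mul _).add (hI1.const_mul _)).const_mul _
  have hIR : IntegrableOn (fun t => t ^ (-σ - 1) * R t) (Set.Ioc 1 y) := by
    refine hIb.mono' ?_ ((ae_restrict_iff' measurableSet_Ioc).2 (Eventually.of_forall hbound))
    exact ((measurable_id.pow_const _).mul hRm).aestronglyMeasurable
  have hIRle : |∫ t in Set.Ioc 1 y, t ^ (-σ - 1) * R t| ≤ 8 * K * expMean w := by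
    calc |∫ t in Set.Ioc 1 y, t ^ (-σ - 1) * R t| ≤ ∫ t in Set.Ioc 1 y,
          K * (2 * expMean w * (t⁻¹ * (1 + Real.log t) ^ (-(4 / 3) : ℝ)) + 2 / L * t ^ (-σ)) :=
          norm_integral_le_of_norm_le hIb
            ((ae_restrict_iff' measurableSet_Ioc).2 (Eventually.of_forall hbound))
      _ = K * (2 * expMean w * (∫ t in Set.Ioc 1 y, t⁻¹ * (1 + Real.log t) ^ (-(4 / 3) : ℝ)) +
          2 / L * (L * expMean w)) := by
          rw [integral_const_mul, integral_add (hI2.const_mul _) (hI1.const_mul _),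
            integral_const_mul, integral_const_mul, hT]
      _ ≤ K * (2 * expMean w * 3 + 2 / L * (L * expMean w)) := by gcongr
      _ = _ := by field_simp; ring
  -- With θ(t) replaced by t, the boundary term is e^w and σ L E(w) = L E(w) - e^w + 1, so the two
  -- exponentials cancel.
  have hsum : splitSum y σ = L * expMean w + 1 + y ^ (-σ) * R y +
      σ * ∫ t in Set.Ioc 1 y, t ^ (-σ - 1) * R t := by
    have h1 : ∫ t in Set.Ioc 1 y, t ^ (-σ - 1) * splitTheta t =
        L * expMean w + ∫ t in Set.Ioc 1 y, t ^ (-σ - 1) * R t := by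
      rw [← hT, ← integral_add hI1 hIR]
      refine setIntegral_congr_fun measurableSet_Ioc fun t ht => ?_
      have h2 : t ^ (-σ) = t ^ (-σ - 1) * t := by
        rw [← Real.rpow_add_one (hpos t ht).ne', sub_add_cancel]
      simp only [hR]
      rw [h2]
      ring
    rw [splitSum, sum_rpow_neg_mul_eq splitWeight_zero]
    change y ^ (-σ) * splitTheta y + σ * ∫ t in Set.Ioc 1 y, t ^ (-σ - 1) * splitTheta t = _
    rw [h1]
    have h3 := mul_expMean w
    have h4 : σ * (L * expMean w) = L * expMean w - Real.exp w + 1 := by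
      rw [hσ]
      field_simp
      linear_combination -h3
    simp only [hR]
    linear_combination h4 + hyw
  have hRy : |y ^ (-σ) * R y| ≤ 6 * K * expMean w := by
    have h1 := hK y hy.le
    have h2 : (1 + L) ^ (-(4 / 3) : ℝ) ≤ L⁻¹ := by
      rw [← Real.rpow_neg_one]
      refine (Real.rpow_le_rpow_of_exponent_le (by linarith) (show (-(4 / 3) : ℝ) ≤ -1 by norm_num)).trans ?_
      exact Real.rpow_le_rpow_of_nonpos hL0 (by linarith) (by norm_num)
    rw [abs_mul, abs_of_pos (by positivity)]
    calc y ^ (-σ) * |R y| ≤ y ^ (-σ) * (K * y * L⁻¹) := by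
          gcongr
          exact h1.trans (by gcongr)
      _ = K * Real.exp w * L⁻¹ := by rw [← hyw]; ring
      _ ≤ K * (6 * (L * expMean w)) * L⁻¹ := by
          gcongr
          exact exp_le_mul_expMean hw hwL hL
      _ = _ := by field_simp
  have hlast : |σ * ∫ t in Set.Ioc 1 y, t ^ (-σ - 1) * R t| ≤ 16 * K * expMean w := by
    rw [abs_mul, abs_of_nonneg hσ0]
    calc _ ≤ 2 * (8 * K * expMean w) := by gcongr
      _ = _ := by ring
  rw [hsum, abs_le]
  rw [abs_le] at hRy hlast
  have hKE : 0 ≤ K * expMean w := by positivity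
  constructor <;> linarith [hRy.1, hRy.2, hlast.1, hlast.2]

end PrimeSum

end GaussSmooth

/-! ### Comparison of the saddle point sum with the sum over split primes. -/

namespace GaussSmooth

open Filter Topology MeasureTheory

theorem splitSum_eq_sum_primesUpTo (y σ : ℝ) :
    splitSum y σ = ∑ p ∈ primesUpTo y, (p : ℝ) ^ (-σ) * splitWeight p := by
  have h : primesUpTo y ⊆ Finset.Icc 0 ⌊y⌋₊ := by
    intro p hp
    rw [primesUpTo, Nat.mem_primesBelow] at hp
    rw [Finset.mem_Icc]
    omega
  rw [splitSum]
  refine (Finset.sum_subset h fun n hn hn' => ?_).symm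
  rw [primesUpTo, Nat.mem_primesBelow] at hn'
  rw [Finset.mem_Icc] at hn
  have hp : ¬ n.Prime := fun hp => hn' ⟨by omega, hp⟩
  simp [splitWeight, hp]

theorem splitWeight_div_le_primeTerm {p : ℕ} (hp : p.Prime) {σ a : ℝ} (hσ : 0 < σ)
    (ha : (p : ℝ) ^ σ - 1 ≤ a) : splitWeight p / a ≤ primeTerm p σ := by
  have h1 := one_lt_prime_rpow hp hσ
  have hlog : 0 < Real.log p := Real.log_pos (by exact_mod_cast hp.one_lt)
  unfold splitWeight
  split_ifs with h
  · have h2 : p ≠ 2 := by rintro rfl; omega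
    rw [primeTerm, if_neg h2, if_pos h.2]
    exact div_le_div_of_nonneg_left (by positivity) (by linarith) ha
  · rw [zero_div]
    exact (primeTerm_pos hp hσ).le

theorem rpow_neg_mul_splitWeight_le_primeTerm {p : ℕ} (hp : p.Prime) {σ : ℝ} (hσ : 0 < σ) :
    (p : ℝ) ^ (-σ) * splitWeight p ≤ primeTerm p σ := by
  rw [Real.rpow_neg (by positivity), mul_comm, ← div_eq_mul_inv]
  exact splitWeight_div_le_primeTerm hp hσ (by linarith)

/-- With a = p^σ, one has 1/(a - 1) = (1/a)(1 + 1/(a - 1)) and a - 1 ≥ σ log p. -/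
theorem inv_rpow_sub_one_le {p : ℕ} (hp : p.Prime) {σ : ℝ} (hσ : 0 < σ) :
    1 / ((p : ℝ) ^ σ - 1) ≤ (p : ℝ) ^ (-σ) * (1 + 1 / (σ * Real.log p)) := by
  have h1 := one_lt_prime_rpow hp hσ
  have hlog : 0 < Real.log p := Real.log_pos (by exact_mod_cast hp.one_lt)
  have hp0 : (0 : ℝ) < p := by exact_mod_cast hp.pos
  have h2 : σ * Real.log p + 1 ≤ (p : ℝ) ^ σ := by
    rw [Real.rpow_def_of_pos hp0, mul_comm (Real.log p)]
    exact Real.add_one_le_exp _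
  rw [Real.rpow_neg hp0.le, div_le_iff₀ (by linarith)]
  set a := (p : ℝ) ^ σ
  set t := σ * Real.log p with ht
  have ht0 : 0 < t := by positivity
  have ha : 0 < a := by linarith
  rw [show a⁻¹ * (1 + 1 / t) * (a - 1) = ((t + 1) * (a - 1)) / (a * t) by field_simp,
    le_div_iff₀ (by positivity)]
  nlinarith

/-- What exceeds the first-order term of a split prime is of order p^(-2σ), as is the whole term of
an inert prime. The prime 2 is bounded crudely by 1/σ. -/
theorem primeTerm_le {p : ℕ} (hp : p.Prime) {σ : ℝ} (hσ : 0 < σ) :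
    primeTerm p σ ≤ (p : ℝ) ^ (-σ) * splitWeight p + (if p = 2 then 1 / σ else 0) +
      (2 * Real.log p + 2 / σ) * (p : ℝ) ^ (-(2 * σ)) := by
  have h1 := one_lt_prime_rpow hp hσ
  have hlog : 0 < Real.log p := Real.log_pos (by exact_mod_cast hp.one_lt)
  have hp0 : (0 : ℝ) < p := by exact_mod_cast hp.pos
  have hinv := inv_rpow_sub_one_le hp hσ
  have h2 : (p : ℝ) ^ (-(2 * σ)) = (p : ℝ) ^ (-σ) * (p : ℝ) ^ (-σ) := by
    rw [← Real.rpow_add hp0]; ring_nf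
  have h3 : (p : ℝ) ^ (2 * σ) = (p : ℝ) ^ σ * (p : ℝ) ^ σ := by
    rw [← Real.rpow_add hp0]; ring_nf
  have h4 : (p : ℝ) ^ (-σ) = ((p : ℝ) ^ σ)⁻¹ := Real.rpow_neg hp0.le σ
  have hb : 0 < (p : ℝ) ^ (-σ) := by positivity
  have key : 2 * Real.log p * ((p : ℝ) ^ (-σ) * (1 / ((p : ℝ) ^ σ - 1))) ≤
      (2 * Real.log p + 2 / σ) * (p : ℝ) ^ (-(2 * σ)) := by
    calc _ ≤ 2 * Real.log p * ((p : ℝ) ^ (-σ) * ((p : ℝ) ^ (-σ) * (1 + 1 / (σ * Real.log p)))) := by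
          gcongr
      _ = _ := by rw [h2]; field_simp
  have hE : 0 ≤ (2 * Real.log p + 2 / σ) * (p : ℝ) ^ (-(2 * σ)) := by positivity
  set a := (p : ℝ) ^ σ with ha
  have ha0 : 0 < a := by linarith
  have ha1 : a - 1 ≠ 0 := by linarith
  clear_value a
  unfold primeTerm splitWeight
  rw [← ha]
  by_cases hp2 : p = 2
  · rw [if_pos hp2, if_pos hp2, if_neg (by omega), mul_zero, zero_add]
    have h5 : Real.log p / (a - 1) ≤ 1 / σ := by
      rw [div_le_div_iff₀ (by linarith) hσ]
      have : σ * Real.log p + 1 ≤ a := by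
        rw [ha, Real.rpow_def_of_pos hp0, mul_comm (Real.log p)]
        exact Real.add_one_le_exp _
      linarith
    linarith
  · rw [if_neg hp2, if_neg hp2, add_zero]
    by_cases hp4 : p % 4 = 1
    · rw [if_pos hp4, if_pos ⟨hp, hp4⟩]
      refine le_trans (le_of_eq ?_) (add_le_add_right key _)
      rw [h4]
      field_simp
      ring
    · rw [if_neg hp4, if_neg (by tauto), mul_zero, zero_add]
      refine le_trans ?_ key
      rw [h3, h4, div_eq_mul_one_div]
      refine mul_le_mul_of_nonneg_left ?_ (by positivity)
      rw [← one_div, one_div_mul_one_div]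
      refine one_div_le_one_div_of_le (mul_pos ha0 (by linarith)) ?_
      nlinarith

theorem splitSum_le_saddleSum {y σ : ℝ} (hy : 0 ≤ y) (hσ : 0 < σ) : splitSum y σ ≤ saddleSum y σ := by
  rw [splitSum_eq_sum_primesUpTo]
  exact Finset.sum_le_sum fun p hp =>
    rpow_neg_mul_splitWeight_le_primeTerm ((mem_primesUpTo hy).1 hp).1 hσ

theorem saddleSum_le {y σ : ℝ} (hy : 0 ≤ y) (hσ : 0 < σ) :
    saddleSum y σ ≤ splitSum y σ + 1 / σ +
      ∑ p ∈ primesUpTo y, (2 * Real.log p + 2 / σ) * (p : ℝ) ^ (-(2 * σ)) := by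
  calc saddleSum y σ ≤ ∑ p ∈ primesUpTo y, ((p : ℝ) ^ (-σ) * splitWeight p +
        (if p = 2 then 1 / σ else 0) + (2 * Real.log p + 2 / σ) * (p : ℝ) ^ (-(2 * σ))) :=
        Finset.sum_le_sum fun p hp => primeTerm_le ((mem_primesUpTo hy).1 hp).1 hσ
    _ = splitSum y σ + (∑ p ∈ primesUpTo y, if p = 2 then 1 / σ else 0) +
      ∑ p ∈ primesUpTo y, (2 * Real.log p + 2 / σ) * (p : ℝ) ^ (-(2 * σ)) := by
        rw [Finset.sum_add_distrib, Finset.sum_add_distrib, splitSum_eq_sum_primesUpTo]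
    _ ≤ _ := by
        gcongr
        rw [Finset.sum_ite_eq']
        split_ifs
        · exact le_rfl
        · positivity

theorem sum_primesUpTo_inv_le {y : ℝ} (hy : 1 ≤ y) :
    ∑ p ∈ primesUpTo y, (p : ℝ)⁻¹ ≤ 1 + Real.log y := by
  refine le_trans ?_ (harmonic_floor_le_one_add_log y hy)
  rw [harmonic_eq_sum_Icc]
  push_cast
  refine Finset.sum_le_sum_of_subset_of_nonneg ?_ fun _ _ _ => by positivity
  intro p hp
  obtain ⟨h1, h2⟩ := (mem_primesUpTo (by linarith)).1 hp
  rw [Finset.mem_Icc]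
  exact ⟨h1.one_le, Nat.le_floor h2⟩

theorem sum_primesUpTo_log_mul_rpow_le {y : ℝ} (hy : 1 ≤ y) :
    ∑ p ∈ primesUpTo y, Real.log p * (p : ℝ) ^ (-(1 / 2) : ℝ) ≤ 3 * y ^ (1 / 2 : ℝ) := by
  have hy0 : 0 < y := by linarith
  set c : ℕ → ℝ := fun n => if n.Prime then Real.log n else 0 with hc
  have hθ : ∀ t : ℝ, ∑ n ∈ Finset.Icc 0 ⌊t⌋₊, c n = Chebyshev.theta t := by
    intro t
    rw [Chebyshev.theta, Finset.sum_filter, ← Finset.insert_Icc_add_one_left_eq_Icc (Nat.zero_le _),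
      Finset.sum_insert (by simp)]
    simp [hc]
    rfl
  have h1 : ∑ p ∈ primesUpTo y, Real.log p * (p : ℝ) ^ (-(1 / 2) : ℝ) =
      ∑ n ∈ Finset.Icc 0 ⌊y⌋₊, (n : ℝ) ^ (-(1 / 2) : ℝ) * c n := by
    have h : primesUpTo y = (Finset.Icc 0 ⌊y⌋₊).filter Nat.Prime := by
      ext p
      rw [primesUpTo, Nat.mem_primesBelow, Finset.mem_filter, Finset.mem_Icc]
      exact and_congr_left fun _ => by omega
    rw [h, Finset.sum_filter]
    refine Finset.sum_congr rfl fun n _ => ?_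
    simp only [hc]
    split_ifs <;> ring
  have hlog4 : Real.log 4 ≤ 1.4 := by
    rw [Real.log_four_eq]; linarith [Real.log_two_lt_d9]
  have hlog40 : 0 ≤ Real.log 4 := Real.log_nonneg (by norm_num)
  rw [h1, sum_rpow_neg_mul_eq (by simp [hc])]
  simp_rw [hθ]
  have h2 : y ^ (-(1 / 2) : ℝ) * Chebyshev.theta y ≤ Real.log 4 * y ^ (1 / 2 : ℝ) := by
    calc _ ≤ y ^ (-(1 / 2) : ℝ) * (Real.log 4 * y) := by
          gcongr
          exact Chebyshev.theta_le_log4_mul_x hy0.le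
      _ = Real.log 4 * (y ^ (-(1 / 2) : ℝ) * y) := by ring
      _ = _ := by rw [← Real.rpow_add_one hy0.ne']; norm_num
  have hI : IntegrableOn (fun t : ℝ => t ^ (-(1 / 2) : ℝ)) (Set.Ioc 1 y) := by
    refine (ContinuousOn.integrableOn_Icc ?_).mono_set Set.Ioc_subset_Icc_self
    exact ContinuousOn.rpow_const continuousOn_id fun t ht => Or.inl (zero_lt_one.trans_le ht.1).ne'
  have h3 : ∫ t in Set.Ioc 1 y, t ^ (-(1 / 2) - 1 : ℝ) * Chebyshev.theta t ≤
      ∫ t in Set.Ioc 1 y, Real.log 4 * t ^ (-(1 / 2) : ℝ) := by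
    refine integral_mono_of_nonneg ?_ (hI.const_mul _) ?_
    · refine (ae_restrict_iff' measurableSet_Ioc).2 (Eventually.of_forall fun t ht => ?_)
      have : 0 < t := zero_lt_one.trans ht.1
      exact mul_nonneg (by positivity) (Chebyshev.theta_nonneg t)
    · refine (ae_restrict_iff' measurableSet_Ioc).2 (Eventually.of_forall fun t ht => ?_)
      have ht0 : 0 < t := zero_lt_one.trans ht.1
      calc t ^ (-(1 / 2) - 1 : ℝ) * Chebyshev.theta t ≤ t ^ (-(1 / 2) - 1 : ℝ) * (Real.log 4 * t) := by
            gcongr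
            exact Chebyshev.theta_le_log4_mul_x ht0.le
        _ = Real.log 4 * (t ^ (-(1 / 2) - 1 : ℝ) * t) := by ring
        _ = _ := by rw [← Real.rpow_add_one ht0.ne', sub_add_cancel]
  have h4 : ∫ t in Set.Ioc 1 y, Real.log 4 * t ^ (-(1 / 2) : ℝ) ≤ 2 * Real.log 4 * y ^ (1 / 2 : ℝ) := by
    rw [integral_const_mul, ← intervalIntegral.integral_of_le hy,
      integral_rpow (Or.inl (by norm_num)), show (-(1 / 2) + 1 : ℝ) = 1 / 2 by norm_num, Real.one_rpow]
    nlinarith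
  have h5 : 0 < y ^ (1 / 2 : ℝ) := by positivity
  nlinarith

theorem log_pow_three_mul_rpow_le {y : ℝ} (hy : 1 ≤ y) :
    Real.log y ^ 3 * y ^ (-(1 / 4) : ℝ) ≤ 1728 := by
  have hy0 : 0 < y := by linarith
  have h1 : Real.log y ≤ 12 * y ^ (1 / 12 : ℝ) := by
    have := Real.log_le_rpow_div hy0.le (ε := 1 / 12) (by norm_num)
    linarith
  have h2 : (y ^ (1 / 12 : ℝ)) ^ 3 * y ^ (-(1 / 4) : ℝ) = 1 := by
    rw [← Real.rpow_natCast, ← Real.rpow_mul hy0.le, ← Real.rpow_add hy0]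
    norm_num
  calc Real.log y ^ 3 * y ^ (-(1 / 4) : ℝ) ≤ (12 * y ^ (1 / 12 : ℝ)) ^ 3 * y ^ (-(1 / 4) : ℝ) := by
        have := Real.log_nonneg hy
        gcongr
    _ = 1728 * ((y ^ (1 / 12 : ℝ)) ^ 3 * y ^ (-(1 / 4) : ℝ)) := by ring
    _ = 1728 := by rw [h2, mul_one]

/-- A saving of y^(-1/4) over e^w absorbs two logarithms, leaving a multiple of `expMean w`. -/
theorem log_sq_mul_rpow_le {y w : ℝ} (hy : 1 < y) (hL : 1 ≤ Real.log y) (hw : -1 ≤ w)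
    (hwL : w ≤ Real.log y) :
    Real.log y ^ 2 * (Real.exp w * y ^ (-(1 / 4) : ℝ)) ≤ 10368 * expMean w := by
  have h1 := exp_le_mul_expMean hw hwL hL
  have h2 := log_pow_three_mul_rpow_le hy.le
  have hE := expMean_pos w
  have hy0 : 0 < y := by linarith
  calc _ ≤ Real.log y ^ 2 * ((6 * (Real.log y * expMean w)) * y ^ (-(1 / 4) : ℝ)) := by gcongr
    _ = 6 * expMean w * (Real.log y ^ 3 * y ^ (-(1 / 4) : ℝ)) := by ring
    _ ≤ 6 * expMean w * 1728 := by gcongr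
    _ = _ := by ring

end GaussSmooth

namespace GaussSmooth

/-- There are three ranges of σ. For σ ≥ 3/4 the sum of p^(-2σ) with its weights converges. For 1/4
≤ σ ≤ 3/4 it is at most L² y^(3/4 - σ) = L² e^w y^(-1/4) up to a constant, a power of y below the
main term. For σ ≤ 1/4 the large primes contribute about y^(1 - 2σ) = e^w y^(-σ), the source of the
term with y^(-σ). -/
theorem exists_saddleSum_le :
    ∃ C : ℝ, 0 ≤ C ∧ ∀ y w σ : ℝ, 1 < y → 4 ≤ Real.log y → -1 ≤ w → 2 / Real.log y ≤ σ →
      σ = 1 - w / Real.log y →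
      saddleSum y σ ≤ splitSum y σ + C * expMean w * (1 + Real.log y * y ^ (-σ)) := by
  set M : ℝ := ∑' n : ℕ, (n : ℝ) ^ (-(5 / 4) : ℝ) with hM
  have hMs : Summable fun n : ℕ => (n : ℝ) ^ (-(5 / 4) : ℝ) :=
    Real.summable_nat_rpow.2 (by norm_num)
  have hM0 : 0 ≤ M := tsum_nonneg fun n => by positivity
  refine ⟨200000 + 22 * M, by positivity, ?_⟩
  intro y w σ hy hL hw hσL hσ
  set L := Real.log y with hLdef
  have hL0 : 0 < L := by linarith
  have hy0 : 0 < y := by linarith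
  have hσ0 : 0 < σ := lt_of_lt_of_le (by positivity) hσL
  have hE := expMean_pos w
  have hE2 := half_le_expMean hw
  have hwL : w ≤ L := by
    have : w / L < 1 := by linarith
    exact ((div_lt_one hL0).1 this).le
  have hyw := rpow_neg_eq_exp hy hσ
  have hyσ : 0 < y ^ (-σ) := by positivity
  have hloss := log_sq_mul_rpow_le hy (by linarith) hw hwL
  have hmem : ∀ p ∈ primesUpTo y, 0 < Real.log p ∧ Real.log p ≤ L ∧ (1 : ℝ) ≤ p ∧ (p : ℝ) ≤ y := by
    intro p hp
    obtain ⟨h1, h2⟩ := (mem_primesUpTo hy0.le).1 hp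
    have h3 : (1 : ℝ) < p := by exact_mod_cast h1.one_lt
    exact ⟨Real.log_pos h3, Real.log_le_log (by linarith) h2, h3.le, h2⟩
  have h := saddleSum_le hy0.le hσ0
  have hinv := sum_primesUpTo_inv_le hy.le
  have hexp : y ^ (3 / 4 - σ) = Real.exp w * y ^ (-(1 / 4) : ℝ) := by
    rw [← hyw, ← Real.rpow_add_one hy0.ne', ← Real.rpow_add hy0]
    ring_nf
  suffices hD : 1 / σ + ∑ p ∈ primesUpTo y, (2 * Real.log p + 2 / σ) * (p : ℝ) ^ (-(2 * σ)) ≤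
      (200000 + 22 * M) * expMean w + 72 * (expMean w * (L * y ^ (-σ))) by
    have h1 : 0 ≤ expMean w * (L * y ^ (-σ)) := by positivity
    have h2 : 0 ≤ M * (expMean w * (L * y ^ (-σ))) := by positivity
    linarith
  have hME : 0 ≤ M * expMean w := by positivity
  have hlast : 0 ≤ expMean w * (L * y ^ (-σ)) := by positivity
  rcases le_total (3 / 4) σ with hc | hc
  · have h1 : 1 / σ ≤ 4 / 3 := by
      rw [div_le_iff₀ hσ0]; linarith
    have h2 : ∑ p ∈ primesUpTo y, (2 * Real.log p + 2 / σ) * (p : ℝ) ^ (-(2 * σ)) ≤ 11 * M := by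
      calc _ ≤ ∑ p ∈ primesUpTo y, 11 * (p : ℝ) ^ (-(5 / 4) : ℝ) := by
            refine Finset.sum_le_sum fun p hp => ?_
            obtain ⟨hl0, hlL, hp1, hpy⟩ := hmem p hp
            have h3 : Real.log p ≤ 4 * (p : ℝ) ^ (1 / 4 : ℝ) := by
              have := Real.log_le_rpow_div (x := (p : ℝ)) (by linarith) (ε := 1 / 4) (by norm_num)
              linarith
            have h4 : (1 : ℝ) ≤ (p : ℝ) ^ (1 / 4 : ℝ) := Real.one_le_rpow hp1 (by norm_num)
            have h5 : (p : ℝ) ^ (-(2 * σ)) ≤ (p : ℝ) ^ (-(3 / 2) : ℝ) :=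
              Real.rpow_le_rpow_of_exponent_le hp1 (by linarith)
            have h6 : 2 / σ = 2 * (1 / σ) := by ring
            calc _ ≤ (11 * (p : ℝ) ^ (1 / 4 : ℝ)) * (p : ℝ) ^ (-(3 / 2) : ℝ) := by
                  gcongr
                  linarith
              _ = 11 * ((p : ℝ) ^ (1 / 4 : ℝ) * (p : ℝ) ^ (-(3 / 2) : ℝ)) := by ring
              _ = _ := by
                  rw [← Real.rpow_add (by linarith)]
                  norm_num
        _ = 11 * ∑ p ∈ primesUpTo y, (p : ℝ) ^ (-(5 / 4) : ℝ) := (Finset.mul_sum _ _ _).symm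
        _ ≤ _ := by
            gcongr
            exact hMs.sum_le_tsum _ fun n _ => by positivity
    have h3 : M * (1 / 2) ≤ M * expMean w := by gcongr
    linarith
  have hsq : 1 + L ≤ 2 * L := by linarith
  rcases le_total (1 / 4) σ with hd | hd
  · have h1 : 1 / σ ≤ 4 := by
      rw [div_le_iff₀ hσ0]; linarith
    have h2 : ∑ p ∈ primesUpTo y, (2 * Real.log p + 2 / σ) * (p : ℝ) ^ (-(2 * σ)) ≤
        8 * (L ^ 2 * y ^ (3 / 4 - σ)) := by
      calc _ ≤ ∑ p ∈ primesUpTo y, (4 * L * y ^ (3 / 4 - σ)) * (p : ℝ)⁻¹ := by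
            refine Finset.sum_le_sum fun p hp => ?_
            obtain ⟨hl0, hlL, hp1, hpy⟩ := hmem p hp
            have h6 : 2 / σ = 2 * (1 / σ) := by ring
            have h5 : (p : ℝ) ^ (-(2 * σ)) ≤ y ^ (3 / 4 - σ) * (p : ℝ)⁻¹ := by
              calc (p : ℝ) ^ (-(2 * σ)) ≤ (p : ℝ) ^ ((3 / 4 - σ) + -1) :=
                    Real.rpow_le_rpow_of_exponent_le hp1 (by linarith)
                _ = (p : ℝ) ^ (3 / 4 - σ) * (p : ℝ)⁻¹ := by
                    rw [Real.rpow_add (by linarith), Real.rpow_neg_one]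
                _ ≤ _ := by
                    gcongr
            calc _ ≤ (4 * L) * (y ^ (3 / 4 - σ) * (p : ℝ)⁻¹) := by
                  gcongr
                  linarith
              _ = _ := by ring
        _ = 4 * L * y ^ (3 / 4 - σ) * ∑ p ∈ primesUpTo y, (p : ℝ)⁻¹ := (Finset.mul_sum _ _ _).symm
        _ ≤ 4 * L * y ^ (3 / 4 - σ) * (2 * L) := by
            gcongr
            exact hinv.trans hsq
        _ = _ := by ring
    rw [hexp] at h2
    linarith
  · have h2σ : 2 / σ ≤ L := by
      rw [div_le_iff₀ hσ0]
      rw [div_le_iff₀ hL0] at hσL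
      linarith
    have hhalf : y ^ (1 / 2 : ℝ) ≤ Real.exp w * y ^ (-(1 / 4) : ℝ) := by
      rw [← hexp]
      exact Real.rpow_le_rpow_of_exponent_le hy.le (by linarith)
    have hone : 1 ≤ y ^ (1 / 2 : ℝ) := Real.one_le_rpow hy.le (by norm_num)
    have hL2 : L ^ 2 * y ^ (1 / 2 : ℝ) ≤ 10368 * expMean w := by
      refine le_trans ?_ hloss
      gcongr
    have h1 : 1 / σ ≤ L ^ 2 * y ^ (1 / 2 : ℝ) := by
      have : 2 / σ = 2 * (1 / σ) := by ring
      nlinarith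
    have h2 : ∑ p ∈ primesUpTo y, (2 * Real.log p + 2 / σ) * (p : ℝ) ^ (-(2 * σ)) ≤
        12 * (y ^ (1 / 2 - 2 * σ) * y ^ (1 / 2 : ℝ)) + 2 * (L ^ 2 * y ^ (1 / 2 : ℝ)) := by
      calc _ ≤ ∑ p ∈ primesUpTo y, ((4 * y ^ (1 / 2 - 2 * σ)) * (Real.log p * (p : ℝ) ^ (-(1 / 2) : ℝ)) +
            (L * y ^ (1 / 2 : ℝ)) * (p : ℝ)⁻¹) := by
            refine Finset.sum_le_sum fun p hp => ?_
            obtain ⟨hl0, hlL, hp1, hpy⟩ := hmem p hp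
            have hp0 : (0 : ℝ) < p := by linarith
            have h5 : (p : ℝ) ^ (-(2 * σ)) ≤ y ^ (1 / 2 - 2 * σ) * (p : ℝ) ^ (-(1 / 2) : ℝ) := by
              calc (p : ℝ) ^ (-(2 * σ)) = (p : ℝ) ^ (1 / 2 - 2 * σ) * (p : ℝ) ^ (-(1 / 2) : ℝ) := by
                    rw [← Real.rpow_add hp0]; ring_nf
                _ ≤ _ := by
                    gcongr
                    linarith
            have h6 : 2 * Real.log p * (p : ℝ) ^ (-(2 * σ)) ≤
                2 * Real.log p * (y ^ (1 / 2 - 2 * σ) * (p : ℝ) ^ (-(1 / 2) : ℝ)) := by gcongr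
            -- The weight 2/σ can be as large as L. For p ≥ √y it is comparable with log p; for p ≤
            -- √y the bound p^(-2σ) ≤ 1 ≤ √y / p is enough.
            have h7 : L * (p : ℝ) ^ (-(2 * σ)) ≤
                2 * Real.log p * (y ^ (1 / 2 - 2 * σ) * (p : ℝ) ^ (-(1 / 2) : ℝ)) +
                  (L * y ^ (1 / 2 : ℝ)) * (p : ℝ)⁻¹ := by
              rcases le_total L (2 * Real.log p) with h8 | h8
              · have : 0 ≤ (L * y ^ (1 / 2 : ℝ)) * (p : ℝ)⁻¹ := by positivity
                have : L * (p : ℝ) ^ (-(2 * σ)) ≤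
                  2 * Real.log p * (y ^ (1 / 2 - 2 * σ) * (p : ℝ) ^ (-(1 / 2) : ℝ)) := by gcongr
                linarith
              · have h9 : (p : ℝ) ≤ y ^ (1 / 2 : ℝ) := by
                  rw [Real.rpow_def_of_pos hy0]
                  exact (Real.log_le_iff_le_exp hp0).1 (by linarith)
                have h10 : (p : ℝ) ^ (-(2 * σ)) ≤ y ^ (1 / 2 : ℝ) * (p : ℝ)⁻¹ := by
                  refine (Real.rpow_le_one_of_one_le_of_nonpos hp1 (by linarith)).trans ?_
                  rw [← div_eq_mul_inv, le_div_iff₀ hp0, one_mul]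
                  exact h9
                have : 0 ≤ 2 * Real.log p * (y ^ (1 / 2 - 2 * σ) * (p : ℝ) ^ (-(1 / 2) : ℝ)) := by
                  positivity
                have : L * (p : ℝ) ^ (-(2 * σ)) ≤ L * (y ^ (1 / 2 : ℝ) * (p : ℝ)⁻¹) := by gcongr
                linarith
            have h8 : 2 / σ * (p : ℝ) ^ (-(2 * σ)) ≤ L * (p : ℝ) ^ (-(2 * σ)) := by gcongr
            rw [add_mul]
            linarith
        _ = 4 * y ^ (1 / 2 - 2 * σ) * (∑ p ∈ primesUpTo y, Real.log p * (p : ℝ) ^ (-(1 / 2) : ℝ)) +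
            L * y ^ (1 / 2 : ℝ) * ∑ p ∈ primesUpTo y, (p : ℝ)⁻¹ := by
            rw [Finset.sum_add_distrib, Finset.mul_sum, Finset.mul_sum]
        _ ≤ 4 * y ^ (1 / 2 - 2 * σ) * (3 * y ^ (1 / 2 : ℝ)) + L * y ^ (1 / 2 : ℝ) * (2 * L) := by
            gcongr
            · exact sum_primesUpTo_log_mul_rpow_le hy.le
            · exact hinv.trans hsq
        _ = _ := by ring
    have h3 : y ^ (1 / 2 - 2 * σ) * y ^ (1 / 2 : ℝ) = Real.exp w * y ^ (-σ) := by
      rw [← hyw, ← Real.rpow_add hy0, ← Real.rpow_add_one hy0.ne', ← Real.rpow_add hy0]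
      congr 1
      ring
    have h4 : Real.exp w * y ^ (-σ) ≤ 6 * (L * expMean w) * y ^ (-σ) := by
      gcongr
      exact exp_le_mul_expMean hw hwL (by linarith)
    rw [h3] at h2
    linarith

/-- The saddle point sum is close to `log y (e^w - 1) / w` at `σ = 1 - w / log y`. -/
theorem exists_saddleSum_bounds :
    ∃ C : ℝ, 0 ≤ C ∧ ∀ y w σ : ℝ, 1 < y → 4 ≤ Real.log y → -1 ≤ w → 2 / Real.log y ≤ σ →
      σ = 1 - w / Real.log y →
      Real.log y * expMean w - C * expMean w ≤ saddleSum y σ ∧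
      saddleSum y σ ≤ Real.log y * expMean w + C * expMean w * (1 + Real.log y * y ^ (-σ)) := by
  obtain ⟨C₁, h10, h1⟩ := exists_abs_splitSum_sub_le
  obtain ⟨C₂, h20, h2⟩ := exists_saddleSum_le
  refine ⟨C₁ + C₂, by positivity, ?_⟩
  intro y w σ hy hL hw hσL hσ
  have hL0 : 0 < Real.log y := by linarith
  have hy0 : 0 < y := by linarith
  have hσ0 : 0 < σ := lt_of_lt_of_le (by positivity) hσL
  have hE := expMean_pos w
  have hwL : w ≤ Real.log y := by
    have : w / Real.log y < 1 := by linarith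
    exact ((div_lt_one hL0).1 this).le
  have h3 := abs_le.1 (h1 y w σ hy (by linarith) hw hwL hσ)
  have h4 := h2 y w σ hy hL hw hσL hσ
  have h5 := splitSum_le_saddleSum hy0.le hσ0
  have h6 : 0 ≤ C₂ * expMean w := by positivity
  have h7 : 0 ≤ C₁ * expMean w * (Real.log y * y ^ (-σ)) := by positivity
  constructor <;> linarith [h3.1, h3.2]

end GaussSmooth

/-! ### The function ξ(u), trial values of σ, and stability. -/

namespace GaussSmooth

/-- Dividing e^ξ = 1 + uξ by ξ gives an equation that also covers u = 1, ξ = 0. -/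
theorem xi_spec {u : ℝ} (hu : 1 ≤ u) : 0 ≤ xi u ∧ expMean (xi u) = u := by
  rcases hu.eq_or_lt with rfl | hu
  · rw [xi, dif_neg (lt_irrefl _), expMean_zero]
    exact ⟨le_rfl, rfl⟩
  · rw [xi, dif_pos hu]
    obtain ⟨h0, h1⟩ := (existsUnique_xi hu).choose_spec.1
    generalize (existsUnique_xi hu).choose = ξ at h0 h1
    refine ⟨?_, ?_⟩
    · have := Real.add_one_le_exp ξ
      by_contra! h
      nlinarith
    · rw [expMean_eq h0, h1]
      field_simp
      ring

theorem log_le_xi {u : ℝ} (hu : 1 ≤ u) : Real.log u ≤ xi u := by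
  obtain ⟨h0, h1⟩ := xi_spec hu
  rw [Real.log_le_iff_le_exp (by linarith)]
  rcases h0.eq_or_lt with h | h
  · rw [← h, expMean_zero] at h1
    rw [← h, Real.exp_zero, h1]
  · have h2 := mul_expMean (xi u)
    have h3 := Real.add_one_le_exp (-xi u)
    have h4 : Real.exp (-xi u) * Real.exp (xi u) = 1 := by rw [← Real.exp_add]; simp
    rw [h1] at h2
    have h5 := Real.exp_pos (xi u)
    refine le_of_mul_le_mul_left ?_ h
    nlinarith

theorem xi_le_two_mul_log {u : ℝ} (hu : 1 ≤ u) : xi u ≤ 2 * Real.log u := by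
  have h1 := exp_half_le_expMean (xi u)
  rw [(xi_spec hu).2] at h1
  have := (Real.le_log_iff_exp_le (by linarith)).2 h1
  linarith

/-- `ξ(u) = log (u log u) + O(log log u / log u)`. -/
theorem abs_xi_sub_log_le {u : ℝ} (hu : 3 ≤ u) :
    |xi u - Real.log (u * Real.log u)| ≤ 21 * (Real.log (Real.log u) / Real.log u) := by
  have hu1 : 1 ≤ u := by linarith
  have h1 := log_le_xi hu1
  have h2 := xi_le_two_mul_log hu1
  have hℓ : (1.09 : ℝ) ≤ Real.log u := by
    have := Real.log_le_log (by norm_num) hu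
    linarith [Real.log_three_gt_d9]
  set ℓ := Real.log u with hℓdef
  have hℓ0 : 0 < ℓ := by linarith
  -- A positive lower bound for log log u on u ≥ 3 lets the constant log 3 + 1/3 be absorbed, whence
  -- the factor 21.
  have hll : 1 / 13 ≤ Real.log ℓ := by
    have h3 := Real.one_sub_inv_le_log_of_pos hℓ0
    have h4 : ℓ⁻¹ ≤ 12 / 13 := by
      rw [inv_eq_one_div, div_le_div_iff₀ hℓ0 (by norm_num)]
      linarith
    linarith
  have huinv : 1 / u ≤ 1 / 3 := one_div_le_one_div_of_le (by norm_num) hu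
  have huinv0 : 0 < 1 / u := by positivity
  set ξ := xi u with hξ
  have hexp : Real.exp ξ = u * (ξ + 1 / u) := by
    have := mul_expMean ξ
    rw [(xi_spec hu1).2] at this
    field_simp
    linarith
  -- The defining equation in logarithmic form; inserting log u ≤ ξ ≤ 2 log u on the right is one
  -- step of iteration.
  have h5 : ξ = ℓ + Real.log (ξ + 1 / u) := by
    rw [hℓdef, ← Real.log_mul (by linarith) (by linarith), ← hexp, Real.log_exp]
  have h6 : Real.log (ξ + 1 / u) ≤ Real.log 3 + Real.log ℓ := by
    rw [← Real.log_mul (by norm_num) hℓ0.ne']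
    exact Real.log_le_log (by linarith) (by linarith)
  have h7 : ξ - Real.log (u * ℓ) = Real.log ((ξ + 1 / u) / ℓ) := by
    rw [Real.log_mul (by linarith) hℓ0.ne', Real.log_div (by linarith) hℓ0.ne']
    linarith
  rw [h7, abs_of_nonneg (Real.log_nonneg (by rw [le_div_iff₀ hℓ0]; linarith))]
  have h8 := Real.log_le_sub_one_of_pos (x := (ξ + 1 / u) / ℓ) (div_pos (by linarith) hℓ0)
  refine h8.trans ?_
  rw [mul_div_assoc', div_sub_one hℓ0.ne']
  refine div_le_div_of_nonneg_right ?_ hℓ0.le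
  linarith [Real.log_three_lt_d9]

theorem le_alphaG {x y σ : ℝ} (hy : 2 ≤ y) (hx : 1 < x) (hσ : 0 < σ)
    (h : Real.log x ≤ saddleSum y σ) : σ ≤ alphaG x y := by
  obtain ⟨h0, h1⟩ := alphaG_spec hy hx
  rw [← h1] at h
  exact ((saddleSum_strictAntiOn hy).le_iff_ge h0 hσ).1 h

theorem alphaG_le {x y σ : ℝ} (hy : 2 ≤ y) (hx : 1 < x) (hσ : 0 < σ)
    (h : saddleSum y σ ≤ Real.log x) : alphaG x y ≤ σ := by
  obtain ⟨h0, h1⟩ := alphaG_spec hy hx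
  rw [← h1] at h
  exact ((saddleSum_strictAntiOn hy).le_iff_ge hσ h0).1 h

/-- At σ = 2 / log y every p ≤ y has p^σ - 1 ≤ e² - 1 < 7, and `splitTheta y` is at least 7y/8. The
bound y/8 is exactly what the condition u ≤ y / (8 log y) calls for. -/
theorem exists_le_saddleSum_two_div_log :
    ∃ A : ℝ, ∀ y : ℝ, 1 < y → 1 ≤ Real.log y → A ≤ Real.log y →
      y / 8 ≤ saddleSum y (2 / Real.log y) := by
  obtain ⟨K, hK0, hK⟩ := exists_abs_splitTheta_sub_le
  refine ⟨8 * K, ?_⟩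
  intro y hy hL hA
  set L := Real.log y with hLdef
  have hL0 : 0 < L := by linarith
  have hy0 : 0 < y := by linarith
  have h1 : 7 / 8 * y ≤ splitTheta y := by
    have h2 := (abs_le.1 (hK y hy.le)).1
    have h3 : (1 + L) ^ (-(4 / 3) : ℝ) ≤ L⁻¹ := by
      rw [← Real.rpow_neg_one]
      refine (Real.rpow_le_rpow_of_exponent_le (by linarith) (show (-(4 / 3) : ℝ) ≤ -1 by norm_num)).trans ?_
      exact Real.rpow_le_rpow_of_nonpos hL0 (by linarith) (by norm_num)
    have h4 : K * y * (1 + L) ^ (-(4 / 3) : ℝ) ≤ K * y * L⁻¹ := by gcongr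
    have h5 : K * y * L⁻¹ ≤ y / 8 := by
      rw [← div_eq_mul_inv, div_le_div_iff₀ hL0 (by norm_num)]
      nlinarith
    linarith
  have h2 : splitTheta y = ∑ p ∈ primesUpTo y, splitWeight p := by
    have := splitSum_eq_sum_primesUpTo y 0
    simpa [splitSum, splitTheta] using this
  have h3 : splitTheta y / 7 ≤ saddleSum y (2 / L) := by
    rw [h2, Finset.sum_div]
    refine Finset.sum_le_sum fun p hp => ?_
    obtain ⟨hp1, hp2⟩ := (mem_primesUpTo hy0.le).1 hp
    refine splitWeight_div_le_primeTerm hp1 (by positivity) ?_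
    have h4 : (p : ℝ) ^ (2 / L) ≤ y ^ (2 / L) := by gcongr
    have h5 : y ^ (2 / L) = Real.exp 1 * Real.exp 1 := by
      rw [Real.rpow_def_of_pos hy0, mul_div_cancel₀ _ hL0.ne', ← Real.exp_add]
      norm_num
    have h6 := Real.exp_one_lt_d9
    nlinarith [Real.exp_pos 1]
  linarith

theorem half_sq_le_of_log {y : ℝ} (hy : 1 ≤ y) : Real.log y ^ 2 / 2 ≤ y := by
  have h := Real.quadratic_le_exp_of_nonneg (Real.log_nonneg hy)
  rw [Real.exp_log (by linarith)] at h
  linarith [Real.log_nonneg hy]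

/-- Here the constants 4 and 14 meet: (e⁴ - 1)/4 < 13.4, with room for the error terms below 14. -/
theorem saddleSum_one_sub_four_div_le {C y : ℝ} (hy : 1 < y) (hL : 1000 ≤ Real.log y)
    (hC0 : 0 ≤ C) (hC : 100 * C ≤ Real.log y)
    (h : saddleSum y (1 - 4 / Real.log y) ≤ Real.log y * expMean 4 +
      C * expMean 4 * (1 + Real.log y * y ^ (-(1 - 4 / Real.log y)))) :
    saddleSum y (1 - 4 / Real.log y) ≤ 14 * Real.log y := by
  have hy0 : 0 < y := by linarith
  have hyL := half_sq_le_of_log hy.le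
  have h1 := rpow_neg_eq_exp (w := 4) hy rfl
  set L := Real.log y
  have he : Real.exp 4 ≤ 54.6 := by
    rw [show (4 : ℝ) = (4 : ℕ) * 1 by norm_num, Real.exp_nat_mul]
    calc Real.exp 1 ^ 4 ≤ 2.7182818286 ^ 4 := by
          gcongr
          exact Real.exp_one_lt_d9.le
      _ ≤ _ := by norm_num
  have hE : expMean 4 ≤ 13.4 := by
    have := mul_expMean 4
    linarith
  have hE0 := expMean_pos 4
  have h2 : L * y ^ (-(1 - 4 / L)) ≤ 1 := by
    have : y ^ (-(1 - 4 / L)) = Real.exp 4 / y := by rw [← h1]; field_simp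
    rw [this, mul_div_assoc', div_le_one hy0]
    nlinarith
  calc _ ≤ L * expMean 4 + C * expMean 4 * (1 + L * y ^ (-(1 - 4 / L))) := h
    _ ≤ L * expMean 4 + C * expMean 4 * (1 + 1) := by gcongr
    _ = expMean 4 * (L + 2 * C) := by ring
    _ ≤ 13.4 * (L + 2 * C) := by gcongr
    _ ≤ _ := by linarith

/-- Since 1 - 1/e < 0.64, the sum at w = -1 is at most log y, so no saddle point with u ≥ 1 lies to
the right of 1 + 1/log y. This supplies the hypothesis w ≥ -1 of the estimates. -/
theorem saddleSum_one_add_inv_le {C y : ℝ} (hy : 1 < y) (hL : 1000 ≤ Real.log y)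
    (hC0 : 0 ≤ C) (hC : 100 * C ≤ Real.log y)
    (h : saddleSum y (1 - (-1) / Real.log y) ≤ Real.log y * expMean (-1) +
      C * expMean (-1) * (1 + Real.log y * y ^ (-(1 - (-1) / Real.log y)))) :
    saddleSum y (1 - (-1) / Real.log y) ≤ Real.log y := by
  have hy0 : 0 < y := by linarith
  have hyL := half_sq_le_of_log hy.le
  have h1 := rpow_neg_eq_exp (w := -1) hy rfl
  set L := Real.log y
  have he : Real.exp (-1) ≤ 1 := Real.exp_le_one_iff.2 (by norm_num)
  have he2 : 0.36 ≤ Real.exp (-1) := by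
    rw [Real.exp_neg, inv_eq_one_div, le_div_iff₀ (Real.exp_pos 1)]
    linarith [Real.exp_one_lt_d9]
  have hE : expMean (-1) ≤ 0.64 := by
    have := mul_expMean (-1)
    linarith
  have hE0 := expMean_pos (-1)
  have h2 : L * y ^ (-(1 - (-1) / L)) ≤ 1 := by
    have : y ^ (-(1 - (-1) / L)) = Real.exp (-1) / y := by rw [← h1]; field_simp
    rw [this, mul_div_assoc', div_le_one hy0]
    nlinarith
  calc _ ≤ L * expMean (-1) + C * expMean (-1) * (1 + L * y ^ (-(1 - (-1) / L))) := h
    _ ≤ L * expMean (-1) + C * expMean (-1) * (1 + 1) := by gcongr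
    _ = expMean (-1) * (L + 2 * C) := by ring
    _ ≤ 0.64 * (L + 2 * C) := by gcongr
    _ ≤ _ := by linarith

/-- Stability of the equation `expMean ξ = u`. -/
theorem abs_sub_xi_le {C L y w u z : ℝ} (hC0 : 0 ≤ C) (hL : 1 ≤ L) (hC : 100 * C ≤ L) (hy : 0 < y)
    (hu : 1 ≤ u) (hw : -1 ≤ w) (hwL : w ≤ L) (hz : z * y = Real.exp w)
    (h1 : L * expMean w - C * expMean w ≤ u * L)
    (h2 : u * L ≤ L * expMean w + C * expMean w * (1 + L * z)) :
    |w - xi u| ≤ 72 * C * (1 / L + L * u / y) := by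
  have hE := expMean_pos w
  have hL0 : 0 < L := by linarith
  obtain ⟨hξ0, hξ⟩ := xi_spec hu
  have hE2 : expMean w ≤ 2 * u := by
    refine le_of_mul_le_mul_right ?_ hL0
    nlinarith
  -- In the application z is y^(-σ) = e^w / y; this is where the term u/y of the final estimate
  -- originates.
  have hzle : z ≤ 12 * (L * u / y) := by
    have : z = Real.exp w / y := by rw [← hz]; field_simp
    rw [this, mul_div_assoc', div_le_div_iff_of_pos_right hy]
    have := exp_le_mul_expMean hw hwL hL
    nlinarith
  have hLuy : 0 ≤ L * u / y := by positivity
  have hLinv : 0 < 1 / L := by positivity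
  rw [abs_le]
  -- If w is below ξ(u) the upper bound for the sum limits the gap, and the term in z enters; if
  -- above, the lower bound does, without z.
  rcases le_total w (xi u) with h | h
  · have h3 := expMean_add_ge hw (sub_nonneg.2 h)
    rw [add_sub_cancel, hξ] at h3
    have h4 : L * (xi u - w) ≤ 6 * C * (1 + L * z) := by
      refine le_of_mul_le_mul_left ?_ hE
      nlinarith
    have h5 : xi u - w ≤ 6 * C * (1 / L + z) := by
      refine le_of_mul_le_mul_left (h4.trans (le_of_eq ?_)) hL0
      field_simp
    have h6 : 6 * C * (1 / L + z) ≤ 6 * C * (1 / L + 12 * (L * u / y)) := by gcongr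
    have h7 : 0 ≤ C * (1 / L) := by positivity
    have h8 : 0 ≤ C * (L * u / y) := by positivity
    constructor <;> linarith
  · have h3 := expMean_add_ge (w := xi u) (by linarith) (sub_nonneg.2 h)
    rw [add_sub_cancel, hξ] at h3
    have hLC : 0 < L - C := by linarith
    have h4 : (1 + (w - xi u) / 6) * (L - C) ≤ L := by
      refine le_of_mul_le_mul_left ?_ (by linarith : 0 < u)
      calc u * ((1 + (w - xi u) / 6) * (L - C)) = (u * (1 + (w - xi u) / 6)) * (L - C) := by ring
        _ ≤ expMean w * (L - C) := by gcongr
        _ ≤ _ := by linarith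
    have h5 : L * (w - xi u) ≤ 12 * C := by nlinarith
    have h6 : w - xi u ≤ 12 * C * (1 / L) := by
      refine le_of_mul_le_mul_left (h5.trans (le_of_eq ?_)) hL0
      field_simp
    have h7 : 0 ≤ C * (1 / L) := by positivity
    have h8 : 0 ≤ C * (L * u / y) := by positivity
    constructor <;> linarith

end GaussSmooth

/-! ### Assembly of the estimates. -/

namespace GaussSmooth

/-- The saddle point estimates, with explicit thresholds. -/
theorem exists_alphaG_estimates :
    ∃ C A : ℝ, 0 ≤ C ∧ 1000 ≤ A ∧ ∀ y : ℝ, 1 < y → A ≤ Real.log y →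
      (∀ u : ℝ, 1 ≤ u → u ≤ y / (8 * Real.log y) → 2 / Real.log y ≤ alphaG (y ^ u) y) ∧
      (∀ u : ℝ, 14 ≤ u → alphaG (y ^ u) y ≤ 1 - 4 / Real.log y) ∧
      (∀ u : ℝ, 1 ≤ u → u ≤ y / (8 * Real.log y) →
        |alphaG (y ^ u) y - (1 - xi u / Real.log y)| ≤ C * (1 / (Real.log y) ^ 2 + u / y)) := by
  obtain ⟨C, hC0, hC⟩ := exists_saddleSum_bounds
  obtain ⟨A, hA⟩ := exists_le_saddleSum_two_div_log
  refine ⟨72 * C, max (max A (100 * C)) 1000, by positivity, le_max_right _ _, ?_⟩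
  intro y hy1 hyA
  have hLA : A ≤ Real.log y := (le_max_left _ _).trans ((le_max_left _ _).trans hyA)
  have hLC : 100 * C ≤ Real.log y := (le_max_right _ _).trans ((le_max_left _ _).trans hyA)
  have hL : 1000 ≤ Real.log y := (le_max_right _ _).trans hyA
  have hbd := hC y
  have hlow := hA y hy1 (by linarith) hLA
  have hy0 : 0 < y := by linarith
  have hyL := half_sq_le_of_log hy1.le
  have hfour := fun h => saddleSum_one_sub_four_div_le hy1 hL hC0 hLC h
  have hone := fun h => saddleSum_one_add_inv_le hy1 hL hC0 hLC h
  have hlogpow : ∀ u : ℝ, Real.log (y ^ u) = u * Real.log y := fun u => Real.log_rpow hy0 u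
  set L := Real.log y with hLdef
  have hL0 : 0 < L := by linarith
  have hy2 : 2 ≤ y := by nlinarith
  have hx : ∀ u : ℝ, 1 ≤ u → 1 < y ^ u := fun u hu => Real.one_lt_rpow hy1 (by linarith)
  have hsmall : ∀ c : ℝ, c ≤ 1000 → c / L ≤ 1 := fun c hc => by
    rw [div_le_one hL0]; linarith
  have hlower : ∀ u : ℝ, 1 ≤ u → u ≤ y / (8 * L) → 2 / L ≤ alphaG (y ^ u) y := by
    intro u hu1 hu2
    refine le_alphaG hy2 (hx u hu1) (by positivity) ?_
    rw [hlogpow]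
    refine le_trans ?_ hlow
    rw [le_div_iff₀ (by positivity)] at hu2
    linarith
  refine ⟨hlower, ?_, ?_⟩
  · intro u hu
    have h6 : 2 / L ≤ 1 - 4 / L := by
      have := hsmall 6 (by norm_num)
      have h : 6 / L = 2 / L + 4 / L := by ring
      linarith
    have hpos : 0 < 2 / L := by positivity
    refine alphaG_le hy2 (hx u (by linarith)) (by linarith) ?_
    rw [hlogpow]
    refine (hfour (hbd 4 _ hy1 (by linarith) (by norm_num) h6 rfl).2).trans ?_
    gcongr
  · intro u hu1 hu2
    obtain ⟨hα0, hαS⟩ := alphaG_spec hy2 (hx u hu1)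
    rw [hlogpow] at hαS
    have hα2 := hlower u hu1 hu2
    have hα1 : alphaG (y ^ u) y ≤ 1 - (-1) / L := by
      have h1 : 2 / L ≤ 1 - (-1) / L := by
        have := hsmall 2 (by norm_num)
        have h : 0 < 1 / L := by positivity
        have h' : (-1) / L = -(1 / L) := by ring
        linarith
      refine alphaG_le hy2 (hx u hu1) (lt_of_lt_of_le (by positivity) h1) ?_
      rw [hlogpow]
      refine (hone (hbd (-1) _ hy1 (by linarith) le_rfl h1 rfl).2).trans ?_
      nlinarith
    set α := alphaG (y ^ u) y
    -- The a priori bounds 2/L ≤ α ≤ 1 + 1/L place w in the range where the sum estimates hold at σ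
    -- = α.
    set w := (1 - α) * L with hw
    have hαw : α = 1 - w / L := by rw [hw]; field_simp; ring
    have hw1 : -1 ≤ w := by
      have : (1 - (-1) / L - α) * L = w + 1 := by rw [hw]; field_simp; ring
      have h2 : 0 ≤ (1 - (-1) / L - α) * L := mul_nonneg (by linarith) hL0.le
      linarith
    have hwL : w ≤ L := by rw [hw]; nlinarith
    obtain ⟨h1, h2⟩ := hbd w α hy1 (by linarith) hw1 hα2 hαw
    rw [hαS] at h1 h2
    have h3 := abs_sub_xi_le hC0 (by linarith) hLC hy0 hu1 hw1 hwL (rpow_neg_eq_exp hy1 hαw) h1 h2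
    have h4 : α - (1 - xi u / L) = -((w - xi u) / L) := by rw [hαw]; ring
    rw [h4, abs_neg, abs_div, abs_of_pos hL0, div_le_iff₀ hL0]
    refine h3.trans (le_of_eq ?_)
    field_simp

end GaussSmooth

theorem proposition3p2 :
    (∀ x y : ℝ, 2 ≤ y → y ≤ x → ∃! α : ℝ, GaussSmooth.IsSaddlePoint x y α) ∧
    ∃ C > (0 : ℝ), ∃ y₀ ≥ (2 : ℝ), ∀ y : ℝ, y₀ ≤ y →
      (∀ u : ℝ, 1 ≤ u → u ≤ y / (8 * Real.log y) →
        2 / Real.log y ≤ GaussSmooth.alphaG (y ^ u) y) ∧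
      (∀ u : ℝ, 1 ≤ u → u ≤ 14 →
        |GaussSmooth.alphaG (y ^ u) y - 1| ≤ C * (1 / Real.log y)) ∧
      (∀ u : ℝ, 14 ≤ u →
        GaussSmooth.alphaG (y ^ u) y ≤ 1 - 4 / Real.log y) ∧
      (∀ u : ℝ, 1 ≤ u → u ≤ y / (8 * Real.log y) →
        |GaussSmooth.alphaG (y ^ u) y - (1 - GaussSmooth.xi u / Real.log y)| ≤
          C * (1 / (Real.log y) ^ 2 + u / y)) ∧
      (∀ u : ℝ, 3 ≤ u → u ≤ y / (8 * Real.log y) →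
        |GaussSmooth.alphaG (y ^ u) y - (1 - Real.log (u * Real.log u) / Real.log y)| ≤
          C * (Real.log (Real.log u) / (Real.log u * Real.log y)
            + 1 / (Real.log y) ^ 2 + u / y)) := by
  refine ⟨fun x y hy hx => GaussSmooth.existsUnique_isSaddlePoint hy (by linarith), ?_⟩
  obtain ⟨C, A, hC0, hA, h⟩ := GaussSmooth.exists_alphaG_estimates
  refine ⟨26 + 2 * C, by positivity, Real.exp A, ?_, ?_⟩
  · linarith [Real.add_one_le_exp A]
  intro y hy
  have hyA := Real.add_one_le_exp A
  have hy1 : 1 < y := by linarith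
  have hy0 : 0 < y := by linarith
  have hLA : A ≤ Real.log y := (Real.le_log_iff_exp_le hy0).2 hy
  obtain ⟨h1, h3, h4⟩ := h y hy1 hLA
  have hyL := GaussSmooth.half_sq_le_of_log hy1.le
  set L := Real.log y
  have hL0 : 0 < L := by linarith
  refine ⟨h1, ?_, h3, ?_, ?_⟩
  · intro u hu1 hu2
    -- The inequality y ≥ L²/2 gives y / (8L) ≥ L/16 > 14, so bounded u lies in the range of the
    -- estimate involving ξ.
    have hu3 : u ≤ y / (8 * L) := by
      rw [le_div_iff₀ (by positivity)]
      nlinarith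
    have h5 := h4 u hu1 hu3
    obtain ⟨hξ0, -⟩ := GaussSmooth.xi_spec hu1
    -- From ξ(u) ≤ 2 log u ≤ 2(u - 1) and u ≤ 14.
    have hξ : GaussSmooth.xi u ≤ 26 := by
      have := GaussSmooth.xi_le_two_mul_log hu1
      have := Real.log_le_sub_one_of_pos (show 0 < u by linarith)
      linarith
    have h6 : u / y ≤ 1 / L := by
      rw [div_le_div_iff₀ hy0 hL0]
      rw [le_div_iff₀ (by positivity)] at hu3
      nlinarith
    have h7 : 1 / L ^ 2 ≤ 1 / L := one_div_le_one_div_of_le hL0 (by nlinarith)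
    have h8 : C * (1 / L ^ 2 + u / y) ≤ C * (1 / L + 1 / L) := by gcongr
    have h9 : GaussSmooth.xi u / L ≤ 26 * (1 / L) := by
      rw [mul_one_div]
      gcongr
    have h10 : 0 ≤ GaussSmooth.xi u / L := by positivity
    have h11 : 0 < 1 / L := by positivity
    rw [abs_le] at h5 ⊢
    constructor <;> linarith [h5.1, h5.2]
  · intro u hu1 hu2
    refine (h4 u hu1 hu2).trans ?_
    gcongr
    linarith
  · intro u hu1 hu2
    have h5 := h4 u (by linarith) hu2
    have h6 := GaussSmooth.abs_xi_sub_log_le hu1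
    set R := Real.log (Real.log u) / (Real.log u * L) with hR
    have h7 : |GaussSmooth.xi u / L - Real.log (u * Real.log u) / L| ≤ 21 * R := by
      rw [← sub_div, abs_div, abs_of_pos hL0, div_le_iff₀ hL0]
      refine h6.trans (le_of_eq ?_)
      rw [hR]
      field_simp
    have hR0 : 0 ≤ R := by linarith [abs_nonneg (GaussSmooth.xi u / L - Real.log (u * Real.log u) / L)]
    have h8 : 0 ≤ 1 / L ^ 2 + u / y := by positivity
    have h9 : 0 ≤ C * R := by positivity
    have h10 : 0 ≤ C * (1 / L ^ 2 + u / y) := by positivity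
    rw [abs_le] at h5 h7 ⊢
    constructor <;> linarith [h5.1, h5.2, h7.1, h7.2]
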